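/- Let $L>0$, let $\rho,a\in BV(0,L)$ satisfy $0<\rho_0\le\rho(x)\le\rho_1$ and $0<a_0\le a(x)\le a_1$ for a.e. $x\in(0,L)$ (with constants $\rho_0,\rho_1,a_0,a_1$), and put $\beta=\operatorname{ess\,sup}_{x\in[0,L]}\sqrt{\rho(x)/a(x)}$. Let $L\beta<T<\infty$. For $y_0\in H^1(0,L)$, $y_1\in L^2(0,L)$ and $u\in L^2(0,T)$ consider $$\begin{cases}\rho(x)y_{tt}-(a(x)y_x)_x=0, & 0<x<L,\ 0<t<T,\\ y(x,0)=y_0(x),\ y_t(x,0)=y_1(x), & 0<x<L,\\ y_x(0,t)=u(t),\ y_x(L,t)=0, & 0<t<T.\end{cases}\qquad(*)$$ A finite energy solution of $(*)$ is a function $y\in C([0,T];H^1(0,L))$ with $y_t\in C([0,T];L^2(0,L))$, $y(\cdot,0)=y_0$, $y_t(\cdot,0)=y_1$, such that for every $v\in H^1(0,L)$, in the sense of distributions on $(0,T)$, $$\frac{d}{dt}\int_0^L\rho\,y_t\,v\,dx+\int_0^L a\,y_x\,v_x\,dx+a(0^+)\,u(t)\,v(0)=0.$$ Elements of $H^1$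 of an interval are identified with their continuous representatives on the closed interval. Let $y_0\in H^1(0,L)$ and $y_1\in L^2(0,L)$. Then $(*)$ with $u=0$ has a unique finite energy solution $w$. Moreover, for every $p\in H^1(L\beta,T)$ with $p(L\beta)=w(L,L\beta)$ there exists a control $u\in L^2(0,T)$ such that $(*)$ has a unique finite energy solution $y$, and this solution satisfies $$y(L,t)=p(t)\qquad\text{for all } t\in(L\beta,T).$$ In particular, if $y_0=y_1=0$, then $w=0$ and the condition on $p$ is $p(L\beta)=0$. -/

import Mathlib

open Set Filter Topology MeasureTheory
open scoped ContDiff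

/-- Lebesgue measure on the open interval `(c, d)`. -/
noncomputable abbrev volOn (c d : ℝ) : Measure ℝ := volume.restrict (Ioo c d)

/-- `g` is the weak (distributional) derivative of `f` on `(c, d)`:
`∫ f φ' = - ∫ g φ` for every test function `φ ∈ C_c^∞(c, d)`. -/
def HasWeakDeriv (c d : ℝ) (f g : ℝ → ℝ) : Prop :=
  ∀ φ : ℝ → ℝ, ContDiff ℝ ∞ φ → HasCompactSupport φ → tsupport φ ⊆ Ioo c d →
    ∫ x in Ioo c d, f x * deriv φ x = - ∫ x in Ioo c d, g x * φ x

/-- `f` is (the continuous representative on `[c, d]` of) an element of `H¹(c, d)` and `g` is its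
weak derivative, `g ∈ L²(c, d)`. -/
structure IsH1With (c d : ℝ) (f g : ℝ → ℝ) : Prop where
  continuousOn : ContinuousOn f (Icc c d)
  memLp : MemLp g 2 (volOn c d)
  hasWeakDeriv : HasWeakDeriv c d f g

/-- `f` is (the continuous representative on `[c, d]` of) an element of the Sobolev space
`H¹(c, d)`. Point values of `f`, including those at the end points, make sense. -/
def MemH1 (c d : ℝ) (f : ℝ → ℝ) : Prop := ∃ g : ℝ → ℝ, IsH1With c d f g

/-- `y` is a finite energy solution, with `Y t`, `Yx t`, `Yt t` the elements of `L²(0, L)` given by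
`y(·, t)`, `y_x(·, t)`, `y_t(·, t)`, of the system
`ρ y_tt - (a y_x)_x = 0` in `(0, L) × (0, T)`, `y(·, 0) = y₀`, `y_t(·, 0) = y₁`,
`y_x(0, ·) = u`, `y_x(L, ·) = 0`. -/
structure IsFiniteEnergySolutionWith (ρ a : ℝ → ℝ) (L T : ℝ) (y₀ y₁ u : ℝ → ℝ) (y : ℝ → ℝ → ℝ)
    (Y Yx Yt : ℝ → Lp ℝ 2 (volOn 0 L)) : Prop where
  /-- `Y t` is the class of `y(·, t)`. -/
  ae_eq : ∀ t ∈ Icc 0 T, Y t =ᵐ[volOn 0 L] fun x => y x t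
  /-- `y(·, t)` is the continuous representative of an element of `H¹(0, L)`, with weak
  derivative `Yx t`. -/
  isH1 : ∀ t ∈ Icc 0 T, IsH1With 0 L (fun x => y x t) (Yx t)
  /-- `y ∈ C([0, T]; H¹(0, L))`. -/
  continuousOn : ContinuousOn Y (Icc 0 T)
  continuousOn_x : ContinuousOn Yx (Icc 0 T)
  /-- `Yt` is the time derivative of `y` (one-sided at `0` and `T`) in `L²(0, L)`. -/
  hasDeriv_t : ∀ t ∈ Icc 0 T, HasDerivWithinAt Y (Yt t) (Icc 0 T) t
  /-- `y_t ∈ C([0, T]; L²(0, L))`. -/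
  continuousOn_t : ContinuousOn Yt (Icc 0 T)
  /-- `y(x, 0) = y₀(x)`. -/
  initial : ∀ x ∈ Icc 0 L, y x 0 = y₀ x
  /-- `y_t(x, 0) = y₁(x)`. -/
  initial_t : Yt 0 =ᵐ[volOn 0 L] y₁
  /-- Weak form of the equation together with the two Neumann conditions: for all `v ∈ H¹(0, L)`,
  `d/dt ∫ ρ y_t v dx + ∫ a y_x v' dx + a(0⁺) u(t) v(0) = 0` on `(0, T)`, integrated in time from
  `0` to `t`. (Integrating `(a y_x)_x v` by parts leaves the boundary terms
  `a(L⁻) y_x(L, t) v(L) = 0` and `a(0⁺) y_x(0, t) v(0) = a(0⁺) u(t) v(0)`.) -/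
  weak : ∀ v v' : ℝ → ℝ, IsH1With 0 L v v' → ∀ t ∈ Icc 0 T,
    (∫ x in Ioo 0 L, ρ x * (Yt t x - Yt 0 x) * v x)
      + (∫ s in (0 : ℝ)..t, ∫ x in Ioo 0 L, a x * Yx s x * v' x)
      + Function.rightLim a 0 * v 0 * (∫ s in (0 : ℝ)..t, u s) = 0

/-- `y` is a finite energy solution, `y ∈ C([0, T]; H¹(0, L))`, `y_t ∈ C([0, T]; L²(0, L))`, of
`ρ y_tt - (a y_x)_x = 0` in `(0, L) × (0, T)`, `y(·, 0) = y₀`, `y_t(·, 0) = y₁`,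
`y_x(0, ·) = u`, `y_x(L, ·) = 0`. The function `y : (x, t) ↦ y x t` is the representative that is
continuous in `x ∈ [0, L]` for every `t ∈ [0, T]`, so `y L t` is its trace at `x = L`. -/
def IsFiniteEnergySolution (ρ a : ℝ → ℝ) (L T : ℝ) (y₀ y₁ u : ℝ → ℝ) (y : ℝ → ℝ → ℝ) : Prop :=
  ∃ Y Yx Yt : ℝ → Lp ℝ 2 (volOn 0 L), IsFiniteEnergySolutionWith ρ a L T y₀ y₁ u y Y Yx Yt

/-- `y` is *the* finite energy solution: it is one, and every finite energy solution agrees with it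
on `[0, L] × [0, T]`. -/
def IsTheFiniteEnergySolution (ρ a : ℝ → ℝ) (L T : ℝ) (y₀ y₁ u : ℝ → ℝ) (y : ℝ → ℝ → ℝ) : Prop :=
  IsFiniteEnergySolution ρ a L T y₀ y₁ u y ∧
    ∀ z : ℝ → ℝ → ℝ, IsFiniteEnergySolution ρ a L T y₀ y₁ u z →
      ∀ x ∈ Icc 0 L, ∀ t ∈ Icc 0 T, z x t = y x t

/-! ### Square integrable functions on an interval -/

/-! Put b = 1/a, P = y_t and Q = a y_x. The wave equation becomes the system P_x = b Q_t, Q_x = ρ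
P_t, in which x can serve as the evolution variable. The values P(L,·) = p', Q(L,·) = 0 are
continued from x = L to x = 0, and the control is read off there as u = Q(0,·) / a(0⁺). Two things
are needed: this sidewise problem must be stable in L² for BV coefficients, and a trace that
vanishes up to the time L β must produce zero data at t = 0.

Both come from one estimate. For a weight χ(t) let F(x) = ∫ χ (ρ P² + b Q²) dt. Since P Q_t + Q P_t
= (P Q)_t, an integration by parts in time gives dF = (∫ χ P²) dρ + (∫ χ Q²) db - 2 ρ b (∫ χ' P Q)
dx if the boundary terms cancel. The first two terms are at most F/m times the increment of the
variation. For χ = exp(-2lt) the last one is at most 2 l β F dx, because ρ b ≤ β² implies 2 ρ b |P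
Q| ≤ β (ρ P² + b Q²). A Gronwall inequality that admits jumps (`gronwall_of_monotone`,
`WaveCoeffs.energy_le`, `IsWave.sidewise_energy_le`) then bounds the energy at time 0 by C ∫
exp(-2l(t - Lβ)) P(L,t)² dt (`IsWave.exists_energy_le_trace`). If the trace vanishes for t ≤ L β,
this tends to 0 as l → ∞.

The estimates are proved for waves that are smooth in time, and these are supplied by sums of
separated waves f(t) ψ(x), g(t) η(x). Neumann modes in x have dense initial data, by the spectral
theorem for a compact self-adjoint operator. Their limits give the uncontrolled solution w, whose
trace velocity lies in L² by the sidewise estimate with a compactly supported weight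
(`IsWave.exists_integral_trace_le`). Neumann modes in t on (-T, T), that is cosines, have dense
traces at x = L. Their limits give a solution with zero data and trace velocity equal to 0 before L
β and to p' - w_t(L,·) afterwards (`IsWave.exists_tendsto_trace`). The sum of the two solutions has
trace p, because p and w(L,·) agree at L β. Limits of regular waves are finite energy solutions
(`isFiniteEnergySolution_of_tendsto`), and these are unique by an energy argument for the equation
integrated in time (`IsFiniteEnergySolutionWith.eqOn`). -/

theorem MeasureTheory.MemLp.intervalIntegrable_volOn {c d : ℝ} {f : ℝ → ℝ}
    (hf : MemLp f 2 (volOn c d)) {x y : ℝ} (hx : x ∈ Icc c d) (hy : y ∈ Icc c d) :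
    IntervalIntegrable f volume x y := by
  have h1 : Integrable f (volOn c d) := hf.integrable (by norm_num)
  have h2 : IntegrableOn f (Icc c d) volume := by
    rw [integrableOn_Icc_iff_integrableOn_Ioo]; exact h1
  exact (h2.mono_set (uIcc_subset_Icc hx hy)).intervalIntegrable

theorem setIntegral_Ioo_eq_intervalIntegral {c d : ℝ} (hcd : c ≤ d) (f : ℝ → ℝ) :
    ∫ x in Ioo c d, f x = ∫ x in c..d, f x := by
  rw [intervalIntegral.integral_of_le hcd, integral_Ioc_eq_integral_Ioo]

/-- Integration by parts for primitives of integrable functions. -/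
theorem integral_primitive_mul {x y : ℝ} (hxy : x ≤ y) {u w U W : ℝ → ℝ}
    (hu : IntervalIntegrable u volume x y) (hw : IntervalIntegrable w volume x y)
    (hU : ∀ z ∈ Icc x y, U z = U y - ∫ s in z..y, u s)
    (hW : ∀ z ∈ Icc x y, W z = W y - ∫ s in z..y, w s) :
    ∫ s in x..y, (u s * W s + U s * w s) = U y * W y - U x * W x := by
  -- Written as a constant plus a primitive based at `y`, each factor is absolutely continuous with
  -- the expected derivative almost everywhere.
  have key : ∀ {u U : ℝ → ℝ}, IntervalIntegrable u volume x y →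
      (∀ z ∈ Icc x y, U z = U y - ∫ s in z..y, u s) →
      AbsolutelyContinuousOnInterval (fun z => U y + ∫ s in y..z, u s) x y ∧
      (∀ᵐ z, z ∈ uIcc x y → deriv (fun z => U y + ∫ s in y..z, u s) z = u z) ∧
      (∀ z ∈ Icc x y, U y + (∫ s in y..z, u s) = U z) := by
    intro u U hu hU
    have hac := hu.absolutelyContinuousOnInterval_intervalIntegral (c := y) (by simp)
    refine ⟨?_, ?_, ?_⟩
    · have hc : AbsolutelyContinuousOnInterval (fun _ : ℝ => U y) x y :=
        (LipschitzWith.const (U y)).lipschitzOnWith.absolutelyContinuousOnInterval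
      exact hc.add hac
    · filter_upwards [hu.ae_hasDerivAt_integral] with z hz hzm
      exact ((hz hzm y (by simp)).const_add _).deriv
    · intro z hz
      rw [hU z hz, intervalIntegral.integral_symm z y]; ring
  obtain ⟨h1, h2, h3⟩ := key hu hU
  obtain ⟨k1, k2, k3⟩ := key hw hW
  have := h1.integral_deriv_mul_eq_sub k1
  rw [h3 y (by simp [hxy]), h3 x (by simp [hxy]), k3 y (by simp [hxy]), k3 x (by simp [hxy])] at this
  rw [← this]
  apply intervalIntegral.integral_congr_ae
  filter_upwards [h2, k2] with z hz1 hz2 hzm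
  have hz : z ∈ uIcc x y := uIoc_subset_uIcc hzm
  rw [hz1 hz, hz2 hz]
  rw [uIcc_of_le hxy] at hz
  simp only [h3 z hz, k3 z hz]

/-! ### Sobolev functions of one variable are primitives -/

theorem continuousOn_of_eq_primitive {c d : ℝ} (hcd : c ≤ d) {f g : ℝ → ℝ}
    (hg : MemLp g 2 (volOn c d))
    (h : ∀ x ∈ Icc c d, f x = f d - ∫ s in x..d, g s) : ContinuousOn f (Icc c d) := by
  have h1 := hg.intervalIntegrable_volOn (left_mem_Icc.2 hcd) (right_mem_Icc.2 hcd)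
  have h2 : IntegrableOn g (uIcc c d) volume := by
    rw [uIcc_of_le hcd, integrableOn_Icc_iff_integrableOn_Ioc]
    exact (intervalIntegrable_iff_integrableOn_Ioc_of_le hcd).1 h1
  have h3 := intervalIntegral.continuousOn_primitive_interval_left h2
  rw [uIcc_of_le hcd] at h3
  exact (continuousOn_const.sub h3).congr h

theorem isH1With_of_eq_primitive {c d : ℝ} (hcd : c ≤ d) {f g : ℝ → ℝ}
    (hg : MemLp g 2 (volOn c d))
    (h : ∀ x ∈ Icc c d, f x = f d - ∫ s in x..d, g s) : IsH1With c d f g := by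
  refine ⟨continuousOn_of_eq_primitive hcd hg h, hg, ?_⟩
  intro φ hφ _ hφs
  have hgi := hg.intervalIntegrable_volOn (left_mem_Icc.2 hcd) (right_mem_Icc.2 hcd)
  have hd : Continuous (deriv φ) := hφ.continuous_deriv (by simp)
  have hz : ∀ x, x ∉ Ioo c d → φ x = 0 := fun x hx =>
    image_eq_zero_of_notMem_tsupport fun h => hx (hφs h)
  have e := integral_primitive_mul hcd hgi (hd.intervalIntegrable c d) h (W := φ) (w := deriv φ) (by
    intro z hz
    rw [intervalIntegral.integral_deriv_eq_sub
      (fun x _ => hφ.differentiable (by simp) x) (hd.intervalIntegrable _ _)]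
    ring)
  rw [hz c (by simp), hz d (by simp)] at e
  have hf := continuousOn_of_eq_primitive hcd hg h
  rw [setIntegral_Ioo_eq_intervalIntegral hcd, setIntegral_Ioo_eq_intervalIntegral hcd]
  rw [intervalIntegral.integral_add] at e
  · linarith
  · exact hgi.mul_continuousOn hφ.continuous.continuousOn
  · exact (hd.intervalIntegrable c d).continuousOn_mul (by rwa [uIcc_of_le hcd])

/-- A continuous function with vanishing weak derivative is constant. -/
theorem exists_const_of_hasWeakDeriv_zero {c d : ℝ} (hcd : c < d) {f : ℝ → ℝ}
    (hf : ContinuousOn f (Icc c d)) (h : HasWeakDeriv c d f 0) :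
    ∃ C, ∀ x ∈ Icc c d, f x = C := by
  obtain ⟨θ, hθs, hθc, hθ, hθi⟩ : ∃ θ : ℝ → ℝ, tsupport θ ⊆ Ioo c d ∧ HasCompactSupport θ ∧
      ContDiff ℝ ∞ θ ∧ ∫ x, θ x = 1 := by
    let b : ContDiffBump ((c + d) / 2) := ⟨(d - c) / 8, (d - c) / 4, by linarith, by linarith⟩
    refine ⟨b.normed volume, ?_, b.hasCompactSupport_normed, b.contDiff_normed, b.integral_normed⟩
    rw [b.tsupport_normed_eq]
    intro x hx
    rw [Metric.mem_closedBall, Real.dist_eq, abs_le] at hx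
    have : b.rOut = (d - c) / 4 := rfl
    constructor <;> linarith [hx.1, hx.2]
  set C := ∫ x in Ioo c d, f x * θ x with hC
  have hfi : IntegrableOn f (Ioo c d) := (hf.integrableOn_Icc).mono_set Ioo_subset_Icc_self
  have hmul : ∀ φ : ℝ → ℝ, ContDiff ℝ ∞ φ → IntegrableOn (fun x => f x * φ x) (Ioo c d) := by
    intro φ hφ
    exact ((hf.mul hφ.continuous.continuousOn).integrableOn_Icc).mono_set Ioo_subset_Icc_self
  have key : ∀ φ : ℝ → ℝ, ContDiff ℝ ∞ φ → HasCompactSupport φ → tsupport φ ⊆ Ioo c d →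
      ∫ x in Ioo c d, f x * φ x = C * ∫ x, φ x := by
    intro φ hφ hφc hφs
    set I := ∫ x, φ x
    -- Removing the mean with the bump `θ` leaves a test function of integral zero. Its primitive is
    -- again a test function on (c, d), so the hypothesis applies to it.
    set ζ : ℝ → ℝ := fun x => φ x - I * θ x
    have hζ : ContDiff ℝ ∞ ζ := hφ.sub (contDiff_const.mul hθ)
    have hζ0 : ∀ x, x ∉ Ioo c d → ζ x = 0 := by
      intro x hx
      have h1 : φ x = 0 := image_eq_zero_of_notMem_tsupport fun h => hx (hφs h)
      have h2 : θ x = 0 := image_eq_zero_of_notMem_tsupport fun h => hx (hθs h)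
      simp [ζ, h1, h2]
    have hφi : Integrable φ := hφ.continuous.integrable_of_hasCompactSupport hφc
    have hθi' : Integrable θ := hθ.continuous.integrable_of_hasCompactSupport hθc
    set Ψ : ℝ → ℝ := fun x => ∫ s in c..x, ζ s
    have hΨd : ∀ x, HasDerivAt Ψ (ζ x) x := fun x =>
      intervalIntegral.integral_hasDerivAt_right (hζ.continuous.intervalIntegrable _ _)
        (hζ.continuous.stronglyMeasurableAtFilter _ _) hζ.continuous.continuousAt
    have hΨ' : deriv Ψ = ζ := funext fun x => (hΨd x).deriv
    have hΨ : ContDiff ℝ ∞ Ψ := by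
      rw [contDiff_infty_iff_deriv]
      exact ⟨fun x => (hΨd x).differentiableAt, by rwa [hΨ']⟩
    have hsub : tsupport φ ∪ tsupport θ ⊆ Ioo c d := union_subset hφs hθs
    have hcomp : IsCompact (tsupport φ ∪ tsupport θ) := hφc.isCompact.union hθc.isCompact
    have hne : (tsupport φ ∪ tsupport θ).Nonempty := by
      by_contra hemp
      rw [not_nonempty_iff_eq_empty, union_empty_iff] at hemp
      have : θ = 0 := by rw [← tsupport_eq_empty_iff]; exact hemp.2
      simp [this] at hθi
    obtain ⟨l, hl⟩ := hcomp.exists_isLeast hne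
    obtain ⟨r, hr⟩ := hcomp.exists_isGreatest hne
    have hζ1 : ∀ x, x ∉ Icc l r → ζ x = 0 := by
      intro x hx
      have hx' : x ∉ tsupport φ ∪ tsupport θ := fun h => hx ⟨hl.2 h, hr.2 h⟩
      have h1 : φ x = 0 := image_eq_zero_of_notMem_tsupport fun h => hx' (Or.inl h)
      have h2 : θ x = 0 := image_eq_zero_of_notMem_tsupport fun h => hx' (Or.inr h)
      simp [ζ, h1, h2]
    have hζint : ∫ x, ζ x = 0 := by
      simp only [ζ]
      rw [integral_sub hφi (hθi'.const_mul I), integral_const_mul, hθi]; simp [I]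
    have hlc := hsub hl.1
    have hrc := hsub hr.1
    have hΨ0 : ∀ x, x ∉ Icc l r → Ψ x = 0 := by
      intro x hx
      rw [mem_Icc, not_and_or, not_le, not_le] at hx
      rcases hx with hx | hx
      · rw [show Ψ x = ∫ s in c..x, (0 : ℝ) from intervalIntegral.integral_congr (by
          intro s hs
          apply hζ1
          intro hs'
          rw [mem_uIcc] at hs
          rcases hs with hs | hs <;> linarith [hs.1, hs.2, hs'.1, hlc.1])]
        simp
      · have : Ψ x = ∫ s, ζ s := by
          simp only [Ψ]
          rw [intervalIntegral.integral_of_le (by linarith [hrc.1])]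
          apply setIntegral_eq_integral_of_forall_compl_eq_zero
          intro s hs
          apply hζ1
          intro hs'
          exact hs ⟨by linarith [hs'.1, hlc.1], by linarith [hs'.2]⟩
        rw [this, hζint]
    have hts : tsupport Ψ ⊆ Icc l r :=
      closure_minimal (fun x hx => by by_contra h'; exact hx (hΨ0 x h')) isClosed_Icc
    have hts' : tsupport Ψ ⊆ Ioo c d := fun x hx =>
      ⟨lt_of_lt_of_le hlc.1 (hts hx).1, lt_of_le_of_lt (hts hx).2 hrc.2⟩
    have := h Ψ hΨ (HasCompactSupport.of_support_subset_isCompact isCompact_Icc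
      (subset_closure.trans hts)) hts'
    rw [hΨ'] at this
    simp only [ζ, Pi.zero_apply, zero_mul, integral_zero, neg_zero] at this
    have e : ∀ x, f x * (φ x - I * θ x) = f x * φ x - I * (f x * θ x) := fun x => by ring
    simp only [e] at this
    rw [integral_sub (hmul φ hφ) ((hmul θ hθ).const_mul I), integral_const_mul, ← hC] at this
    linarith
  have hae : ∀ᵐ x, x ∈ Ioo c d → f x - C = 0 := by
    apply isOpen_Ioo.ae_eq_zero_of_integral_contDiff_smul_eq_zero
    · exact (hfi.sub (by simp [IntegrableOn])).locallyIntegrableOn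
    · intro φ hφ hφc hφs
      have h0 : ∀ x, x ∉ Ioo c d → φ x = 0 := fun x hx =>
        image_eq_zero_of_notMem_tsupport fun h => hx (hφs h)
      rw [← setIntegral_eq_integral_of_forall_compl_eq_zero (s := Ioo c d)
        (fun x hx => by simp [h0 x hx])]
      have e : ∀ x, φ x • (f x - C) = f x * φ x - C * φ x := fun x => by simp; ring
      simp only [e]
      have hφi : Integrable φ := hφ.continuous.integrable_of_hasCompactSupport hφc
      rw [integral_sub (hmul φ hφ) (hφi.integrableOn.const_mul C), integral_const_mul,
        key φ hφ hφc hφs, setIntegral_eq_integral_of_forall_compl_eq_zero (f := φ) h0]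
      ring
  refine ⟨C, ?_⟩
  have hdense : ∀ x ∈ Ioo c d, f x = C := by
    have : EqOn f (fun _ => C) (Ioo c d) :=
      Measure.eqOn_open_of_ae_eq (μ := volume) (by
        rw [Filter.EventuallyEq, ae_restrict_iff' measurableSet_Ioo]
        filter_upwards [hae] with x hx hxm
        linarith [hx hxm]) isOpen_Ioo (hf.mono Ioo_subset_Icc_self) continuousOn_const
    exact this
  have : EqOn f (fun _ => C) (Icc c d) := by
    apply EqOn.of_subset_closure (s := Ioo c d) hdense hf continuousOn_const Ioo_subset_Icc_self
    rw [closure_Ioo hcd.ne]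
  exact this

/-- A primitive of `g` has the same weak derivative as `f`, so the difference is continuous with
weak derivative zero, hence constant. From here on H¹ functions are handled through the fundamental
theorem of calculus. -/
theorem IsH1With.eq_primitive {c d : ℝ} (hcd : c < d) {f g : ℝ → ℝ} (h : IsH1With c d f g) :
    ∀ x ∈ Icc c d, f x = f d - ∫ s in x..d, g s := by
  set G : ℝ → ℝ := fun x => - ∫ s in x..d, g s
  have hG : IsH1With c d G g := isH1With_of_eq_primitive hcd.le h.memLp (by
    intro x _; simp [G])
  obtain ⟨C, hC⟩ := exists_const_of_hasWeakDeriv_zero hcd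
    (h.continuousOn.sub hG.continuousOn) (by
      intro φ hφ hφc hφs
      have hd : Continuous (deriv φ) := hφ.continuous_deriv (by simp)
      have e1 := h.hasWeakDeriv φ hφ hφc hφs
      have e2 := hG.hasWeakDeriv φ hφ hφc hφs
      have i1 : IntegrableOn (fun x => f x * deriv φ x) (Ioo c d) :=
        ((h.continuousOn.mul hd.continuousOn).integrableOn_Icc).mono_set Ioo_subset_Icc_self
      have i2 : IntegrableOn (fun x => G x * deriv φ x) (Ioo c d) :=
        ((hG.continuousOn.mul hd.continuousOn).integrableOn_Icc).mono_set Ioo_subset_Icc_self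
      simp only [Pi.sub_apply, sub_mul, Pi.zero_apply, zero_mul, integral_zero, neg_zero]
      rw [integral_sub i1 i2, e1, e2]; ring)
  intro x hx
  have h1 := hC x hx
  have h2 := hC d (right_mem_Icc.2 hcd.le)
  simp only [Pi.sub_apply, G, intervalIntegral.integral_same] at h1 h2
  linarith

/-! ### The space `L²(c, d)` -/

/-- The class in `L²(c, d)` of a function (zero if the function is not square integrable). -/
noncomputable def toL2 (c d : ℝ) (f : ℝ → ℝ) : Lp ℝ 2 (volOn c d) :=
  open Classical in if h : MemLp f 2 (volOn c d) then h.toLp f else 0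

section L2

variable {c d : ℝ}

theorem toL2_ae {f : ℝ → ℝ} (h : MemLp f 2 (volOn c d)) : toL2 c d f =ᵐ[volOn c d] f := by
  rw [toL2, dif_pos h]; exact h.coeFn_toLp

theorem toL2_eq_of_ae {f : ℝ → ℝ} {g : Lp ℝ 2 (volOn c d)} (h : f =ᵐ[volOn c d] g) :
    toL2 c d f = g := by
  have hf : MemLp f 2 (volOn c d) := (memLp_congr_ae h).2 (Lp.memLp g)
  exact Lp.ext ((toL2_ae hf).trans h)

theorem toL2_coe (g : Lp ℝ 2 (volOn c d)) : toL2 c d g = g := toL2_eq_of_ae (ae_eq_refl _)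

theorem toL2_congr {f g : ℝ → ℝ} (h : f =ᵐ[volOn c d] g) : toL2 c d f = toL2 c d g := by
  by_cases hg : MemLp g 2 (volOn c d)
  · exact toL2_eq_of_ae (h.trans (toL2_ae hg).symm)
  · have hf : ¬ MemLp f 2 (volOn c d) := fun hf => hg ((memLp_congr_ae h).1 hf)
    rw [toL2, toL2, dif_neg hf, dif_neg hg]

theorem toL2_add {f g : ℝ → ℝ} (hf : MemLp f 2 (volOn c d)) (hg : MemLp g 2 (volOn c d)) :
    toL2 c d (fun x => f x + g x) = toL2 c d f + toL2 c d g := by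
  apply toL2_eq_of_ae
  filter_upwards [toL2_ae hf, toL2_ae hg, Lp.coeFn_add (toL2 c d f) (toL2 c d g)] with x h1 h2 h3
  rw [h3, Pi.add_apply, h1, h2]

theorem toL2_sub {f g : ℝ → ℝ} (hf : MemLp f 2 (volOn c d)) (hg : MemLp g 2 (volOn c d)) :
    toL2 c d (fun x => f x - g x) = toL2 c d f - toL2 c d g := by
  apply toL2_eq_of_ae
  filter_upwards [toL2_ae hf, toL2_ae hg, Lp.coeFn_sub (toL2 c d f) (toL2 c d g)] with x h1 h2 h3
  rw [h3, Pi.sub_apply, h1, h2]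

theorem toL2_const_mul {f : ℝ → ℝ} (hf : MemLp f 2 (volOn c d)) (r : ℝ) :
    toL2 c d (fun x => r * f x) = r • toL2 c d f := by
  apply toL2_eq_of_ae
  filter_upwards [toL2_ae hf, Lp.coeFn_smul r (toL2 c d f)] with x h1 h2
  rw [h2, Pi.smul_apply, h1, smul_eq_mul]

theorem L2_inner_eq (f g : Lp ℝ 2 (volOn c d)) : inner ℝ f g = ∫ x in Ioo c d, f x * g x := by
  rw [L2.inner_def]
  simp [mul_comm]

theorem L2_norm_sq (f : Lp ℝ 2 (volOn c d)) : ‖f‖ ^ 2 = ∫ x in Ioo c d, f x ^ 2 := by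
  rw [← real_inner_self_eq_norm_sq, L2_inner_eq]
  simp [sq]

theorem toL2_inner {f g : ℝ → ℝ} (hf : MemLp f 2 (volOn c d)) (hg : MemLp g 2 (volOn c d)) :
    inner ℝ (toL2 c d f) (toL2 c d g) = ∫ x in Ioo c d, f x * g x := by
  rw [L2_inner_eq]
  apply integral_congr_ae
  filter_upwards [toL2_ae hf, toL2_ae hg] with x h1 h2
  rw [h1, h2]

theorem toL2_norm_sq {f : ℝ → ℝ} (hf : MemLp f 2 (volOn c d)) :
    ‖toL2 c d f‖ ^ 2 = ∫ x in Ioo c d, f x ^ 2 := by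
  rw [← real_inner_self_eq_norm_sq, toL2_inner hf hf]
  simp [sq]

theorem memLp_of_continuousOn {f : ℝ → ℝ} (hf : ContinuousOn f (Icc c d)) {p : ENNReal} :
    MemLp f p (volOn c d) := by
  obtain ⟨C, hC⟩ := isCompact_Icc.exists_bound_of_continuousOn hf
  refine MemLp.of_bound ((hf.mono Ioo_subset_Icc_self).aestronglyMeasurable measurableSet_Ioo) C ?_
  filter_upwards [ae_restrict_mem measurableSet_Ioo] with x hx
  exact hC x (Ioo_subset_Icc_self hx)

theorem memLp_of_measurable_bounded {w : ℝ → ℝ} (hw : Measurable w) {C : ℝ} (hC : ∀ x, |w x| ≤ C)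
    {p : ENNReal} : MemLp w p (volOn c d) :=
  MemLp.of_bound hw.aestronglyMeasurable C (ae_of_all _ hC)

theorem intervalIntegral_congr_volOn {f g : ℝ → ℝ} (h : f =ᵐ[volOn c d] g) {x y : ℝ}
    (hx : x ∈ Icc c d) (hy : y ∈ Icc c d) : ∫ s in x..y, f s = ∫ s in x..y, g s := by
  apply intervalIntegral.integral_congr_ae
  rw [Filter.EventuallyEq, ae_restrict_iff' measurableSet_Ioo] at h
  -- Interval integrals run over half-open intervals, which may contain `d`, whereas the hypothesis
  -- concerns the open interval.
  have hd : ∀ᵐ s : ℝ, s ≠ d := by simp [ae_iff, measure_singleton]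
  filter_upwards [h, hd] with s hs hsd hsm
  apply hs
  rw [mem_uIoc] at hsm
  rcases hsm with hsm | hsm
  · exact ⟨lt_of_le_of_lt hx.1 hsm.1, lt_of_le_of_ne (hsm.2.trans hy.2) hsd⟩
  · exact ⟨lt_of_le_of_lt hy.1 hsm.1, lt_of_le_of_ne (hsm.2.trans hx.2) hsd⟩

theorem L2_intervalIntegrable (f : Lp ℝ 2 (volOn c d)) {x y : ℝ} (hx : x ∈ Icc c d)
    (hy : y ∈ Icc c d) : IntervalIntegrable f volume x y :=
  (Lp.memLp f).intervalIntegrable_volOn hx hy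

theorem L2_abs_integral_le (f : Lp ℝ 2 (volOn c d)) {x y : ℝ} (hx : x ∈ Icc c d)
    (hy : y ∈ Icc c d) : |∫ s in x..y, f s| ≤ √|y - x| * ‖f‖ := by
  wlog hxy : x ≤ y generalizing x y
  · rw [intervalIntegral.integral_symm, abs_neg, abs_sub_comm]
    exact this hy hx (le_of_not_ge hxy)
  have hfin : volOn c d (Ioo x y) ≠ ⊤ := measure_ne_top _ _
  have h1 := L2.inner_indicatorConstLp_one (𝕜 := ℝ) measurableSet_Ioo hfin f
  have hsub : Ioo x y ⊆ Ioo c d := Ioo_subset_Ioo hx.1 hy.2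
  rw [Measure.restrict_restrict measurableSet_Ioo, inter_eq_left.2 hsub,
    setIntegral_Ioo_eq_intervalIntegral hxy] at h1
  rw [← h1]
  refine (abs_real_inner_le_norm _ _).trans ?_
  rw [norm_indicatorConstLp (by norm_num) (by norm_num)]
  have : (volOn c d).real (Ioo x y) = y - x := by
    rw [measureReal_restrict_apply measurableSet_Ioo, inter_eq_left.2 hsub]
    simp [hxy]
  rw [this, abs_of_nonneg (sub_nonneg.2 hxy), Real.sqrt_eq_rpow]
  simp

/-! ### Multiplication operators -/

/-- Multiplication by a bounded function on `L²(c, d)`. -/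
noncomputable def mulOp (c d : ℝ) (w : ℝ → ℝ) :
    Lp ℝ 2 (volOn c d) →L[ℝ] Lp ℝ 2 (volOn c d) :=
  open Classical in if h : MemLp w ⊤ (volOn c d) then
    (ContinuousLinearMap.mul ℝ ℝ).holderL (volOn c d) ⊤ 2 2 (h.toLp w) else 0

theorem mulOp_ae {w : ℝ → ℝ} (h : MemLp w ⊤ (volOn c d)) (f : Lp ℝ 2 (volOn c d)) :
    mulOp c d w f =ᵐ[volOn c d] fun x => w x * f x := by
  rw [mulOp, dif_pos h]
  have := ContinuousLinearMap.coeFn_holder (r := 2) (ContinuousLinearMap.mul ℝ ℝ) (h.toLp w) f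
  filter_upwards [this, h.coeFn_toLp] with x h1 h2
  refine Eq.trans h1 ?_
  rw [h2]; rfl

theorem mulOp_inner {w : ℝ → ℝ} (h : MemLp w ⊤ (volOn c d)) (f g : Lp ℝ 2 (volOn c d)) :
    inner ℝ (mulOp c d w f) g = ∫ x in Ioo c d, w x * f x * g x := by
  rw [L2_inner_eq]
  apply integral_congr_ae
  filter_upwards [mulOp_ae h f] with x h1
  rw [h1]

theorem mulOp_symm (w : ℝ → ℝ) (f g : Lp ℝ 2 (volOn c d)) :
    inner ℝ (mulOp c d w f) g = inner ℝ f (mulOp c d w g) := by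
  by_cases h : MemLp w ⊤ (volOn c d)
  · rw [mulOp_inner h, real_inner_comm, mulOp_inner h]
    congr 1; ext x; ring
  · simp [mulOp, h]

/-! ### The Volterra operator -/

theorem continuous_primitive_subtype (f : Lp ℝ 2 (volOn c d)) :
    Continuous fun x : Icc c d => ∫ s in (x : ℝ)..d, f s := by
  by_cases hcd : c ≤ d
  · have h := continuousOn_of_eq_primitive hcd (Lp.memLp f) (f := fun x => - ∫ s in x..d, f s)
      (by intro x _; simp)
    have h' := continuousOn_iff_continuous_domRestrict.1 h.neg
    convert h' using 2
    simp
  · have : IsEmpty (Icc c d) := by rw [Icc_eq_empty hcd]; infer_instance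
    exact continuous_of_discreteTopology

open scoped BoundedContinuousFunction

/-- `f ↦ (x ↦ ∫_x^d f)` from `L²(c, d)` to the continuous functions. -/
noncomputable def tailC (c d : ℝ) (hcd : c ≤ d) :
    Lp ℝ 2 (volOn c d) →L[ℝ] (Icc c d →ᵇ ℝ) :=
  LinearMap.mkContinuous
    { toFun := fun f => BoundedContinuousFunction.mkOfCompact
        ⟨fun x : Icc c d => ∫ s in (x : ℝ)..d, f s, continuous_primitive_subtype f⟩
      map_add' := by
        intro f g
        ext x
        have hd : d ∈ Icc c d := right_mem_Icc.2 hcd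
        simp only [BoundedContinuousFunction.mkOfCompact_apply, ContinuousMap.coe_mk,
          BoundedContinuousFunction.coe_add, Pi.add_apply]
        rw [intervalIntegral_congr_volOn (Lp.coeFn_add f g) x.2 hd]
        exact intervalIntegral.integral_add (L2_intervalIntegrable f x.2 hd)
          (L2_intervalIntegrable g x.2 hd)
      map_smul' := by
        intro r f
        ext x
        have hd : d ∈ Icc c d := right_mem_Icc.2 hcd
        simp only [BoundedContinuousFunction.mkOfCompact_apply, ContinuousMap.coe_mk,
          BoundedContinuousFunction.coe_smul, RingHom.id_apply]
        rw [intervalIntegral_congr_volOn (Lp.coeFn_smul r f) x.2 hd]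
        exact intervalIntegral.integral_const_mul r (fun s => f s) } (√(d - c)) (by
    intro f
    rw [BoundedContinuousFunction.norm_le (by positivity)]
    intro x
    refine (L2_abs_integral_le f x.2 (right_mem_Icc.2 hcd)).trans ?_
    gcongr
    rw [abs_of_nonneg (by linarith [x.2.2])]
    linarith [x.2.1])

theorem tailC_apply (hcd : c ≤ d) (f : Lp ℝ 2 (volOn c d)) (x : Icc c d) :
    tailC c d hcd f x = ∫ s in (x : ℝ)..d, f s := rfl

/-- By Cauchy–Schwarz the image of the unit ball is bounded and uniformly Hölder of exponent 1/2, so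
Arzelà–Ascoli applies. -/
theorem isCompactOperator_tailC (hcd : c ≤ d) : IsCompactOperator (tailC c d hcd) := by
  rw [isCompactOperator_iff_exists_mem_nhds_isCompact_closure_image]
  refine ⟨Metric.closedBall 0 1, Metric.closedBall_mem_nhds _ one_pos, ?_⟩
  apply BoundedContinuousFunction.arzela_ascoli (Metric.closedBall 0 (√(d - c)))
    (isCompact_closedBall _ _)
  · rintro _ x ⟨f, hf, rfl⟩
    rw [mem_closedBall_zero_iff] at hf ⊢
    refine (L2_abs_integral_le f x.2 (right_mem_Icc.2 hcd)).trans ?_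
    rw [abs_of_nonneg (by linarith [x.2.2])]
    calc √(d - x) * ‖f‖ ≤ √(d - c) * 1 := by
          gcongr
          exact x.2.1
      _ = _ := mul_one _
  · apply Metric.equicontinuous_of_continuity_modulus (fun r => √|r|)
    · have : Continuous fun r : ℝ => √|r| := by fun_prop
      simpa using this.tendsto 0
    · rintro x y ⟨_, f, hf, rfl⟩
      rw [mem_closedBall_zero_iff] at hf
      simp only [Real.dist_eq, tailC_apply]
      rw [← intervalIntegral.integral_add_adjacent_intervals (L2_intervalIntegrable f x.2 y.2)
        (L2_intervalIntegrable f y.2 (right_mem_Icc.2 hcd)), add_sub_cancel_right]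
      refine (L2_abs_integral_le f x.2 y.2).trans ?_
      rw [Subtype.dist_eq, Real.dist_eq, abs_abs, abs_sub_comm]
      exact mul_le_of_le_one_right (by positivity) hf

/-- Continuous functions on `[c, d]` as elements of `L²(c, d)`. -/
noncomputable def contToL2 (c d : ℝ) (hcd : c ≤ d) :
    (Icc c d →ᵇ ℝ) →L[ℝ] Lp ℝ 2 (volOn c d) :=
  have hm : ∀ u : Icc c d →ᵇ ℝ, MemLp (IccExtend hcd u) 2 (volOn c d) := fun u =>
    memLp_of_continuousOn (u.continuous.Icc_extend').continuousOn
  LinearMap.mkContinuous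
    { toFun := fun u => toL2 c d (IccExtend hcd u)
      map_add' := fun u v => by
        rw [← toL2_add (hm u) (hm v)]; rfl
      map_smul' := fun r u => by
        rw [RingHom.id_apply, ← toL2_const_mul (hm u)]; rfl }
    ((measureUnivNNReal (volOn c d) : ℝ) ^ (2 : ENNReal).toReal⁻¹) (by
      intro u
      apply Lp.norm_le_of_ae_bound (norm_nonneg u)
      filter_upwards [toL2_ae (hm u)] with x hx
      refine (congrArg norm hx).trans_le ?_
      exact u.norm_coe_le_norm _)

theorem contToL2_ae (hcd : c ≤ d) (u : Icc c d →ᵇ ℝ) :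
    contToL2 c d hcd u =ᵐ[volOn c d] IccExtend hcd u :=
  toL2_ae (memLp_of_continuousOn (u.continuous.Icc_extend').continuousOn)

/-- The Volterra operator `f ↦ (x ↦ ∫_x^d f)` on `L²(c, d)`. -/
noncomputable def tailOp (c d : ℝ) (hcd : c ≤ d) :
    Lp ℝ 2 (volOn c d) →L[ℝ] Lp ℝ 2 (volOn c d) :=
  contToL2 c d hcd ∘L tailC c d hcd

theorem tailOp_ae (hcd : c ≤ d) (f : Lp ℝ 2 (volOn c d)) :
    tailOp c d hcd f =ᵐ[volOn c d] fun x => ∫ s in x..d, f s := by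
  filter_upwards [contToL2_ae hcd (tailC c d hcd f), ae_restrict_mem measurableSet_Ioo]
    with x h1 h2
  refine Eq.trans h1 ?_
  rw [IccExtend_of_mem hcd _ (Ioo_subset_Icc_self h2), tailC_apply]

theorem isCompactOperator_tailOp (hcd : c ≤ d) : IsCompactOperator (tailOp c d hcd) :=
  (isCompactOperator_tailC hcd).clm_comp (contToL2 c d hcd)

/-- Integration by parts without boundary terms: the tail integral of one factor vanishes at `d`,
the primitive of the other at `c`. -/
theorem tailOp_adjoint_ae (hcd : c ≤ d) (h : Lp ℝ 2 (volOn c d)) :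
    ContinuousLinearMap.adjoint (tailOp c d hcd) h =ᵐ[volOn c d] fun x => ∫ s in c..x, h s := by
  have hc : c ∈ Icc c d := left_mem_Icc.2 hcd
  have hd : d ∈ Icc c d := right_mem_Icc.2 hcd
  have hW : ∀ z ∈ Icc c d, (∫ s in c..z, h s) = (∫ s in c..d, h s) - ∫ s in z..d, h s := by
    intro z hz
    rw [← intervalIntegral.integral_add_adjacent_intervals (L2_intervalIntegrable h hc hz)
      (L2_intervalIntegrable h hz hd)]
    ring
  have hm : MemLp (fun x => ∫ s in c..x, h s) 2 (volOn c d) :=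
    memLp_of_continuousOn (continuousOn_of_eq_primitive hcd (Lp.memLp h) hW)
  have : ContinuousLinearMap.adjoint (tailOp c d hcd) h = toL2 c d (fun x => ∫ s in c..x, h s) := by
    apply ext_inner_left ℝ
    intro f
    rw [ContinuousLinearMap.adjoint_inner_right, ← toL2_coe f, toL2_inner (Lp.memLp f) hm,
      toL2_coe, L2_inner_eq]
    have e := integral_primitive_mul hcd (u := fun s => - f s) (L2_intervalIntegrable f hc hd).neg
      (L2_intervalIntegrable h hc hd) (U := fun x => ∫ s in x..d, f s)
      (by intro z _; simp) hW
    rw [intervalIntegral.integral_add] at e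
    · simp only [neg_mul, intervalIntegral.integral_neg, intervalIntegral.integral_same, zero_mul,
        mul_zero, sub_zero] at e
      have e1 : ∫ x in Ioo c d, tailOp c d hcd f x * h x
          = ∫ x in c..d, (∫ s in x..d, f s) * h x := by
        rw [← setIntegral_Ioo_eq_intervalIntegral hcd]
        apply integral_congr_ae
        filter_upwards [tailOp_ae hcd f] with x hx
        rw [hx]
      rw [e1, setIntegral_Ioo_eq_intervalIntegral hcd]
      linarith
    · exact (L2_intervalIntegrable f hc hd).neg.mul_continuousOn (by
        rw [uIcc_of_le hcd]; exact continuousOn_of_eq_primitive hcd (Lp.memLp h) hW)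
    · refine (L2_intervalIntegrable h hc hd).continuousOn_mul ?_
      rw [uIcc_of_le hcd]
      have := (continuousOn_of_eq_primitive hcd (Lp.memLp f) (f := fun x => - ∫ s in x..d, f s)
        (by intro x _; simp)).neg
      exact this.congr fun x _ => by simp
  rw [this]
  exact toL2_ae hm

theorem L2_eq_zero_of_primitive_eq_const (hcd : c ≤ d) (f : Lp ℝ 2 (volOn c d)) (C : ℝ)
    (h : ∀ᵐ x ∂(volOn c d), ∫ s in c..x, f s = C) : f = 0 := by
  have hc : c ∈ Icc c d := left_mem_Icc.2 hcd
  have hd : d ∈ Icc c d := right_mem_Icc.2 hcd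
  have hW : ∀ z ∈ Icc c d, (∫ s in c..z, f s) = (∫ s in c..d, f s) - ∫ s in z..d, f s := by
    intro z hz
    rw [← intervalIntegral.integral_add_adjacent_intervals (L2_intervalIntegrable f hc hz)
      (L2_intervalIntegrable f hz hd)]
    ring
  have hcont := continuousOn_of_eq_primitive hcd (Lp.memLp f) hW
  have heq : EqOn (fun x => ∫ s in c..x, f s) (fun _ => C) (Ioo c d) :=
    Measure.eqOn_open_of_ae_eq (μ := volume) h isOpen_Ioo (hcont.mono Ioo_subset_Icc_self)
      continuousOn_const
  have hae := (L2_intervalIntegrable f hc hd).ae_hasDerivAt_integral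
  rw [uIcc_of_le hcd] at hae
  rw [Lp.eq_zero_iff_ae_eq_zero, Filter.EventuallyEq, ae_restrict_iff' measurableSet_Ioo]
  filter_upwards [hae] with x hx hxm
  have h1 := hx (Ioo_subset_Icc_self hxm) c hc
  have h2 : HasDerivAt (fun x => ∫ s in c..x, f s) 0 x :=
    (hasDerivAt_const x C).congr_of_eventuallyEq (heq.eventuallyEq_of_mem (isOpen_Ioo.mem_nhds hxm))
  exact h1.unique h2

end L2

/-! ### Separated solutions -/

/-- A measurable function on the line with values in `[m, M]`, where `m > 0`. -/
structure IsCoeff (m M : ℝ) (w : ℝ → ℝ) : Prop where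
  measurable : Measurable w
  pos : 0 < m
  lower : ∀ x, m ≤ w x
  upper : ∀ x, w x ≤ M

namespace IsCoeff

variable {m M : ℝ} {w : ℝ → ℝ}

theorem apply_pos (h : IsCoeff m M w) (x : ℝ) : 0 < w x := h.pos.trans_le (h.lower x)

theorem upper_pos (h : IsCoeff m M w) : 0 < M := (h.apply_pos 0).trans_le (h.upper 0)

theorem abs_le (h : IsCoeff m M w) (x : ℝ) : |w x| ≤ M := by
  rw [abs_of_pos (h.apply_pos x)]; exact h.upper x

theorem memLp (h : IsCoeff m M w) {c d : ℝ} {p : ENNReal} : MemLp w p (volOn c d) :=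
  memLp_of_measurable_bounded h.measurable h.abs_le

theorem sqrt (h : IsCoeff m M w) : IsCoeff (√m) (√M) fun x => √(w x) where
  measurable := h.measurable.sqrt
  pos := Real.sqrt_pos.2 h.pos
  lower x := Real.sqrt_le_sqrt (h.lower x)
  upper x := Real.sqrt_le_sqrt (h.upper x)

theorem inv (h : IsCoeff m M w) : IsCoeff M⁻¹ m⁻¹ fun x => (w x)⁻¹ where
  measurable := h.measurable.inv
  pos := inv_pos.2 h.upper_pos
  lower x := inv_anti₀ (h.apply_pos x) (h.upper x)
  upper x := inv_anti₀ h.pos (h.lower x)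

theorem memLp_const_mul_mul (h : IsCoeff m M w) {c d : ℝ} (r : ℝ) {f : ℝ → ℝ}
    (hf : ContinuousOn f (Icc c d)) {p : ENNReal} :
    MemLp (fun s => r * w s * f s) p (volOn c d) := by
  have h1 : MemLp f ⊤ (volOn c d) := memLp_of_continuousOn hf
  have h2 : MemLp (fun s => r * w s) p (volOn c d) := h.memLp.const_mul r
  exact h1.mul' h2

theorem memLp_mul (h : IsCoeff m M w) {c d : ℝ} {f : ℝ → ℝ}
    (hf : ContinuousOn f (Icc c d)) {p : ENNReal} :
    MemLp (fun s => w s * f s) p (volOn c d) := by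
  simpa using h.memLp_const_mul_mul 1 hf (p := p)

theorem intervalIntegrable_mul (h : IsCoeff m M w) {f : ℝ → ℝ} (hf : Continuous f) (x y : ℝ) :
    IntervalIntegrable (fun s => w s * f s) volume x y := by
  have h1 : IntervalIntegrable w volume x y :=
    (intervalIntegrable_const (c := M)).mono_fun h.measurable.aestronglyMeasurable
      (ae_of_all _ fun s => by
        simp only [Real.norm_eq_abs]; exact (h.abs_le s).trans (le_abs_self _))
  exact h1.mul_continuousOn hf.continuousOn

end IsCoeff

/-- `ψ' = ν b η`, `η' = - ν ρ ψ` on `[c, d]`, in integrated form. -/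
structure IsMode (ρ b : ℝ → ℝ) (c d ν : ℝ) (ψ η : ℝ → ℝ) : Prop where
  continuous_fst : Continuous ψ
  continuous_snd : Continuous η
  eq_fst : ∀ x ∈ Icc c d, ψ x = ψ d - ∫ s in x..d, ν * b s * η s
  eq_snd : ∀ x ∈ Icc c d, η x = η d - ∫ s in x..d, -(ν * ρ s * ψ s)

/-- Modes are required to be continuous on the whole line. Extension by constants outside `[c, d]`
achieves this and leaves the equations untouched. -/
theorem exists_isMode_of_continuousOn {ρ b : ℝ → ℝ} {c d ν : ℝ} (hcd : c ≤ d) {ψ η : ℝ → ℝ}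
    (hψ : ContinuousOn ψ (Icc c d)) (hη : ContinuousOn η (Icc c d))
    (h1 : ∀ x ∈ Icc c d, ψ x = ψ d - ∫ s in x..d, ν * b s * η s)
    (h2 : ∀ x ∈ Icc c d, η x = η d - ∫ s in x..d, -(ν * ρ s * ψ s)) :
    ∃ ψ' η' : ℝ → ℝ, IsMode ρ b c d ν ψ' η' ∧ (∀ x ∈ Icc c d, ψ' x = ψ x) ∧
      ∀ x ∈ Icc c d, η' x = η x := by
  have e : ∀ (f : ℝ → ℝ), ∀ x ∈ Icc c d, IccExtend hcd ((Icc c d).domRestrict f) x = f x :=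
    fun f x hx => by rw [IccExtend_of_mem hcd _ hx]; rfl
  have hd : d ∈ Icc c d := right_mem_Icc.2 hcd
  have hsub : ∀ x ∈ Icc c d, ∀ s ∈ uIcc x d, s ∈ Icc c d := fun x hx s hs =>
    uIcc_subset_Icc hx hd hs
  refine ⟨IccExtend hcd ((Icc c d).domRestrict ψ), IccExtend hcd ((Icc c d).domRestrict η),
    ⟨?_, ?_, ?_, ?_⟩, e ψ, e η⟩
  · exact (continuousOn_iff_continuous_domRestrict.1 hψ).Icc_extend'
  · exact (continuousOn_iff_continuous_domRestrict.1 hη).Icc_extend'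
  · intro x hx
    rw [e ψ x hx, e ψ d hd, h1 x hx]
    congr 1
    apply intervalIntegral.integral_congr
    intro s hs
    simp only [e η s (hsub x hx s hs)]
  · intro x hx
    rw [e η x hx, e η d hd, h2 x hx]
    congr 1
    apply intervalIntegral.integral_congr
    intro s hs
    simp only [e ψ s (hsub x hx s hs)]

/-- Gronwall's inequality, from the right end of the interval. -/
theorem eq_zero_of_le_integral_tail {c d C : ℝ} {U : ℝ → ℝ} (hU : Continuous U)
    (h0 : ∀ x, 0 ≤ U x) (h : ∀ x ∈ Icc c d, U x ≤ C * ∫ s in x..d, U s) :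
    ∀ x ∈ Icc c d, U x = 0 := by
  set W : ℝ → ℝ := fun x => ∫ s in x..d, U s
  have hW : ∀ x, HasDerivAt W (- U x) x := fun x =>
    intervalIntegral.integral_hasDerivAt_left (hU.intervalIntegrable _ _)
      (hU.stronglyMeasurableAtFilter _ _) hU.continuousAt
  have hG : ∀ x, HasDerivAt (fun x => Real.exp (C * x) * W x)
      (Real.exp (C * x) * (C * W x - U x)) x := by
    intro x
    have h1 : HasDerivAt (fun x => Real.exp (C * x)) (Real.exp (C * x) * C) x := by
      have := ((hasDerivAt_id x).const_mul C).exp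
      simpa using this
    exact (h1.mul (hW x)).congr_deriv (by ring)
  have hmono : MonotoneOn (fun x => Real.exp (C * x) * W x) (Icc c d) := by
    apply monotoneOn_of_hasDerivWithinAt_nonneg (convex_Icc c d)
      (fun x _ => (hG x).continuousAt.continuousWithinAt)
      (fun x _ => (hG x).hasDerivWithinAt)
    intro x hx
    exact mul_nonneg (Real.exp_pos _).le (sub_nonneg.2 (h x (interior_subset hx)))
  intro x hx
  have h1 := hmono hx (right_mem_Icc.2 (hx.1.trans hx.2)) hx.2
  have h2 : W d = 0 := by simp [W]
  simp only [h2, mul_zero] at h1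
  have h3 : W x ≤ 0 := by
    by_contra h4
    exact absurd (mul_pos (Real.exp_pos (C * x)) (not_le.1 h4)) (not_lt.2 h1)
  have h5 : 0 ≤ W x := intervalIntegral.integral_nonneg hx.2 fun s _ => h0 s
  have h6 : W x = 0 := le_antisymm h3 h5
  have h7 := h x hx
  change U x ≤ C * W x at h7
  rw [h6, mul_zero] at h7
  exact le_antisymm h7 (h0 x)

section

variable {m M : ℝ} {ρ b : ℝ → ℝ} {c d : ℝ}

/-- Uniqueness for the initial value problem at `d`: |ψ| + |η| satisfies the integral Gronwall
inequality with constant |ν| M. -/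
theorem IsMode.eq_zero (hρ : IsCoeff m M ρ) (hb : IsCoeff m M b) {ν : ℝ} {ψ η : ℝ → ℝ}
    (h : IsMode ρ b c d ν ψ η) (hψ : ψ d = 0) (hη : η d = 0) : ∀ x ∈ Icc c d, ψ x = 0 := by
  have hU : Continuous fun x => |ψ x| + |η x| := h.continuous_fst.abs.add h.continuous_snd.abs
  have key : ∀ {w f : ℝ → ℝ}, IsCoeff m M w → Continuous f → ∀ x ∈ Icc c d,
      |∫ s in x..d, ν * w s * f s| ≤ |ν| * M * ∫ s in x..d, |f s| := by
    intro w f hw hf x hx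
    rw [← intervalIntegral.integral_const_mul, ← Real.norm_eq_abs]
    refine intervalIntegral.norm_integral_le_of_norm_le (μ := volume) hx.2 (ae_of_all _ fun s _ => ?_)
      ((continuous_const.mul hf.abs).intervalIntegrable (μ := volume) _ _)
    rw [Real.norm_eq_abs, abs_mul, abs_mul]
    gcongr
    exact hw.abs_le s
  have := eq_zero_of_le_integral_tail (c := c) (d := d) (C := |ν| * M) hU
    (fun x => by positivity) (by
      intro x hx
      rw [intervalIntegral.integral_add (h.continuous_fst.abs.intervalIntegrable _ _)
        (h.continuous_snd.abs.intervalIntegrable _ _), mul_add, add_comm]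
      have e1 : |ψ x| = |∫ s in x..d, ν * b s * η s| := by
        rw [h.eq_fst x hx, hψ, zero_sub, abs_neg]
      have e2 : |η x| = |∫ s in x..d, ν * ρ s * ψ s| := by
        rw [h.eq_snd x hx, hη, zero_sub, abs_neg, intervalIntegral.integral_neg, abs_neg]
      have k1 := key hb h.continuous_snd x hx
      have k2 := key hρ h.continuous_fst x hx
      rw [e1, e2]
      linarith)
  intro x hx
  have h1 := this x hx
  have h2 := abs_nonneg (ψ x)
  have h3 := abs_nonneg (η x)
  exact abs_eq_zero.1 (by linarith)

/-- The initial value problem for separated solutions, solved from the right end point. -/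
theorem exists_isMode (hcd : c ≤ d) (hρ : IsCoeff m M ρ) (hb : IsCoeff m M b) (ν : ℝ) :
    ∃ ψ η : ℝ → ℝ, IsMode ρ b c d ν ψ η ∧ ψ d = 1 ∧ η d = 0 := by
  have hd : d ∈ Icc c d := right_mem_Icc.2 hcd
  have hmρ : MemLp (fun x => ν * ρ x) ⊤ (volOn c d) := hρ.memLp.const_mul ν
  have hmb : MemLp (fun x => ν * b x) ⊤ (volOn c d) := hb.memLp.const_mul ν
  set A := tailOp c d hcd ∘L mulOp c d (fun x => ν * ρ x)
  set B := tailOp c d hcd ∘L mulOp c d (fun x => ν * b x)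
  -- With ψ(d) = r and η(d) = 0 the system says η = A ψ and ψ = r - B η, that is ψ + T ψ = r. As `T`
  -- is compact, the Fredholm alternative reduces solvability to uniqueness, which is
  -- `IsMode.eq_zero`.
  set T := B ∘L A
  have hT : IsCompactOperator T :=
    ((isCompactOperator_tailOp hcd).comp_clm (mulOp c d (fun x => ν * b x))).comp_clm A
  have key : ∀ (r : ℝ) (u : Lp ℝ 2 (volOn c d)), u + T u = toL2 c d (fun _ => r) →
      ∃ ψ η : ℝ → ℝ, IsMode ρ b c d ν ψ η ∧ ψ d = r ∧ η d = 0 ∧ u =ᵐ[volOn c d] ψ := by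
    intro r u hu
    set f := mulOp c d (fun x => ν * ρ x) u
    set g := mulOp c d (fun x => ν * b x) (A u)
    set η : ℝ → ℝ := fun x => ∫ s in x..d, f s
    set ψ : ℝ → ℝ := fun x => r - ∫ s in x..d, g s
    have hAu : A u =ᵐ[volOn c d] η := tailOp_ae hcd f
    have hg : g =ᵐ[volOn c d] fun s => ν * b s * η s := by
      filter_upwards [mulOp_ae hmb (A u), hAu] with x h1 h2
      rw [h1, h2]
    have huψ : u =ᵐ[volOn c d] ψ := by
      have : u = toL2 c d (fun _ => r) - T u := by rw [← hu]; abel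
      rw [this]
      filter_upwards [Lp.coeFn_sub (toL2 c d fun _ => r) (T u),
        toL2_ae (c := c) (d := d) (f := fun _ => r) (memLp_const r), tailOp_ae hcd g]
        with x h1 h2 h3
      rw [h1, Pi.sub_apply, h2]
      exact congrArg (r - ·) h3
    have hf : f =ᵐ[volOn c d] fun s => ν * ρ s * ψ s := by
      filter_upwards [mulOp_ae hmρ u, huψ] with x h1 h2
      rw [h1, h2]
    have hηc : ContinuousOn η (Icc c d) := by
      refine (continuousOn_of_eq_primitive hcd (Lp.memLp f)
        (f := fun x => - ∫ s in x..d, f s) (by intro x _; simp)).neg.congr fun x _ => by simp [η]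
    have hψc : ContinuousOn ψ (Icc c d) :=
      continuousOn_of_eq_primitive hcd (Lp.memLp g) (by intro x _; simp [ψ])
    obtain ⟨ψ', η', hm, e1, e2⟩ := exists_isMode_of_continuousOn (ρ := ρ) (b := b) (ν := ν)
      hcd hψc hηc (by
        intro x hx
        rw [← intervalIntegral_congr_volOn hg hx hd]; simp [ψ]) (by
        intro x hx
        rw [intervalIntegral.integral_neg, ← intervalIntegral_congr_volOn hf hx hd]; simp [η])
    refine ⟨ψ', η', hm, ?_, ?_, ?_⟩
    · rw [e1 d hd]; simp [ψ]
    · rw [e2 d hd]; simp [η]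
    · filter_upwards [huψ, ae_restrict_mem measurableSet_Ioo] with x h1 h2
      rw [h1, e1 x (Ioo_subset_Icc_self h2)]
  rcases hT.hasEigenvalue_or_mem_resolventSet (neg_ne_zero.2 (one_ne_zero (α := ℝ))) with h | h
  · exfalso
    obtain ⟨u, hu⟩ := h.exists_hasEigenvector
    have hu1 : T u = (-1 : ℝ) • u := hu.apply_eq_smul
    obtain ⟨ψ, η, hm, h1, h2, h3⟩ := key 0 u (by
      rw [hu1]
      have : toL2 c d (fun _ => (0 : ℝ)) = 0 := toL2_eq_of_ae (Lp.coeFn_zero ℝ 2 _).symm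
      rw [this]; simp)
    apply hu.2
    rw [Lp.eq_zero_iff_ae_eq_zero]
    filter_upwards [h3, ae_restrict_mem measurableSet_Ioo] with x h4 h5
    rw [h4, hm.eq_zero hρ hb h1 h2 x (Ioo_subset_Icc_self h5)]; rfl
  · rw [spectrum.mem_resolventSet_iff] at h
    obtain ⟨R, hR⟩ := h.exists_right_inv
    have := DFunLike.congr_fun hR (- toL2 c d (fun _ => (1 : ℝ)))
    set v := R (- toL2 c d (fun _ => (1 : ℝ)))
    obtain ⟨ψ, η, hm, h1, h2, -⟩ := key 1 v (by
      have e : (-1 : ℝ) • v - T v = - toL2 c d (fun _ => (1 : ℝ)) := by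
        rw [Algebra.algebraMap_eq_smul_one] at this
        simpa only [ContinuousLinearMap.mul_apply', ContinuousLinearMap.mul_def,
          ContinuousLinearMap.comp_apply, sub_apply,
          smul_apply, one_apply_eq_self] using this
      rw [neg_one_smul] at e
      have e' : v + T v = -(-v - T v) := by abel
      rw [e', e, neg_neg])
    exact ⟨ψ, η, hm, h1, h2⟩

end

/-! ### Completeness of the Neumann eigenfunctions -/

/-- `f ↦ w₁ (∫_x^d w₂ f)` on `L²(c, d)`, followed by the projection onto the orthogonal complement
of `w₁`. -/
noncomputable def neumannOp (c d : ℝ) (hcd : c ≤ d) (w₁ w₂ : ℝ → ℝ) :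
    Lp ℝ 2 (volOn c d) →L[ℝ] Lp ℝ 2 (volOn c d) :=
  (ContinuousLinearMap.id ℝ _ - (Submodule.span ℝ {toL2 c d w₁}).starProjection) ∘L
    mulOp c d w₁ ∘L tailOp c d hcd ∘L mulOp c d w₂

/-- The adjoint of `neumannOp`. -/
noncomputable def neumannOpAdj (c d : ℝ) (hcd : c ≤ d) (w₁ w₂ : ℝ → ℝ) :
    Lp ℝ 2 (volOn c d) →L[ℝ] Lp ℝ 2 (volOn c d) :=
  mulOp c d w₂ ∘L ContinuousLinearMap.adjoint (tailOp c d hcd) ∘L mulOp c d w₁ ∘L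
    (ContinuousLinearMap.id ℝ _ - (Submodule.span ℝ {toL2 c d w₁}).starProjection)

section

variable {m M : ℝ} {c d : ℝ} {w₁ w₂ : ℝ → ℝ}

theorem neumannOp_inner (hcd : c ≤ d) (f g : Lp ℝ 2 (volOn c d)) :
    inner ℝ (neumannOp c d hcd w₁ w₂ f) g = inner ℝ f (neumannOpAdj c d hcd w₁ w₂ g) := by
  simp only [neumannOp, neumannOpAdj, ContinuousLinearMap.comp_apply, sub_apply,
    ContinuousLinearMap.id_apply]
  rw [← mulOp_symm, ContinuousLinearMap.adjoint_inner_right, ← mulOp_symm, inner_sub_left,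
    inner_sub_right, Submodule.inner_starProjection_left_eq_right]

theorem isCompactOperator_neumannOp (hcd : c ≤ d) :
    IsCompactOperator (neumannOp c d hcd w₁ w₂) :=
  (((isCompactOperator_tailOp hcd).comp_clm (mulOp c d w₂)).clm_comp (mulOp c d w₁)).clm_comp
    (ContinuousLinearMap.id ℝ (Lp ℝ 2 (volOn c d)) - (Submodule.span ℝ {toL2 c d w₁}).starProjection)

theorem inner_neumannOp_eq_zero (hcd : c ≤ d) (f : Lp ℝ 2 (volOn c d)) :
    inner ℝ (toL2 c d w₁) (neumannOp c d hcd w₁ w₂ f) = 0 := by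
  have h : toL2 c d w₁ ∈ Submodule.span ℝ {toL2 c d w₁} := Submodule.mem_span_singleton_self _
  simp only [neumannOp, ContinuousLinearMap.comp_apply, sub_apply, ContinuousLinearMap.id_apply]
  rw [inner_sub_right, ← Submodule.inner_starProjection_left_eq_right,
    Submodule.starProjection_eq_self_iff.2 h, sub_self]

theorem neumannOp_ae (hcd : c ≤ d) (h₁ : IsCoeff m M w₁)
    (f : Lp ℝ 2 (volOn c d)) : ∃ r : ℝ, neumannOp c d hcd w₁ w₂ f =ᵐ[volOn c d]
      fun x => w₁ x * ((∫ s in x..d, mulOp c d w₂ f s) - r) := by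
  set u := mulOp c d w₁ (tailOp c d hcd (mulOp c d w₂ f))
  refine ⟨inner ℝ (toL2 c d w₁) u / ‖toL2 c d w₁‖ ^ 2, ?_⟩
  have e : neumannOp c d hcd w₁ w₂ f
      = u - (inner ℝ (toL2 c d w₁) u / ‖toL2 c d w₁‖ ^ 2) • toL2 c d w₁ := by
    simp only [neumannOp, ContinuousLinearMap.comp_apply, sub_apply, ContinuousLinearMap.id_apply]
    rw [Submodule.starProjection_singleton]
    rfl
  rw [e]
  filter_upwards [Lp.coeFn_sub u ((inner ℝ (toL2 c d w₁) u / ‖toL2 c d w₁‖ ^ 2) • toL2 c d w₁),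
    Lp.coeFn_smul (inner ℝ (toL2 c d w₁) u / ‖toL2 c d w₁‖ ^ 2) (toL2 c d w₁),
    toL2_ae (h₁.memLp (c := c) (d := d)), mulOp_ae h₁.memLp (tailOp c d hcd (mulOp c d w₂ f)),
    tailOp_ae hcd (mulOp c d w₂ f)] with x k1 k2 k3 k4 k5
  rw [k1, Pi.sub_apply, k2, Pi.smul_apply, k3, k4, k5, smul_eq_mul]
  ring

theorem neumannOpAdj_ae (hcd : c ≤ d) (h₂ : IsCoeff m M w₂) (f : Lp ℝ 2 (volOn c d))
    (hf : inner ℝ (toL2 c d w₁) f = 0) : neumannOpAdj c d hcd w₁ w₂ f =ᵐ[volOn c d]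
      fun x => w₂ x * ∫ s in c..x, mulOp c d w₁ f s := by
  have e : neumannOpAdj c d hcd w₁ w₂ f
      = mulOp c d w₂ (ContinuousLinearMap.adjoint (tailOp c d hcd) (mulOp c d w₁ f)) := by
    simp only [neumannOpAdj, ContinuousLinearMap.comp_apply, sub_apply,
      ContinuousLinearMap.id_apply]
    rw [Submodule.starProjection_singleton, hf]
    simp
  rw [e]
  filter_upwards [mulOp_ae h₂.memLp
    (ContinuousLinearMap.adjoint (tailOp c d hcd) (mulOp c d w₁ f)),
    tailOp_adjoint_ae hcd (mulOp c d w₁ f)] with x k1 k2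
  rw [k1, k2]

/-- Eigenvectors of `neumannOpAdj ∘ neumannOp` are Neumann eigenfunctions. -/
theorem exists_isMode_of_eigenvector (hcd : c ≤ d) (h₁ : IsCoeff m M w₁) (h₂ : IsCoeff m M w₂)
    {g : Lp ℝ 2 (volOn c d)} {κ : ℝ} (hκ : 0 < κ)
    (hg : neumannOpAdj c d hcd w₁ w₂ (neumannOp c d hcd w₁ w₂ g) = κ • g) :
    ∃ (ν : ℝ) (ψ η : ℝ → ℝ), IsMode (fun x => w₁ x ^ 2) (fun x => w₂ x ^ 2) c d ν ψ η ∧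
      η c = 0 ∧ η d = 0 ∧ ν ≠ 0 ∧
      (neumannOp c d hcd w₁ w₂ g =ᵐ[volOn c d] fun x => w₁ x * ψ x) ∧
      (fun x => w₂ x * η x) =ᵐ[volOn c d] fun x => -(ν * κ) * g x := by
  have hc : c ∈ Icc c d := left_mem_Icc.2 hcd
  have hd : d ∈ Icc c d := right_mem_Icc.2 hcd
  set φ := neumannOp c d hcd w₁ w₂ g
  have hφ0 : inner ℝ (toL2 c d w₁) φ = 0 := inner_neumannOp_eq_zero hcd g
  obtain ⟨r, hr⟩ := neumannOp_ae (w₂ := w₂) hcd h₁ g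
  set G := mulOp c d w₂ g
  set Φ := mulOp c d w₁ φ
  set ψ : ℝ → ℝ := fun x => (∫ s in x..d, G s) - r
  -- The eigenvalue equation amounts to ψ' = -w₂ g, θ' = w₁² ψ and κ g = w₂ θ, hence ψ' = -κ⁻¹ w₂²
  -- θ. With ν² = 1/κ and η = -ν θ this is the symmetric form required of a mode.
  set ν : ℝ := -1 / √κ
  set θ : ℝ → ℝ := fun x => ∫ s in c..x, Φ s
  have hν : ν ^ 2 * κ = 1 := by
    simp only [ν]; rw [div_pow, Real.sq_sqrt hκ.le]; field_simp
  have hν0 : ν ≠ 0 := by rintro h; rw [h] at hν; simp at hν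
  have hθ : ∀ z ∈ Icc c d, θ z = θ d - ∫ s in z..d, Φ s := by
    intro z hz
    simp only [θ]
    rw [← intervalIntegral.integral_add_adjacent_intervals (L2_intervalIntegrable Φ hc hz)
      (L2_intervalIntegrable Φ hz hd)]
    ring
  have hψ : ∀ z ∈ Icc c d, ψ z = ψ d - ∫ s in z..d, -G s := by
    intro z _; simp [ψ]; ring
  have hψc := continuousOn_of_eq_primitive hcd (Lp.memLp G).neg hψ
  have hθc := continuousOn_of_eq_primitive hcd (Lp.memLp Φ) hθ
  -- This is what the projection in `neumannOp` is for: orthogonality to `w₁` is the Neumann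
  -- condition at `d`. The one at `c` holds because θ is a primitive from `c`.
  have hθd : θ d = 0 := by
    rw [← hφ0, real_inner_comm, L2_inner_eq, setIntegral_Ioo_eq_intervalIntegral hcd]
    apply intervalIntegral_congr_volOn _ hc hd
    filter_upwards [mulOp_ae h₁.memLp φ, toL2_ae (h₁.memLp (c := c) (d := d))] with x k1 k2
    rw [k1, k2, mul_comm]
  have hθc0 : θ c = 0 := by simp [θ]
  have hΦ : Φ =ᵐ[volOn c d] fun x => w₁ x ^ 2 * ψ x := by
    filter_upwards [mulOp_ae h₁.memLp φ, hr] with x k1 k2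
    rw [k1, k2]; simp only [ψ]; ring
  have hgθ : (fun x => κ * g x) =ᵐ[volOn c d] fun x => w₂ x * θ x := by
    have := neumannOpAdj_ae hcd h₂ φ hφ0
    rw [hg] at this
    filter_upwards [this, Lp.coeFn_smul κ g] with x k1 k2
    rw [← k1, k2]; rfl
  have hG : (fun x => -G x) =ᵐ[volOn c d] fun x => ν * w₂ x ^ 2 * (ν * -θ x) := by
    filter_upwards [mulOp_ae h₂.memLp g, hgθ] with x k1 k2
    rw [k1]
    have : g x = ν ^ 2 * (κ * g x) := by rw [← mul_assoc, hν, one_mul]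
    rw [this, k2]; ring
  obtain ⟨ψ', η', hm, e1, e2⟩ := exists_isMode_of_continuousOn (ρ := fun x => w₁ x ^ 2)
    (b := fun x => w₂ x ^ 2) (ν := ν) (ψ := ψ) (η := fun x => ν * -θ x) hcd hψc
    (continuousOn_const.mul hθc.neg) (by
      intro x hx
      rw [hψ x hx, intervalIntegral_congr_volOn hG hx hd]) (by
      intro x hx
      have : (fun s => -(ν * w₁ s ^ 2 * ψ s)) =ᵐ[volOn c d] fun s => (-ν) * Φ s := by
        filter_upwards [hΦ] with s k1
        rw [k1]; ring
      rw [intervalIntegral_congr_volOn this hx hd, intervalIntegral.integral_const_mul]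
      simp only [hθ x hx]
      ring)
  refine ⟨ν, ψ', η', hm, ?_, ?_, hν0, ?_, ?_⟩
  · rw [e2 c hc, hθc0]; simp
  · rw [e2 d hd, hθd]; simp
  · filter_upwards [hr, ae_restrict_mem measurableSet_Ioo] with x k1 k2
    rw [k1, e1 x (Ioo_subset_Icc_self k2)]
  · filter_upwards [hgθ, ae_restrict_mem measurableSet_Ioo] with x k1 k2
    rw [e2 x (Ioo_subset_Icc_self k2)]
    linear_combination ν * k1

theorem neumannOp_eigenvector_cases (hcd : c ≤ d) {g : Lp ℝ 2 (volOn c d)} {κ : ℝ}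
    (hg : neumannOpAdj c d hcd w₁ w₂ (neumannOp c d hcd w₁ w₂ g) = κ • g) :
    neumannOp c d hcd w₁ w₂ g = 0 ∨ 0 < κ := by
  have h : ‖neumannOp c d hcd w₁ w₂ g‖ ^ 2 = κ * ‖g‖ ^ 2 := by
    rw [← real_inner_self_eq_norm_sq, neumannOp_inner, hg, real_inner_smul_right,
      real_inner_self_eq_norm_sq]
  rcases lt_or_ge 0 κ with hκ | hκ
  · exact Or.inr hκ
  · left
    have h1 : κ * ‖g‖ ^ 2 ≤ 0 := mul_nonpos_of_nonpos_of_nonneg hκ (by positivity)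
    rw [← h] at h1
    have h2 := le_antisymm h1 (by positivity)
    simpa using h2

/-- The eigenvectors of `neumannOpAdj ∘ neumannOp` are total. -/
theorem eq_zero_of_inner_eigenvector (hcd : c ≤ d) {f : Lp ℝ 2 (volOn c d)}
    (hf : ∀ (κ : ℝ) (g : Lp ℝ 2 (volOn c d)),
      neumannOpAdj c d hcd w₁ w₂ (neumannOp c d hcd w₁ w₂ g) = κ • g → inner ℝ g f = 0) :
    f = 0 := by
  set S := neumannOpAdj c d hcd w₁ w₂ ∘L neumannOp c d hcd w₁ w₂
  have hS : IsCompactOperator S :=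
    (isCompactOperator_neumannOp hcd).clm_comp (neumannOpAdj c d hcd w₁ w₂)
  have hS' : (S : Lp ℝ 2 (volOn c d) →ₗ[ℝ] Lp ℝ 2 (volOn c d)).IsSymmetric := by
    intro u v
    change inner ℝ (neumannOpAdj c d hcd w₁ w₂ (neumannOp c d hcd w₁ w₂ u)) v
      = inner ℝ u (neumannOpAdj c d hcd w₁ w₂ (neumannOp c d hcd w₁ w₂ v))
    rw [← neumannOp_inner, real_inner_comm, ← neumannOp_inner, real_inner_comm]
  have hbot := ContinuousLinearMap.orthogonalComplement_iSup_eigenspaces_eq_bot hS hS'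
  rw [← Submodule.mem_bot ℝ (x := f), ← hbot, Submodule.mem_orthogonal]
  intro u hu
  induction hu using Submodule.iSup_induction' with
  | mem κ g hg => exact hf κ g (Module.End.mem_eigenspace_iff.1 hg)
  | zero => exact inner_zero_left _
  | add u v _ _ hu hv => rw [inner_add_left, hu, hv, add_zero]

theorem eq_zero_of_mulOp_eq_zero (h₁ : IsCoeff m M w₁) {f : Lp ℝ 2 (volOn c d)}
    (h : mulOp c d w₁ f = 0) : f = 0 := by
  rw [Lp.eq_zero_iff_ae_eq_zero] at h ⊢
  filter_upwards [h, mulOp_ae h₁.memLp f] with x k1 k2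
  rw [k1] at k2
  simpa [(h₁.apply_pos x).ne'] using k2.symm

theorem eq_zero_of_primitive_mul_ae_eq_zero (hcd : c ≤ d) (h₂ : IsCoeff m M w₂)
    {f : Lp ℝ 2 (volOn c d)} (h : (fun x => w₂ x * ∫ s in c..x, f s) =ᵐ[volOn c d] 0) :
    f = 0 := by
  apply L2_eq_zero_of_primitive_eq_const hcd f 0
  filter_upwards [h] with x k1
  simpa [(h₂.apply_pos x).ne'] using k1

theorem eq_zero_of_neumannOp_eq_zero (hcd : c ≤ d) (h₁ : IsCoeff m M w₁) (h₂ : IsCoeff m M w₂)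
    {g : Lp ℝ 2 (volOn c d)} (h : neumannOp c d hcd w₁ w₂ g = 0) : g = 0 := by
  obtain ⟨r, hr⟩ := neumannOp_ae (w₂ := w₂) hcd h₁ g
  rw [h] at hr
  have hc : c ∈ Icc c d := left_mem_Icc.2 hcd
  have hd : d ∈ Icc c d := right_mem_Icc.2 hcd
  apply eq_zero_of_mulOp_eq_zero h₂
  set G := mulOp c d w₂ g
  apply L2_eq_zero_of_primitive_eq_const hcd G ((∫ s in c..d, G s) - r)
  filter_upwards [hr, Lp.coeFn_zero ℝ 2 (volOn c d), ae_restrict_mem measurableSet_Ioo]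
    with x k1 k2 k3
  rw [k2] at k1
  have k4 : (∫ s in x..d, G s) - r = 0 := by
    simpa [(h₁.apply_pos x).ne'] using k1.symm
  have hx := Ioo_subset_Icc_self k3
  rw [← intervalIntegral.integral_add_adjacent_intervals (L2_intervalIntegrable G hc hx)
    (L2_intervalIntegrable G hx hd)]
  linarith

/-- The first components of the Neumann eigenfunctions are total in `L²`. -/
theorem eq_zero_of_inner_isMode_fst {ρ b : ℝ → ℝ} (hcd : c < d) (hρ : IsCoeff m M ρ)
    (hb : IsCoeff m M b) {f : Lp ℝ 2 (volOn c d)}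
    (hf : ∀ (ν : ℝ) (ψ η : ℝ → ℝ), IsMode ρ b c d ν ψ η → η c = 0 → η d = 0 →
      ∫ x in Ioo c d, f x * ψ x = 0) : f = 0 := by
  have h₁ := hρ.sqrt
  have h₂ := hb.sqrt
  set w₁ := fun x => √(ρ x)
  set w₂ := fun x => √(b x)
  have hρ' : ρ = fun x => w₁ x ^ 2 := funext fun x => (Real.sq_sqrt (hρ.apply_pos x).le).symm
  have hb' : b = fun x => w₂ x ^ 2 := funext fun x => (Real.sq_sqrt (hb.apply_pos x).le).symm
  have h₁' := h₁.inv
  set F := mulOp c d (fun x => (w₁ x)⁻¹) f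
  have hF := mulOp_ae h₁'.memLp f
  -- The mode ν = 0, ψ = 1, η = 0 places F = f / w₁ in the orthogonal complement of `w₁`. There
  -- `neumannOpAdj` is injective, and pairing with the eigenvectors shows that it annihilates `F`.
  have he : inner ℝ (toL2 c d w₁) F = 0 := by
    have := hf 0 (fun _ => 1) (fun _ => 0) ⟨continuous_const, continuous_const, by simp, by simp⟩
      rfl rfl
    rw [← this, L2_inner_eq]
    apply integral_congr_ae
    filter_upwards [hF, toL2_ae (h₁.memLp (c := c) (d := d))] with x k1 k2
    rw [k1, k2, mul_inv_cancel_left₀ (h₁.apply_pos x).ne', mul_one]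
  have h0 : neumannOpAdj c d hcd.le w₁ w₂ F = 0 := by
    apply eq_zero_of_inner_eigenvector (w₁ := w₁) (w₂ := w₂) hcd.le
    intro κ g hg
    rw [← neumannOp_inner]
    rcases neumannOp_eigenvector_cases hcd.le hg with h | hκ
    · rw [h, inner_zero_left]
    · obtain ⟨ν, ψ, η, hm, hη1, hη2, -, hk, -⟩ := exists_isMode_of_eigenvector hcd.le h₁ h₂ hκ hg
      rw [← hρ', ← hb'] at hm
      rw [← hf ν ψ η hm hη1 hη2, L2_inner_eq]
      apply integral_congr_ae
      filter_upwards [hF, hk] with x k1 k2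
      rw [k1, k2]
      have := (h₁.apply_pos x).ne'
      field_simp
  have h1 := neumannOpAdj_ae hcd.le h₂ F he
  rw [h0] at h1
  have h2 : mulOp c d w₁ F = 0 := eq_zero_of_primitive_mul_ae_eq_zero hcd.le h₂
    (h1.symm.trans (Lp.coeFn_zero ℝ 2 _))
  exact eq_zero_of_mulOp_eq_zero h₁' (eq_zero_of_mulOp_eq_zero h₁ h2)

/-- The second components of the Neumann eigenfunctions are total in `L²`. -/
theorem eq_zero_of_inner_isMode_snd {ρ b : ℝ → ℝ} (hcd : c < d) (hρ : IsCoeff m M ρ)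
    (hb : IsCoeff m M b) {f : Lp ℝ 2 (volOn c d)}
    (hf : ∀ (ν : ℝ) (ψ η : ℝ → ℝ), IsMode ρ b c d ν ψ η → η c = 0 → η d = 0 →
      ∫ x in Ioo c d, f x * (b x * η x) = 0) : f = 0 := by
  have h₁ := hρ.sqrt
  have h₂ := hb.sqrt
  set w₁ := fun x => √(ρ x)
  set w₂ := fun x => √(b x)
  have hρ' : ρ = fun x => w₁ x ^ 2 := funext fun x => (Real.sq_sqrt (hρ.apply_pos x).le).symm
  have hb' : b = fun x => w₂ x ^ 2 := funext fun x => (Real.sq_sqrt (hb.apply_pos x).le).symm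
  apply eq_zero_of_mulOp_eq_zero h₂
  apply eq_zero_of_inner_eigenvector (w₁ := w₁) (w₂ := w₂) hcd.le
  intro κ g hg
  rcases neumannOp_eigenvector_cases hcd.le hg with h | hκ
  · rw [eq_zero_of_neumannOp_eq_zero hcd.le h₁ h₂ h, inner_zero_left]
  · obtain ⟨ν, ψ, η, hm, hη1, hη2, hν, -, hk⟩ := exists_isMode_of_eigenvector hcd.le h₁ h₂ hκ hg
    rw [← hρ', ← hb'] at hm
    have := hf ν ψ η hm hη1 hη2
    have e : ∫ x in Ioo c d, f x * (b x * η x)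
        = -(ν * κ) * inner ℝ g (mulOp c d w₂ f) := by
      rw [L2_inner_eq, ← integral_const_mul]
      apply integral_congr_ae
      filter_upwards [mulOp_ae h₂.memLp f, hk] with x k1 k2
      have k3 : b x = w₂ x ^ 2 := congrFun hb' x
      rw [k1, k3]
      linear_combination (f x * w₂ x) * k2
    rw [this, zero_eq_mul] at e
    exact e.resolve_left (neg_ne_zero.2 (mul_ne_zero hν hκ.ne'))

end

/-! ### Gronwall's inequality with jumps -/

/-- On a partition into n + 1 equal pieces the errors telescope to C (y₀ - x₀) (W y₀ - W x₀) / (n +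
1), which tends to zero. Errors of the form length times increment are thus negligible even where
`W` jumps. -/
theorem le_of_le_add_mul_sub {x₀ y₀ C : ℝ} {G W : ℝ → ℝ} (hxy : x₀ ≤ y₀)
    (h : ∀ x ∈ Icc x₀ y₀, ∀ y ∈ Icc x₀ y₀, x ≤ y → G x ≤ G y + C * ((y - x) * (W y - W x))) :
    G x₀ ≤ G y₀ := by
  have key : ∀ n : ℕ, G x₀ ≤ G y₀ + C * (y₀ - x₀) * (W y₀ - W x₀) * (1 / ((n : ℝ) + 1)) := by
    intro n
    set δ := (y₀ - x₀) / ((n : ℝ) + 1) with hδ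
    have hn : (0 : ℝ) < (n : ℝ) + 1 := by positivity
    have hδ0 : 0 ≤ δ := div_nonneg (sub_nonneg.2 hxy) hn.le
    have hmem : ∀ i : ℕ, i ≤ n + 1 → x₀ + i * δ ∈ Icc x₀ y₀ := by
      intro i hi
      refine ⟨by have : 0 ≤ (i : ℝ) * δ := by positivity
                 linarith, ?_⟩
      have : (i : ℝ) * δ ≤ ((n : ℝ) + 1) * δ := by
        gcongr; exact_mod_cast hi
      rw [hδ, mul_div_cancel₀ _ hn.ne'] at this
      linarith
    have ind : ∀ i : ℕ, i ≤ n + 1 →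
        G x₀ ≤ G (x₀ + i * δ) + C * δ * (W (x₀ + i * δ) - W x₀) := by
      intro i
      induction i with
      | zero => intro _; simp
      | succ i ih =>
        intro hi
        have h1 := ih (by omega)
        have h2 := h _ (hmem i (by omega)) _ (hmem (i + 1) hi) (by push_cast; linarith)
        have h3 : x₀ + ((i + 1 : ℕ) : ℝ) * δ - (x₀ + i * δ) = δ := by push_cast; ring
        rw [h3] at h2
        linarith
    have h1 := ind (n + 1) le_rfl
    have h2 : x₀ + ((n + 1 : ℕ) : ℝ) * δ = y₀ := by
      rw [hδ]; push_cast; field_simp; ring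
    rw [h2] at h1
    convert h1 using 2
    rw [hδ]; ring
  have hlim : Tendsto (fun n : ℕ => G y₀ + C * (y₀ - x₀) * (W y₀ - W x₀) * (1 / ((n : ℝ) + 1)))
      atTop (𝓝 (G y₀ + C * (y₀ - x₀) * (W y₀ - W x₀) * 0)) :=
    tendsto_const_nhds.add (tendsto_one_div_add_atTop_nhds_zero_nat.const_mul _)
  rw [mul_zero, add_zero] at hlim
  exact ge_of_tendsto' hlim key

/-- Gronwall's inequality for a function whose increments are controlled by those of a monotone
function, in both directions. -/
theorem gronwall_of_monotone {c d C : ℝ} {F U W S : ℝ → ℝ} (hC : 0 ≤ C)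
    (hU : MonotoneOn U (Ioo c d)) (hW : MonotoneOn W (Ioo c d))
    (hF : ∀ x ∈ Ioo c d, 0 ≤ F x) (hS : Continuous S) (hS0 : ∀ x, 0 ≤ S x)
    (h : ∀ x ∈ Ioo c d, ∀ y ∈ Ioo c d, x ≤ y → ∀ z, (z = x ∨ z = y) →
      |F y - F x| ≤ (U y - U x) * F z + (∫ s in x..y, S s) + C * ((y - x) * (W y - W x)))
    {x y : ℝ} (hx : x ∈ Ioo c d) (hy : y ∈ Ioo c d) (hxy : x ≤ y) :
    F x ≤ Real.exp (U y - U x) * (F y + ∫ s in x..y, S s) ∧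
      F y ≤ Real.exp (U y - U x) * (F x + ∫ s in x..y, S s) := by
  have hsub : Icc x y ⊆ Ioo c d := fun z hz => ⟨hx.1.trans_le hz.1, hz.2.trans_lt hy.2⟩
  have hSi : ∀ u v, IntervalIntegrable S volume u v := fun u v => hS.intervalIntegrable _ _
  have hSsplit : ∀ u v : ℝ, (∫ s in x..v, S s) = (∫ s in x..u, S s) + ∫ s in u..v, S s :=
    fun u v => (intervalIntegral.integral_add_adjacent_intervals (hSi _ _) (hSi _ _)).symm
  have hSn : ∀ u v : ℝ, u ≤ v → 0 ≤ ∫ s in u..v, S s := fun u v huv =>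
    intervalIntegral.integral_nonneg huv fun s _ => hS0 s
  have hWn : ∀ u ∈ Icc x y, ∀ v ∈ Icc x y, u ≤ v → 0 ≤ C * ((v - u) * (W v - W u)) :=
    fun u hu v hv huv => mul_nonneg hC (mul_nonneg (sub_nonneg.2 huv)
      (sub_nonneg.2 (hW (hsub hu) (hsub hv) huv)))
  constructor
  -- The hypothesis at the right end `z = v` of a small interval, combined with 1 + t ≤ exp t,
  -- compares exp(U) F at its two ends. The second half is the mirror image, with `z` the left end
  -- and the factor exp(-U).
  · have := le_of_le_add_mul_sub (G := fun z => Real.exp (U z) * F z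
        + Real.exp (U y) * ∫ s in x..z, S s) (W := W) (C := Real.exp (U y) * C) hxy (by
      intro u hu v hv huv
      have h1 := (abs_le.1 (h u (hsub hu) v (hsub hv) huv v (Or.inr rfl))).1
      have h2 : F u ≤ (U v - U u + 1) * F v
          + ((∫ s in u..v, S s) + C * ((v - u) * (W v - W u))) := by linarith
      have h3 : Real.exp (U u) * ((U v - U u + 1) * F v) ≤ Real.exp (U v) * F v := by
        rw [← mul_assoc]
        apply mul_le_mul_of_nonneg_right _ (hF v (hsub hv))
        calc Real.exp (U u) * (U v - U u + 1) ≤ Real.exp (U u) * Real.exp (U v - U u) := by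
              gcongr; exact Real.add_one_le_exp _
          _ = Real.exp (U v) := by rw [← Real.exp_add]; congr 1; ring
      have h4 : Real.exp (U u) * ((∫ s in u..v, S s) + C * ((v - u) * (W v - W u)))
          ≤ Real.exp (U y) * ((∫ s in u..v, S s) + C * ((v - u) * (W v - W u))) := by
        apply mul_le_mul_of_nonneg_right
        · exact Real.exp_le_exp.2 (hU (hsub hu) hy hu.2)
        · exact add_nonneg (hSn u v huv) (hWn u hu v hv huv)
      have h5 := mul_le_mul_of_nonneg_left h2 (Real.exp_pos (U u)).le
      simp only [hSsplit u v]
      linarith)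
    simp only [intervalIntegral.integral_same, mul_zero, add_zero] at this
    have e : Real.exp (U y - U x) * Real.exp (U x) = Real.exp (U y) := by
      rw [← Real.exp_add]; congr 1; ring
    rw [← mul_add, ← e, mul_comm (Real.exp (U y - U x)), mul_assoc] at this
    exact le_of_mul_le_mul_left this (Real.exp_pos _)
  · have := le_of_le_add_mul_sub (G := fun z => Real.exp (-U x) * (∫ s in x..z, S s)
        - Real.exp (-U z) * F z) (W := W) (C := Real.exp (-U x) * C) hxy (by
      intro u hu v hv huv
      have h1 := (abs_le.1 (h u (hsub hu) v (hsub hv) huv u (Or.inl rfl))).2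
      have h2 : F v ≤ (U v - U u + 1) * F u
          + ((∫ s in u..v, S s) + C * ((v - u) * (W v - W u))) := by linarith
      have h3 : Real.exp (-U v) * ((U v - U u + 1) * F u) ≤ Real.exp (-U u) * F u := by
        rw [← mul_assoc]
        apply mul_le_mul_of_nonneg_right _ (hF u (hsub hu))
        calc Real.exp (-U v) * (U v - U u + 1) ≤ Real.exp (-U v) * Real.exp (U v - U u) := by
              gcongr; exact Real.add_one_le_exp _
          _ = Real.exp (-U u) := by rw [← Real.exp_add]; congr 1; ring
      have h4 : Real.exp (-U v) * ((∫ s in u..v, S s) + C * ((v - u) * (W v - W u)))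
          ≤ Real.exp (-U x) * ((∫ s in u..v, S s) + C * ((v - u) * (W v - W u))) := by
        apply mul_le_mul_of_nonneg_right
        · exact Real.exp_le_exp.2 (neg_le_neg (hU hx (hsub hv) hv.1))
        · exact add_nonneg (hSn u v huv) (hWn u hu v hv huv)
      have h5 := mul_le_mul_of_nonneg_left h2 (Real.exp_pos (-U v)).le
      simp only [hSsplit u v]
      linarith)
    simp only [intervalIntegral.integral_same, mul_zero, zero_sub] at this
    have e : Real.exp (-U y) * Real.exp (U y - U x) = Real.exp (-U x) := by
      rw [← Real.exp_add]; congr 1; ring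
    have h6 : Real.exp (-U y) * F y ≤ Real.exp (-U x) * (F x + ∫ s in x..y, S s) := by
      linarith
    rw [← e, mul_assoc] at h6
    exact le_of_mul_le_mul_left h6 (Real.exp_pos _)

/-- Coefficients `ρ`, `b = 1 / a` of the wave equation `ρ y_tt = (a y_x)_x` on `(0, L)`: bounded
above and below, of bounded variation, and with slowness `√(ρ b)` at most `β`. -/
structure WaveCoeffs (m M v β L : ℝ) (ρ b : ℝ → ℝ) : Prop where
  isCoeff_fst : IsCoeff m M ρ
  isCoeff_snd : IsCoeff m M b
  exists_variation : ∃ V : ℝ → ℝ, MonotoneOn V (Ioo 0 L) ∧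
    ∀ x ∈ Ioo 0 L, ∀ y ∈ Ioo 0 L, x ≤ y →
      V y - V x ≤ v ∧ |ρ y - ρ x| ≤ V y - V x ∧ |b y - b x| ≤ V y - V x
  slowness : ∀ᵐ x ∂(volOn 0 L), ρ x * b x ≤ β ^ 2
  beta_nonneg : 0 ≤ β
  length_pos : 0 < L

/-- Gronwall's inequality for F = ρ A + b B. Formally dF = A dρ + B db + 2 ρ b (h₁ + h₂) dx; the
first two terms contribute v/m to the exponent and the last one is bounded by `hh`. As F jumps with
the coefficients, the computation uses finite increments, with errors of size length times
oscillation that disappear under refinement. The bound `H` depends on the given functions but enters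
only these errors, so the final constant does not depend on it. -/
theorem WaveCoeffs.energy_le {m M v β L : ℝ} {ρ b : ℝ → ℝ} (hc : WaveCoeffs m M v β L ρ b)
    {κ : ℝ} (hκ : 0 ≤ κ) {A B h₁ h₂ S : ℝ → ℝ} (hh₁ : Continuous h₁) (hh₂ : Continuous h₂)
    (hA : Continuous A) (hB : Continuous B)
    (hA0 : ∀ x, 0 ≤ A x) (hB0 : ∀ x, 0 ≤ B x) (hS : Continuous S) (hS0 : ∀ x, 0 ≤ S x)
    (hAe : ∀ x ∈ Icc 0 L, ∀ y ∈ Icc 0 L, x ≤ y → A y - A x = ∫ s in x..y, b s * (2 * h₁ s))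
    (hBe : ∀ x ∈ Icc 0 L, ∀ y ∈ Icc 0 L, x ≤ y → B y - B x = ∫ s in x..y, ρ s * (2 * h₂ s))
    (hh : ∀ᵐ s ∂(volOn 0 L), |2 * (ρ s * b s) * (h₁ s + h₂ s)|
      ≤ κ * (ρ s * A s + b s * B s) + S s)
    {x y : ℝ} (hx : x ∈ Ioo 0 L) (hy : y ∈ Ioo 0 L) (hxy : x ≤ y) :
    A x + B x ≤ M / m * Real.exp (v / m + κ * L) * (A y + B y + 1 / M * ∫ s in 0..L, S s) ∧
    A y + B y ≤ M / m * Real.exp (v / m + κ * L) * (A x + B x + 1 / M * ∫ s in 0..L, S s) := by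
  obtain ⟨V, hV, hVρ⟩ := hc.exists_variation
  have hρ := hc.isCoeff_fst
  have hb := hc.isCoeff_snd
  have hm := hρ.pos
  have hM := hρ.upper_pos
  obtain ⟨H, hH⟩ : ∃ H, ∀ s ∈ Icc 0 L, |h₁ s| ≤ H ∧ |h₂ s| ≤ H ∧ A s ≤ H ∧ B s ≤ H := by
    obtain ⟨H1, k1⟩ := isCompact_Icc.exists_bound_of_continuousOn (hh₁.continuousOn (s := Icc 0 L))
    obtain ⟨H2, k2⟩ := isCompact_Icc.exists_bound_of_continuousOn (hh₂.continuousOn (s := Icc 0 L))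
    obtain ⟨H3, k3⟩ := isCompact_Icc.exists_bound_of_continuousOn (hA.continuousOn (s := Icc 0 L))
    obtain ⟨H4, k4⟩ := isCompact_Icc.exists_bound_of_continuousOn (hB.continuousOn (s := Icc 0 L))
    refine ⟨max (max H1 H2) (max H3 H4), fun s hs => ⟨?_, ?_, ?_, ?_⟩⟩
    · exact (k1 s hs).trans ((le_max_left _ _).trans (le_max_left _ _))
    · exact (k2 s hs).trans ((le_max_right _ _).trans (le_max_left _ _))
    · exact (le_abs_self _).trans ((k3 s hs).trans ((le_max_left _ _).trans (le_max_right _ _)))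
    · exact (le_abs_self _).trans ((k4 s hs).trans ((le_max_right _ _).trans (le_max_right _ _)))
  have hH0 : 0 ≤ H := (abs_nonneg _).trans (hH 0 (left_mem_Icc.2 hc.length_pos.le)).1
  set F : ℝ → ℝ := fun s => ρ s * A s + b s * B s with hF
  have hF0 : ∀ s, 0 ≤ F s := fun s => add_nonneg (mul_nonneg (hρ.apply_pos s).le (hA0 s))
    (mul_nonneg (hb.apply_pos s).le (hB0 s))
  have hio : ∀ {s : ℝ}, s ∈ Ioo 0 L → s ∈ Icc 0 L := fun h => Ioo_subset_Icc_self h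
  have hlip : ∀ {w f : ℝ → ℝ}, IsCoeff m M w → Continuous f → (∀ s ∈ Icc 0 L, |f s| ≤ H) →
      ∀ u ∈ Icc 0 L, ∀ t ∈ Icc 0 L, u ≤ t → |∫ s in u..t, w s * (2 * f s)| ≤ 2 * M * H * (t - u) := by
    intro w f hw hf hfH u hu t ht hut
    have := intervalIntegral.norm_integral_le_of_norm_le_const (a := u) (b := t)
      (f := fun s => w s * (2 * f s)) (C := 2 * M * H) (by
        intro s hs
        rw [uIoc_of_le hut] at hs
        rw [Real.norm_eq_abs, abs_mul, abs_mul, abs_two]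
        calc |w s| * (2 * |f s|) ≤ M * (2 * H) := by
              gcongr
              · exact hw.abs_le s
              · exact hfH s ⟨hu.1.trans hs.1.le, hs.2.trans ht.2⟩
          _ = _ := by ring)
    rwa [Real.norm_eq_abs, abs_of_nonneg (sub_nonneg.2 hut)] at this
  have hosc : ∀ {w D : ℝ → ℝ}, IsCoeff m M w → (∀ s ∈ Icc 0 L, |D s| ≤ H) →
      (∀ u ∈ Icc 0 L, ∀ t ∈ Icc 0 L, u ≤ t → |D t - D u| ≤ 2 * M * H * (t - u)) →
      (∀ u ∈ Ioo 0 L, ∀ t ∈ Ioo 0 L, u ≤ t → |w t - w u| ≤ V t - V u) →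
      ∀ u ∈ Ioo 0 L, ∀ t ∈ Ioo 0 L, u ≤ t →
        |w t * D t - w u * D u| ≤ H * (V t - V u) + 2 * M ^ 2 * H * (t - u) := by
    intro w D hw hD hDl hwV u hu t ht hut
    have e : w t * D t - w u * D u = (w t - w u) * D t + w u * (D t - D u) := by ring
    rw [e]
    refine (abs_add_le _ _).trans ?_
    rw [abs_mul, abs_mul]
    have k1 := mul_le_mul (hwV u hu t ht hut) (hD t (hio ht)) (abs_nonneg _)
      ((abs_nonneg _).trans (hwV u hu t ht hut))
    have k2 := mul_le_mul (hw.abs_le u) (hDl u (hio hu) t (hio ht) hut) (abs_nonneg _) hM.le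
    linarith
  have hoscF : ∀ u ∈ Ioo 0 L, ∀ t ∈ Ioo 0 L, u ≤ t →
      |F t - F u| ≤ 2 * H * (V t - V u) + 4 * M ^ 2 * H * (t - u) := by
    intro u hu t ht hut
    have k1 := hosc hρ (D := A) (fun s hs => by rw [abs_of_nonneg (hA0 s)]; exact (hH s hs).2.2.1)
      (fun u hu t ht hut => by
        rw [hAe u hu t ht hut]; exact hlip hb hh₁ (fun s hs => (hH s hs).1) u hu t ht hut)
      (fun u hu t ht hut => (hVρ u hu t ht hut).2.1) u hu t ht hut
    have k2 := hosc hb (D := B) (fun s hs => by rw [abs_of_nonneg (hB0 s)]; exact (hH s hs).2.2.2)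
      (fun u hu t ht hut => by
        rw [hBe u hu t ht hut]; exact hlip hρ hh₂ (fun s hs => (hH s hs).2.1) u hu t ht hut)
      (fun u hu t ht hut => (hVρ u hu t ht hut).2.2) u hu t ht hut
    have e : F t - F u = (ρ t * A t - ρ u * A u) + (b t * B t - b u * B u) := by
      simp only [hF]; ring
    rw [e]
    refine (abs_add_le _ _).trans ?_
    linarith
  set C₁ : ℝ := 2 * H + 4 * M ^ 2 * H
  have hC₁ : 0 ≤ C₁ := by positivity
  have hstep : ∀ u ∈ Ioo 0 L, ∀ t ∈ Ioo 0 L, u ≤ t → ∀ z, (z = u ∨ z = t) →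
      |F t - F u| ≤ ((V t / m + κ * t) - (V u / m + κ * u)) * F z + (∫ s in u..t, S s)
        + (κ * C₁ + 4 * M * H) * ((t - u) * ((V t + t) - (V u + u))) := by
    intro u hu t ht hut z hz
    -- Discrete product rule: if `A` and `B` are taken at one end of the interval, the coefficients
    -- multiplying their increments are taken at the other end.
    obtain ⟨z', hz', hsplit⟩ : ∃ z', (z' = u ∨ z' = t) ∧
        F t - F u = ((ρ t - ρ u) * A z + (b t - b u) * B z)
          + (ρ z' * (A t - A u) + b z' * (B t - B u)) := by
      rcases hz with rfl | rfl
      · exact ⟨t, Or.inr rfl, by simp only [hF]; ring⟩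
      · exact ⟨u, Or.inl rfl, by simp only [hF]; ring⟩
    have hzm : z ∈ Icc u t := by
      rcases hz with rfl | rfl <;> simp [hut]
    have hzm' : z' ∈ Icc u t := by
      rcases hz' with rfl | rfl <;> simp [hut]
    have hIo : ∀ {s}, s ∈ Icc u t → s ∈ Ioo 0 L := fun hs =>
      ⟨hu.1.trans_le hs.1, hs.2.trans_lt ht.2⟩
    obtain ⟨-, hVu1, hVu2⟩ := hVρ u hu t ht hut
    have hΔ : 0 ≤ V t - V u := (abs_nonneg _).trans hVu1
    set Δ := (V t + t) - (V u + u) with hΔd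
    have hΔ0 : 0 ≤ Δ := by rw [hΔd]; linarith
    have hΔ1 : V t - V u ≤ Δ := by rw [hΔd]; linarith
    have hΔ2 : t - u ≤ Δ := by rw [hΔd]; linarith
    -- oscillation of the coefficients and of `F` inside `[u, t]`
    have hw : ∀ {w : ℝ → ℝ}, (∀ u ∈ Ioo 0 L, ∀ t ∈ Ioo 0 L, u ≤ t → |w t - w u| ≤ V t - V u) →
        ∀ p ∈ Icc u t, ∀ q ∈ Icc u t, |w p - w q| ≤ Δ := by
      intro w hwV p hp q hq
      rcases le_total q p with hqp | hqp
      · have k1 := hwV q (hIo hq) p (hIo hp) hqp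
        have k2 := hV hu (hIo hq) hq.1
        have k3 := hV (hIo hp) ht hp.2
        linarith
      · rw [abs_sub_comm]
        have k1 := hwV p (hIo hp) q (hIo hq) hqp
        have k2 := hV hu (hIo hp) hp.1
        have k3 := hV (hIo hq) ht hq.2
        linarith
    have hFz : ∀ s ∈ Icc u t, F s ≤ F z + C₁ * Δ := by
      intro s hs
      have aux : ∀ p ∈ Icc u t, ∀ q ∈ Icc u t, p ≤ q → |F q - F p| ≤ C₁ * Δ := by
        intro p hp q hq hpq
        have k1 := hoscF p (hIo hp) q (hIo hq) hpq
        have k2 := hV hu (hIo hp) hp.1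
        have k3 := hV (hIo hq) ht hq.2
        have k4 : 2 * H * (V q - V p) ≤ 2 * H * Δ := by gcongr; linarith
        have k5 : 4 * M ^ 2 * H * (q - p) ≤ 4 * M ^ 2 * H * Δ := by
          gcongr; linarith [hp.1, hq.2]
        simp only [C₁]
        linarith
      rcases le_total s z with h | h
      · have := (abs_le.1 (aux s hs z hzm h)).1
        linarith
      · have := (abs_le.1 (aux z hzm s hs h)).2
        linarith
    have hi1 : ∀ {w f : ℝ → ℝ}, IsCoeff m M w → Continuous f → ∀ r : ℝ,
        IntervalIntegrable (fun s => r * (w s * (2 * f s))) volume u t := fun hw hf r =>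
      (hw.intervalIntegrable_mul (continuous_const.mul hf) u t).const_mul r
    have hmain : |ρ z' * (A t - A u) + b z' * (B t - B u)|
        ≤ ∫ s in u..t, ((κ * (F z + C₁ * Δ) + 4 * M * H * Δ) + S s) := by
      rw [hAe u (hio hu) t (hio ht) hut, hBe u (hio hu) t (hio ht) hut,
        ← intervalIntegral.integral_const_mul, ← intervalIntegral.integral_const_mul,
        ← intervalIntegral.integral_add (hi1 hb hh₁ _) (hi1 hρ hh₂ _), ← Real.norm_eq_abs]
      refine intervalIntegral.norm_integral_le_of_norm_le (μ := volume) hut ?_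
        (intervalIntegrable_const.add (hS.intervalIntegrable _ _))
      rw [ae_restrict_iff' measurableSet_Ioo] at hh
      filter_upwards [hh] with s hs hsm
      have hsI : s ∈ Icc u t := Ioc_subset_Icc_self hsm
      have hs1 := hs (hIo hsI)
      obtain ⟨k1, k2, -, -⟩ := hH s (hio (hIo hsI))
      -- Moving the coefficients from `z'` to `s` isolates the exact source 2 ρ b (h₁ + h₂), up to
      -- an oscillation of the coefficients of at most `Δ`.
      have e : ρ z' * (b s * (2 * h₁ s)) + b z' * (ρ s * (2 * h₂ s))
          = 2 * (ρ s * b s) * (h₁ s + h₂ s)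
            + ((ρ z' - ρ s) * (b s * (2 * h₁ s)) + (b z' - b s) * (ρ s * (2 * h₂ s))) := by ring
      rw [e, Real.norm_eq_abs]
      refine (abs_add_le _ _).trans ?_
      have aux : ∀ {w w' f : ℝ → ℝ}, IsCoeff m M w' → |f s| ≤ H → |w z' - w s| ≤ Δ →
          |(w z' - w s) * (w' s * (2 * f s))| ≤ 2 * M * H * Δ := by
        intro w w' f hw' hf hwΔ
        rw [abs_mul, abs_mul, abs_mul, abs_two]
        calc |w z' - w s| * (|w' s| * (2 * |f s|)) ≤ Δ * (M * (2 * H)) := by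
              gcongr; exact hw'.abs_le s
          _ = _ := by ring
      have j1 := aux (w := ρ) hb k1 (hw (fun u hu t ht hut => (hVρ u hu t ht hut).2.1) z' hzm' s hsI)
      have j2 := aux (w := b) hρ k2 (hw (fun u hu t ht hut => (hVρ u hu t ht hut).2.2) z' hzm' s hsI)
      have j3 := abs_add_le ((ρ z' - ρ s) * (b s * (2 * h₁ s))) ((b z' - b s) * (ρ s * (2 * h₂ s)))
      have j4 : κ * F s ≤ κ * (F z + C₁ * Δ) := by gcongr; exact hFz s hsI
      linarith
    rw [intervalIntegral.integral_add intervalIntegrable_const (hS.intervalIntegrable _ _),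
      intervalIntegral.integral_const, smul_eq_mul] at hmain
    have hcoef : |(ρ t - ρ u) * A z + (b t - b u) * B z| ≤ (V t - V u) / m * F z := by
      refine (abs_add_le _ _).trans ?_
      rw [abs_mul, abs_mul, abs_of_nonneg (hA0 z), abs_of_nonneg (hB0 z)]
      have j1 : m * (A z + B z) ≤ F z := by
        have i1 := mul_le_mul_of_nonneg_right (hρ.lower z) (hA0 z)
        have i2 := mul_le_mul_of_nonneg_right (hb.lower z) (hB0 z)
        simp only [hF]; linarith
      have j2 := mul_le_mul_of_nonneg_right hVu1 (hA0 z)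
      have j3 := mul_le_mul_of_nonneg_right hVu2 (hB0 z)
      have j4 := mul_le_mul_of_nonneg_left j1 (div_nonneg hΔ hm.le)
      have j5 : (V t - V u) / m * (m * (A z + B z)) = (V t - V u) * (A z + B z) := by
        field_simp
      linarith
    rw [hsplit]
    refine (abs_add_le _ _).trans ((add_le_add hcoef hmain).trans (le_of_eq ?_))
    ring
  have hU : MonotoneOn (fun s => V s / m + κ * s) (Ioo 0 L) := by
    intro u hu t ht hut
    have := hV hu ht hut
    simp only
    gcongr
  have hW : MonotoneOn (fun s => V s + s) (Ioo 0 L) := fun u hu t ht hut =>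
    add_le_add (hV hu ht hut) hut
  obtain ⟨g1, g2⟩ := gronwall_of_monotone (c := 0) (d := L) (C := κ * C₁ + 4 * M * H)
    (by positivity) hU hW (fun s _ => hF0 s) hS hS0 hstep hx hy hxy
  have hSle : ∫ s in x..y, S s ≤ ∫ s in 0..L, S s :=
    intervalIntegral.integral_mono_interval hx.1.le hxy hy.2.le (ae_of_all _ hS0)
      (hS.intervalIntegrable _ _)
  have hexp : Real.exp ((V y / m + κ * y) - (V x / m + κ * x)) ≤ Real.exp (v / m + κ * L) := by
    rw [Real.exp_le_exp]
    have k1 := div_le_div_of_nonneg_right (hVρ x hx y hy hxy).1 hm.le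
    have k2 : κ * (y - x) ≤ κ * L := by gcongr; linarith [hx.1, hy.2]
    rw [sub_div] at k1
    linarith
  have hFlow : ∀ s, m * (A s + B s) ≤ F s := by
    intro s
    have i1 := mul_le_mul_of_nonneg_right (hρ.lower s) (hA0 s)
    have i2 := mul_le_mul_of_nonneg_right (hb.lower s) (hB0 s)
    simp only [hF]; linarith
  have hFup : ∀ s, F s ≤ M * (A s + B s) := by
    intro s
    have i1 := mul_le_mul_of_nonneg_right (hρ.upper s) (hA0 s)
    have i2 := mul_le_mul_of_nonneg_right (hb.upper s) (hB0 s)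
    simp only [hF]; linarith
  have fin : ∀ s t, F s ≤ Real.exp ((V y / m + κ * y) - (V x / m + κ * x))
        * (F t + ∫ s in x..y, S s) →
      A s + B s ≤ M / m * Real.exp (v / m + κ * L) * (A t + B t + 1 / M * ∫ s in 0..L, S s) := by
    intro s t hst
    have hI0 : 0 ≤ ∫ s in x..y, S s := intervalIntegral.integral_nonneg hxy fun s _ => hS0 s
    have k1 : m * (A s + B s) ≤ Real.exp (v / m + κ * L)
        * (M * (A t + B t) + ∫ s in 0..L, S s) := by
      refine (hFlow s).trans (hst.trans ?_)
      apply mul_le_mul hexp (add_le_add (hFup t) hSle) (add_nonneg (hF0 t) hI0)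
        (Real.exp_pos _).le
    have k2 : M / m * Real.exp (v / m + κ * L) * (A t + B t + 1 / M * ∫ s in 0..L, S s)
        = (Real.exp (v / m + κ * L) * (M * (A t + B t) + ∫ s in 0..L, S s)) / m := by
      field_simp
    rw [k2, le_div_iff₀ hm]
    linarith
  exact ⟨fin x y g1, fin y x g2⟩

/-! ### Regular waves -/

/-- `P = y_t` and `Q = a y_x` for a solution `y` of `ρ y_tt = (a y_x)_x`, `a = 1 / b`, that is smooth
in time and satisfies the Neumann condition `Q(L, t) = 0`. -/
structure IsWave (ρ b : ℝ → ℝ) (L : ℝ) (P Q Pt Qt : ℝ → ℝ → ℝ) : Prop where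
  continuous_P : Continuous fun z : ℝ × ℝ => P z.1 z.2
  continuous_Q : Continuous fun z : ℝ × ℝ => Q z.1 z.2
  continuous_Pt : Continuous fun z : ℝ × ℝ => Pt z.1 z.2
  continuous_Qt : Continuous fun z : ℝ × ℝ => Qt z.1 z.2
  hasDerivAt_P : ∀ x t, HasDerivAt (P x) (Pt x t) t
  hasDerivAt_Q : ∀ x t, HasDerivAt (Q x) (Qt x t) t
  eq_P : ∀ t, ∀ x ∈ Icc 0 L, P x t = P L t - ∫ s in x..L, b s * Qt s t
  eq_Q : ∀ t, ∀ x ∈ Icc 0 L, Q x t = Q L t - ∫ s in x..L, ρ s * Pt s t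
  right_Q : ∀ t, Q L t = 0
  hasDerivAt_toL2_P : ∀ t, HasDerivAt (fun t => toL2 0 L fun x => P x t)
    (toL2 0 L fun x => Pt x t) t
  hasDerivAt_toL2_R : ∀ t, HasDerivAt (fun t => toL2 0 L fun x => b x * Q x t)
    (toL2 0 L fun x => b x * Qt x t) t

theorem continuous_of_uncurry_left {P : ℝ → ℝ → ℝ} (h : Continuous fun z : ℝ × ℝ => P z.1 z.2)
    (t : ℝ) : Continuous fun x => P x t :=
  h.comp (continuous_id.prodMk continuous_const)

theorem continuous_of_uncurry_right {P : ℝ → ℝ → ℝ} (h : Continuous fun z : ℝ × ℝ => P z.1 z.2)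
    (x : ℝ) : Continuous fun t => P x t :=
  h.comp (continuous_const.prodMk continuous_id)

theorem IsCoeff.integrableOn_prod {m M : ℝ} {w : ℝ → ℝ} (hw : IsCoeff m M w) {G : ℝ → ℝ → ℝ}
    (hG : Continuous fun z : ℝ × ℝ => G z.1 z.2) (x y s t : ℝ) :
    IntegrableOn (Function.uncurry fun x t => w x * G x t) (uIoc x y ×ˢ uIoc s t) := by
  have h1 : IntegrableOn (fun z : ℝ × ℝ => G z.1 z.2) (uIoc x y ×ˢ uIoc s t) :=
    (hG.continuousOn.integrableOn_compact (isCompact_uIcc.prod isCompact_uIcc)).mono_set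
      (prod_mono uIoc_subset_uIcc uIoc_subset_uIcc)
  exact h1.bdd_mul (c := M) (hw.measurable.comp measurable_fst).aestronglyMeasurable
    (ae_of_all _ fun z => hw.abs_le z.1)

theorem IsCoeff.integral_swap {m M : ℝ} {w : ℝ → ℝ} (hw : IsCoeff m M w) {G : ℝ → ℝ → ℝ}
    (hG : Continuous fun z : ℝ × ℝ => G z.1 z.2) (x y s t : ℝ) :
    ∫ z in x..y, w z * ∫ r in s..t, G z r = ∫ r in s..t, ∫ z in x..y, w z * G z r := by
  rw [← intervalIntegral_intervalIntegral_swap (hw.integrableOn_prod hG x y s t)]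
  simp only [intervalIntegral.integral_const_mul]

theorem continuous_integral_left {G : ℝ → ℝ → ℝ} (hG : Continuous fun z : ℝ × ℝ => G z.1 z.2)
    (s t : ℝ) : Continuous fun x => ∫ r in s..t, G x r :=
  intervalIntegral.continuous_parametric_intervalIntegral_of_continuous' hG s t

namespace IsWave

variable {ρ b : ℝ → ℝ} {L : ℝ} {P Q Pt Qt P' Q' Pt' Qt' : ℝ → ℝ → ℝ} {m M : ℝ}

theorem memLp_P (h : IsWave ρ b L P Q Pt Qt) (t : ℝ) {p : ENNReal} :
    MemLp (fun x => P x t) p (volOn 0 L) :=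
  memLp_of_continuousOn (continuous_of_uncurry_left h.continuous_P t).continuousOn

theorem memLp_R (hb : IsCoeff m M b) (h : IsWave ρ b L P Q Pt Qt) (t : ℝ) {p : ENNReal} :
    MemLp (fun x => b x * Q x t) p (volOn 0 L) :=
  hb.memLp_mul (continuous_of_uncurry_left h.continuous_Q t).continuousOn

theorem toL2_P_add (h : IsWave ρ b L P Q Pt Qt) (h' : IsWave ρ b L P' Q' Pt' Qt') (t : ℝ) :
    (toL2 0 L fun x => P x t + P' x t) = (toL2 0 L fun x => P x t) + toL2 0 L fun x => P' x t :=
  toL2_add (h.memLp_P t) (h'.memLp_P t)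

theorem toL2_R_add (hb : IsCoeff m M b) (h : IsWave ρ b L P Q Pt Qt)
    (h' : IsWave ρ b L P' Q' Pt' Qt') (t : ℝ) :
    (toL2 0 L fun x => b x * (Q x t + Q' x t))
      = (toL2 0 L fun x => b x * Q x t) + toL2 0 L fun x => b x * Q' x t := by
  rw [← toL2_add (h.memLp_R hb t) (h'.memLp_R hb t)]
  simp only [mul_add]

theorem toL2_P_const_mul (h : IsWave ρ b L P Q Pt Qt) (r t : ℝ) :
    (toL2 0 L fun x => r * P x t) = r • toL2 0 L fun x => P x t :=
  toL2_const_mul (h.memLp_P t) r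

theorem toL2_R_const_mul (hb : IsCoeff m M b) (h : IsWave ρ b L P Q Pt Qt) (r t : ℝ) :
    (toL2 0 L fun x => b x * (r * Q x t)) = r • toL2 0 L fun x => b x * Q x t := by
  rw [← toL2_const_mul (h.memLp_R hb t)]
  congr 1; ext x; ring

theorem add (hρ : IsCoeff m M ρ) (hb : IsCoeff m M b) (h : IsWave ρ b L P Q Pt Qt)
    (h' : IsWave ρ b L P' Q' Pt' Qt') :
    IsWave ρ b L (fun x t => P x t + P' x t) (fun x t => Q x t + Q' x t)
      (fun x t => Pt x t + Pt' x t) (fun x t => Qt x t + Qt' x t) where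
  continuous_P := h.continuous_P.add h'.continuous_P
  continuous_Q := h.continuous_Q.add h'.continuous_Q
  continuous_Pt := h.continuous_Pt.add h'.continuous_Pt
  continuous_Qt := h.continuous_Qt.add h'.continuous_Qt
  hasDerivAt_P x t := (h.hasDerivAt_P x t).add (h'.hasDerivAt_P x t)
  hasDerivAt_Q x t := (h.hasDerivAt_Q x t).add (h'.hasDerivAt_Q x t)
  eq_P t x hx := by
    have h1 := hb.intervalIntegrable_mul (continuous_of_uncurry_left h.continuous_Qt t) x L
    have h2 := hb.intervalIntegrable_mul (continuous_of_uncurry_left h'.continuous_Qt t) x L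
    simp only [mul_add]
    rw [intervalIntegral.integral_add h1 h2, h.eq_P t x hx, h'.eq_P t x hx]
    ring
  eq_Q t x hx := by
    have h1 := hρ.intervalIntegrable_mul (continuous_of_uncurry_left h.continuous_Pt t) x L
    have h2 := hρ.intervalIntegrable_mul (continuous_of_uncurry_left h'.continuous_Pt t) x L
    simp only [mul_add]
    rw [intervalIntegral.integral_add h1 h2, h.eq_Q t x hx, h'.eq_Q t x hx]
    ring
  right_Q t := by rw [h.right_Q, h'.right_Q, add_zero]
  hasDerivAt_toL2_P t := by
    have e : (toL2 0 L fun x => Pt x t + Pt' x t)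
        = (toL2 0 L fun x => Pt x t) + toL2 0 L fun x => Pt' x t := toL2_add
      (memLp_of_continuousOn (continuous_of_uncurry_left h.continuous_Pt t).continuousOn)
      (memLp_of_continuousOn (continuous_of_uncurry_left h'.continuous_Pt t).continuousOn)
    simp only [h.toL2_P_add h', e]
    exact (h.hasDerivAt_toL2_P t).add (h'.hasDerivAt_toL2_P t)
  hasDerivAt_toL2_R t := by
    have e : (toL2 0 L fun x => b x * (Qt x t + Qt' x t))
        = (toL2 0 L fun x => b x * Qt x t) + toL2 0 L fun x => b x * Qt' x t := by
      rw [← toL2_add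
        (hb.memLp_mul (continuous_of_uncurry_left h.continuous_Qt t).continuousOn)
        (hb.memLp_mul (continuous_of_uncurry_left h'.continuous_Qt t).continuousOn)]
      simp only [mul_add]
    simp only [h.toL2_R_add hb h', e]
    exact (h.hasDerivAt_toL2_R t).add (h'.hasDerivAt_toL2_R t)

theorem const_mul (hb : IsCoeff m M b) (h : IsWave ρ b L P Q Pt Qt) (r : ℝ) :
    IsWave ρ b L (fun x t => r * P x t) (fun x t => r * Q x t)
      (fun x t => r * Pt x t) (fun x t => r * Qt x t) where
  continuous_P := continuous_const.mul h.continuous_P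
  continuous_Q := continuous_const.mul h.continuous_Q
  continuous_Pt := continuous_const.mul h.continuous_Pt
  continuous_Qt := continuous_const.mul h.continuous_Qt
  hasDerivAt_P x t := (h.hasDerivAt_P x t).const_mul r
  hasDerivAt_Q x t := (h.hasDerivAt_Q x t).const_mul r
  eq_P t x hx := by
    simp only [mul_left_comm _ r]
    rw [intervalIntegral.integral_const_mul, h.eq_P t x hx, mul_sub]
  eq_Q t x hx := by
    simp only [mul_left_comm _ r]
    rw [intervalIntegral.integral_const_mul, h.eq_Q t x hx, mul_sub]
  right_Q t := by rw [h.right_Q, mul_zero]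
  hasDerivAt_toL2_P t := by
    have e : (toL2 0 L fun x => r * Pt x t) = r • toL2 0 L fun x => Pt x t := toL2_const_mul
      (memLp_of_continuousOn (continuous_of_uncurry_left h.continuous_Pt t).continuousOn) r
    simp only [h.toL2_P_const_mul, e]
    exact (h.hasDerivAt_toL2_P t).const_smul r
  hasDerivAt_toL2_R t := by
    have e : (toL2 0 L fun x => b x * (r * Qt x t)) = r • toL2 0 L fun x => b x * Qt x t := by
      rw [← toL2_const_mul
        (hb.memLp_mul (continuous_of_uncurry_left h.continuous_Qt t).continuousOn)]
      simp only [mul_left_comm _ r]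
    simp only [h.toL2_R_const_mul hb, e]
    exact (h.hasDerivAt_toL2_R t).const_smul r

theorem sub (hρ : IsCoeff m M ρ) (hb : IsCoeff m M b) (h : IsWave ρ b L P Q Pt Qt)
    (h' : IsWave ρ b L P' Q' Pt' Qt') :
    IsWave ρ b L (fun x t => P x t - P' x t) (fun x t => Q x t - Q' x t)
      (fun x t => Pt x t - Pt' x t) (fun x t => Qt x t - Qt' x t) := by
  simpa only [neg_one_mul, ← sub_eq_add_neg] using h.add hρ hb (h'.const_mul hb (-1))

/-- Separation of variables: f' = -ν g, g' = ν f in time match ψ' = ν b η, η' = -ν ρ ψ in space,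
giving P_x = b Q_t and Q_x = ρ P_t. The phase of (f, g) is left free; different phases produce
different data. -/
theorem of_isMode (hb : IsCoeff m M b) {ν : ℝ} {ψ η f g : ℝ → ℝ}
    (h : IsMode ρ b 0 L ν ψ η) (hη : η L = 0) (hf : ∀ t, HasDerivAt f (-(ν * g t)) t)
    (hg : ∀ t, HasDerivAt g (ν * f t) t) :
    IsWave ρ b L (fun x t => f t * ψ x) (fun x t => g t * η x)
      (fun x t => -(ν * g t) * ψ x) (fun x t => (ν * f t) * η x) := by
  have hfc : Continuous f := continuous_iff_continuousAt.2 fun t => (hf t).continuousAt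
  have hgc : Continuous g := continuous_iff_continuousAt.2 fun t => (hg t).continuousAt
  have hψ := h.continuous_fst
  have hη' := h.continuous_snd
  have mψ : MemLp ψ 2 (volOn 0 L) := memLp_of_continuousOn hψ.continuousOn
  have mη : MemLp (fun x => b x * η x) 2 (volOn 0 L) := hb.memLp_mul hη'.continuousOn
  refine ⟨by fun_prop, by fun_prop, by fun_prop, by fun_prop, ?_, ?_, ?_, ?_, ?_, ?_, ?_⟩
  · exact fun x t => (hf t).mul_const _
  · exact fun x t => (hg t).mul_const _
  · intro t x hx
    rw [h.eq_fst x hx, mul_sub, ← intervalIntegral.integral_const_mul]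
    congr 2; ext s; ring
  · intro t x hx
    rw [h.eq_snd x hx, mul_sub, ← intervalIntegral.integral_const_mul]
    congr 2; ext s; ring
  · intro t; simp [hη]
  · intro t
    simp only [toL2_const_mul mψ]
    exact (hf t).smul_const _
  · intro t
    simp only [mul_left_comm (b _), toL2_const_mul mη]
    exact (hg t).smul_const _

/-! ### Energy identities and estimates -/

theorem eq_sub_integral_of_eq_right {f : ℝ → ℝ → ℝ} {g w : ℝ → ℝ → ℝ} {x y t : ℝ}
    (hx : x ∈ Icc 0 L) (hy : y ∈ Icc 0 L)
    (hi : ∀ u v, IntervalIntegrable (fun s => w s t) volume u v)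
    (h : ∀ x ∈ Icc 0 L, f x t = g L t - ∫ s in x..L, w s t) :
    f x t = f y t - ∫ s in x..y, w s t := by
  rw [h x hx, h y hy, ← intervalIntegral.integral_add_adjacent_intervals (hi x y) (hi y L)]
  ring

theorem eq_P' (hb : IsCoeff m M b) (h : IsWave ρ b L P Q Pt Qt) {x y : ℝ} (hx : x ∈ Icc 0 L)
    (hy : y ∈ Icc 0 L) (t : ℝ) : P x t = P y t - ∫ s in x..y, b s * Qt s t :=
  eq_sub_integral_of_eq_right (w := fun s t => b s * Qt s t) hx hy (fun u v => hb.intervalIntegrable_mul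
    (continuous_of_uncurry_left h.continuous_Qt t) u v) (h.eq_P t)

theorem eq_Q' (hρ : IsCoeff m M ρ) (h : IsWave ρ b L P Q Pt Qt) {x y : ℝ} (hx : x ∈ Icc 0 L)
    (hy : y ∈ Icc 0 L) (t : ℝ) : Q x t = Q y t - ∫ s in x..y, ρ s * Pt s t :=
  eq_sub_integral_of_eq_right (w := fun s t => ρ s * Pt s t) hx hy (fun u v => hρ.intervalIntegrable_mul
    (continuous_of_uncurry_left h.continuous_Pt t) u v) (h.eq_Q t)

theorem sq_sub_sq_eq {w : ℝ → ℝ} (hw : IsCoeff m M w) {f g : ℝ → ℝ} (hg : Continuous g) {x y : ℝ}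
    (hxy : x ≤ y) (h : ∀ z ∈ Icc x y, f z = f y - ∫ s in z..y, w s * g s) :
    f y ^ 2 - f x ^ 2 = ∫ s in x..y, w s * (2 * (f s * g s)) := by
  have hi := hw.intervalIntegrable_mul hg x y
  have := integral_primitive_mul hxy hi hi h h
  rw [sq, sq, ← this]
  congr 1; ext s; ring

/-- The sidewise energy estimate. -/
theorem sidewise_energy_le {v β : ℝ} (hc : WaveCoeffs m M v β L ρ b)
    (h : IsWave ρ b L P Q Pt Qt) {t₁ t₂ : ℝ} (ht : t₁ ≤ t₂) {χ χ' : ℝ → ℝ}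
    (hχ : ∀ t, HasDerivAt χ (χ' t) t) (hχ' : Continuous χ') (hχ0 : ∀ t ∈ Icc t₁ t₂, 0 ≤ χ t)
    (hbd : ∀ x ∈ Icc 0 L, χ t₂ * (P x t₂ * Q x t₂) = χ t₁ * (P x t₁ * Q x t₁))
    {κ : ℝ} (hκ : 0 ≤ κ) {S : ℝ → ℝ} (hS : Continuous S) (hS0 : ∀ x, 0 ≤ S x)
    (hχPQ : ∀ᵐ s ∂(volOn 0 L), 2 * (ρ s * b s) * ∫ t in t₁..t₂, |χ' t * (P s t * Q s t)|
      ≤ κ * (∫ t in t₁..t₂, χ t * (ρ s * P s t ^ 2 + b s * Q s t ^ 2)) + S s)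
    {x : ℝ} (hx : x ∈ Icc 0 L) :
    (∫ t in t₁..t₂, χ t * (P x t ^ 2 + Q x t ^ 2)) ≤ M / m * Real.exp (v / m + κ * L) *
      ((∫ t in t₁..t₂, χ t * (P L t ^ 2 + Q L t ^ 2)) + 1 / M * ∫ s in 0..L, S s) ∧
    (∫ t in t₁..t₂, χ t * (P L t ^ 2 + Q L t ^ 2)) ≤ M / m * Real.exp (v / m + κ * L) *
      ((∫ t in t₁..t₂, χ t * (P x t ^ 2 + Q x t ^ 2)) + 1 / M * ∫ s in 0..L, S s) := by
  have hρ := hc.isCoeff_fst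
  have hb := hc.isCoeff_snd
  have cχ : Continuous χ := continuous_iff_continuousAt.2 fun t => (hχ t).continuousAt
  have cP := h.continuous_P
  have cQ := h.continuous_Q
  have cPt := h.continuous_Pt
  have cQt := h.continuous_Qt
  have gA : Continuous fun z : ℝ × ℝ => χ z.2 * P z.1 z.2 ^ 2 := by fun_prop
  have gB : Continuous fun z : ℝ × ℝ => χ z.2 * Q z.1 z.2 ^ 2 := by fun_prop
  have g1 : Continuous fun z : ℝ × ℝ => χ z.2 * (P z.1 z.2 * Qt z.1 z.2) := by fun_prop
  have g2 : Continuous fun z : ℝ × ℝ => χ z.2 * (Q z.1 z.2 * Pt z.1 z.2) := by fun_prop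
  have gP := continuous_of_uncurry_right cP
  have gQ := continuous_of_uncurry_right cQ
  have gPt := continuous_of_uncurry_right cPt
  have gQt := continuous_of_uncurry_right cQt
  set A : ℝ → ℝ := fun x => ∫ t in t₁..t₂, χ t * P x t ^ 2 with hA
  set B : ℝ → ℝ := fun x => ∫ t in t₁..t₂, χ t * Q x t ^ 2 with hB
  set h₁ : ℝ → ℝ := fun x => ∫ t in t₁..t₂, χ t * (P x t * Qt x t)
  set h₂ : ℝ → ℝ := fun x => ∫ t in t₁..t₂, χ t * (Q x t * Pt x t)
  have cA : Continuous A := continuous_integral_left (G := fun x t => χ t * P x t ^ 2) gA _ _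
  have cB : Continuous B := continuous_integral_left (G := fun x t => χ t * Q x t ^ 2) gB _ _
  have ch₁ : Continuous h₁ :=
    continuous_integral_left (G := fun x t => χ t * (P x t * Qt x t)) g1 _ _
  have ch₂ : Continuous h₂ :=
    continuous_integral_left (G := fun x t => χ t * (Q x t * Pt x t)) g2 _ _
  have iA : ∀ x, IntervalIntegrable (fun t => χ t * P x t ^ 2) volume t₁ t₂ := fun x =>
    (continuous_of_uncurry_right (P := fun x t => χ t * P x t ^ 2) gA x).intervalIntegrable _ _
  have iB : ∀ x, IntervalIntegrable (fun t => χ t * Q x t ^ 2) volume t₁ t₂ := fun x =>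
    (continuous_of_uncurry_right (P := fun x t => χ t * Q x t ^ 2) gB x).intervalIntegrable _ _
  have hAB : ∀ x, (∫ t in t₁..t₂, χ t * (P x t ^ 2 + Q x t ^ 2)) = A x + B x := by
    intro x
    simp only [mul_add]
    exact intervalIntegral.integral_add (iA x) (iB x)
  have hF : ∀ x, (∫ t in t₁..t₂, χ t * (ρ x * P x t ^ 2 + b x * Q x t ^ 2))
      = ρ x * A x + b x * B x := by
    intro x
    simp only [hA, hB]
    rw [← intervalIntegral.integral_const_mul, ← intervalIntegral.integral_const_mul,
      ← intervalIntegral.integral_add ((iA x).const_mul _) ((iB x).const_mul _)]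
    congr 1; ext t; ring
  have hA0 : ∀ x, 0 ≤ A x := fun x => intervalIntegral.integral_nonneg ht fun t htm =>
    mul_nonneg (hχ0 t htm) (sq_nonneg _)
  have hB0 : ∀ x, 0 ≤ B x := fun x => intervalIntegral.integral_nonneg ht fun t htm =>
    mul_nonneg (hχ0 t htm) (sq_nonneg _)
  have incr : ∀ {w : ℝ → ℝ} {f g : ℝ → ℝ → ℝ}, IsCoeff m M w →
      (Continuous fun z : ℝ × ℝ => f z.1 z.2) → (Continuous fun z : ℝ × ℝ => g z.1 z.2) →
      (∀ x ∈ Icc 0 L, ∀ y ∈ Icc 0 L, ∀ t, f x t = f y t - ∫ s in x..y, w s * g s t) →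
      ∀ x ∈ Icc 0 L, ∀ y ∈ Icc 0 L, x ≤ y →
      (∫ t in t₁..t₂, χ t * f y t ^ 2) - (∫ t in t₁..t₂, χ t * f x t ^ 2)
        = ∫ s in x..y, w s * (2 * ∫ t in t₁..t₂, χ t * (f s t * g s t)) := by
    intro w f g hw cf cg hfg x hx y hy hxy
    have k1 : Continuous fun z : ℝ × ℝ => χ z.2 * f z.1 z.2 ^ 2 := by fun_prop
    have k2 : Continuous fun z : ℝ × ℝ => 2 * (χ z.2 * (f z.1 z.2 * g z.1 z.2)) := by fun_prop
    have i1 : ∀ x, IntervalIntegrable (fun t => χ t * f x t ^ 2) volume t₁ t₂ := fun x =>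
      (continuous_of_uncurry_right (P := fun x t => χ t * f x t ^ 2) k1 x).intervalIntegrable _ _
    simp only [← intervalIntegral.integral_const_mul (2 : ℝ)]
    rw [hw.integral_swap (G := fun s t => 2 * (χ t * (f s t * g s t))) k2,
      ← intervalIntegral.integral_sub (i1 y) (i1 x)]
    apply intervalIntegral.integral_congr
    intro t _
    simp only
    rw [← mul_sub, sq_sub_sq_eq hw (f := fun s => f s t) (continuous_of_uncurry_left cg t) hxy
      (fun z hz => hfg z ⟨hx.1.trans hz.1, hz.2.trans hy.2⟩ y hy t),
      ← intervalIntegral.integral_const_mul]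
    congr 1; ext s; ring
  have hAe := incr hb cP cQt (fun x hx y hy t => h.eq_P' hb hx hy t)
  have hBe := incr hρ cQ cPt (fun x hx y hy t => h.eq_Q' hρ hx hy t)
  -- P Q_t + Q P_t = (P Q)_t is integrated by parts against χ, and `hbd` cancels the boundary
  -- values.
  have hh : ∀ x ∈ Icc 0 L, h₁ x + h₂ x = - ∫ t in t₁..t₂, χ' t * (P x t * Q x t) := by
    intro x hx
    have i1 : IntervalIntegrable (fun t => χ t * (P x t * Qt x t)) volume t₁ t₂ :=
      (continuous_of_uncurry_right (P := fun x t => χ t * (P x t * Qt x t)) g1 x).intervalIntegrable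
        _ _
    have i2 : IntervalIntegrable (fun t => χ t * (Q x t * Pt x t)) volume t₁ t₂ :=
      (continuous_of_uncurry_right (P := fun x t => χ t * (Q x t * Pt x t)) g2 x).intervalIntegrable
        _ _
    have i3 : IntervalIntegrable (fun t => χ' t * (P x t * Q x t)) volume t₁ t₂ :=
      (hχ'.mul ((gP x).mul (gQ x))).intervalIntegrable _ _
    have hd : ∀ t ∈ uIcc t₁ t₂, HasDerivAt (fun t => χ t * (P x t * Q x t))
        (χ' t * (P x t * Q x t) + (χ t * (P x t * Qt x t) + χ t * (Q x t * Pt x t))) t := by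
      intro t _
      refine ((hχ t).mul ((h.hasDerivAt_P x t).mul (h.hasDerivAt_Q x t))).congr_deriv ?_
      simp only [Pi.mul_apply]
      ring
    have := intervalIntegral.integral_eq_sub_of_hasDerivAt hd (i3.add (i1.add i2))
    rw [hbd x hx, sub_self, intervalIntegral.integral_add i3 (i1.add i2),
      intervalIntegral.integral_add i1 i2] at this
    simp only [h₁, h₂]
    linarith
  have hsource : ∀ᵐ s ∂(volOn 0 L), |2 * (ρ s * b s) * (h₁ s + h₂ s)|
      ≤ κ * (ρ s * A s + b s * B s) + S s := by
    filter_upwards [hχPQ, ae_restrict_mem measurableSet_Ioo] with s hs hsm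
    rw [hF] at hs
    refine le_trans ?_ hs
    have hpos : 0 ≤ 2 * (ρ s * b s) :=
      mul_nonneg zero_le_two (mul_nonneg (hρ.apply_pos s).le (hb.apply_pos s).le)
    rw [hh s (Ioo_subset_Icc_self hsm), abs_mul, abs_of_nonneg hpos, abs_neg]
    exact mul_le_mul_of_nonneg_left (intervalIntegral.abs_integral_le_integral_abs ht) hpos
  set K := M / m * Real.exp (v / m + κ * L)
  set J := 1 / M * ∫ s in 0..L, S s
  have hint : ∀ x ∈ Ioo 0 L, ∀ y ∈ Ioo 0 L, x ≤ y →
      A x + B x ≤ K * (A y + B y + J) ∧ A y + B y ≤ K * (A x + B x + J) :=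
    fun x hx y hy hxy => hc.energy_le hκ ch₁ ch₂ cA cB hA0 hB0 hS hS0 hAe hBe hsource hx hy hxy
  have cN : Continuous fun x => A x + B x := cA.add cB
  have cN' : Continuous fun x => K * (A x + B x + J) :=
    continuous_const.mul (cN.add continuous_const)
  have hL := hc.length_pos
  -- The variation of the coefficients is controlled only on the open interval. Since A + B is
  -- continuous, both inequalities extend first to the right end and then to all of [0, L].
  have step : ∀ x ∈ Ioo 0 L, A x + B x ≤ K * (A L + B L + J) ∧ A L + B L ≤ K * (A x + B x + J) := by
    intro x hx
    have hcl : IsClosed {y | A x + B x ≤ K * (A y + B y + J) ∧ A y + B y ≤ K * (A x + B x + J)} :=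
      (isClosed_le continuous_const cN').and (isClosed_le cN continuous_const)
    have hsub : Ioo x L ⊆ {y | A x + B x ≤ K * (A y + B y + J) ∧ A y + B y ≤ K * (A x + B x + J)} :=
      fun y hy => hint x hx y ⟨hx.1.trans hy.1, hy.2⟩ hy.1.le
    have := closure_minimal hsub hcl
    rw [closure_Ioo hx.2.ne] at this
    exact this (right_mem_Icc.2 hx.2.le)
  have hcl : IsClosed {x | A x + B x ≤ K * (A L + B L + J) ∧ A L + B L ≤ K * (A x + B x + J)} :=
    (isClosed_le cN continuous_const).and (isClosed_le continuous_const cN')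
  have := closure_minimal (s := Ioo 0 L) step hcl
  rw [closure_Ioo hL.ne] at this
  rw [hAB x, hAB L]
  exact this hx

/-- The energy identity. -/
theorem energy_sub_eq (hρ : IsCoeff m M ρ) (hb : IsCoeff m M b) (hL : 0 ≤ L)
    (h : IsWave ρ b L P Q Pt Qt) (s t : ℝ) :
    (∫ x in 0..L, (ρ x * P x t ^ 2 + b x * Q x t ^ 2))
      - (∫ x in 0..L, (ρ x * P x s ^ 2 + b x * Q x s ^ 2)) = - ∫ r in s..t, 2 * (P 0 r * Q 0 r) := by
  have cP := h.continuous_P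
  have cQ := h.continuous_Q
  have cPt := h.continuous_Pt
  have cQt := h.continuous_Qt
  have key : ∀ {w : ℝ → ℝ} {f g : ℝ → ℝ → ℝ}, IsCoeff m M w →
      (Continuous fun z : ℝ × ℝ => f z.1 z.2) → (Continuous fun z : ℝ × ℝ => g z.1 z.2) →
      (∀ x t, HasDerivAt (f x) (g x t) t) →
      (∫ x in 0..L, w x * f x t ^ 2) - (∫ x in 0..L, w x * f x s ^ 2)
        = ∫ r in s..t, ∫ x in 0..L, w x * (2 * (f x r * g x r)) := by
    intro w f g hw cf cg hd
    have k1 : ∀ t, Continuous fun x => f x t ^ 2 := fun t => (continuous_of_uncurry_left cf t).pow 2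
    have k2 : Continuous fun z : ℝ × ℝ => 2 * (f z.1 z.2 * g z.1 z.2) := by fun_prop
    rw [← hw.integral_swap (G := fun x r => 2 * (f x r * g x r)) k2,
      ← intervalIntegral.integral_sub (hw.intervalIntegrable_mul (k1 t) _ _)
        (hw.intervalIntegrable_mul (k1 s) _ _)]
    congr 1; ext x
    rw [← mul_sub]
    congr 1
    rw [intervalIntegral.integral_eq_sub_of_hasDerivAt (f := fun r => f x r ^ 2)]
    · intro r _
      refine ((hd x r).pow 2).congr_deriv ?_
      simp; ring
    · exact (continuous_of_uncurry_right (P := fun x r => 2 * (f x r * g x r)) k2 x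
        ).intervalIntegrable _ _
  have i1 : ∀ {w : ℝ → ℝ} {f : ℝ → ℝ → ℝ}, IsCoeff m M w →
      (Continuous fun z : ℝ × ℝ => f z.1 z.2) → ∀ t,
      IntervalIntegrable (fun x => w x * f x t ^ 2) volume 0 L := fun hw cf t =>
    hw.intervalIntegrable_mul ((continuous_of_uncurry_left cf t).pow 2) _ _
  rw [intervalIntegral.integral_add (i1 hρ cP t) (i1 hb cQ t),
    intervalIntegral.integral_add (i1 hρ cP s) (i1 hb cQ s), add_sub_add_comm,
    key hρ cP cPt h.hasDerivAt_P, key hb cQ cQt h.hasDerivAt_Q]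
  have c1 : Continuous fun z : ℝ × ℝ => 2 * (P z.1 z.2 * Pt z.1 z.2) := by fun_prop
  have c2 : Continuous fun z : ℝ × ℝ => 2 * (Q z.1 z.2 * Qt z.1 z.2) := by fun_prop
  have ii : ∀ {w : ℝ → ℝ} {G : ℝ → ℝ → ℝ}, IsCoeff m M w →
      (Continuous fun z : ℝ × ℝ => G z.1 z.2) →
      IntervalIntegrable (fun r => ∫ x in 0..L, w x * G x r) volume s t := by
    intro w G hw hG
    have := hw.integrableOn_prod hG 0 L s t
    rw [IntegrableOn, Measure.volume_eq_prod, ← Measure.prod_restrict] at this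
    have := this.integral_prod_right
    rw [intervalIntegrable_iff]
    refine this.congr (ae_of_all _ fun r => ?_)
    simp only [Function.uncurry]
    rw [intervalIntegral.integral_of_le hL, uIoc_of_le hL]
  rw [← intervalIntegral.integral_add (ii (G := fun x r => 2 * (P x r * Pt x r)) hρ c1)
    (ii (G := fun x r => 2 * (Q x r * Qt x r)) hb c2), ← intervalIntegral.integral_neg]
  congr 1; ext r
  -- (P Q)_x = b Q Q_t + ρ P P_t, so integration over x leaves only the flux through x = 0; `Q`
  -- vanishes at x = L.
  have := integral_primitive_mul hL
    (hb.intervalIntegrable_mul (continuous_of_uncurry_left cQt r) 0 L)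
    (hρ.intervalIntegrable_mul (continuous_of_uncurry_left cPt r) 0 L) (h.eq_P r) (h.eq_Q r)
  rw [h.right_Q, mul_zero, zero_sub] at this
  rw [← intervalIntegral.integral_add
    (hρ.intervalIntegrable_mul (continuous_of_uncurry_left
      (P := fun x r => 2 * (P x r * Pt x r)) c1 r) 0 L)
    (hb.intervalIntegrable_mul (continuous_of_uncurry_left
      (P := fun x r => 2 * (Q x r * Qt x r)) c2 r) 0 L), ← mul_neg, ← mul_neg, mul_neg, ← this,
    ← intervalIntegral.integral_const_mul]
  congr 1; ext x; ring

end IsWave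

/-- The energy at time `t` (up to the factor `1 / 2`). -/
noncomputable def waveEnergy (ρ b : ℝ → ℝ) (L : ℝ) (P Q : ℝ → ℝ → ℝ) (t : ℝ) : ℝ :=
  ∫ x in 0..L, (ρ x * P x t ^ 2 + b x * Q x t ^ 2)

theorem isCoeff_one : IsCoeff 1 1 fun _ => (1 : ℝ) :=
  ⟨measurable_const, one_pos, fun _ => le_rfl, fun _ => le_rfl⟩

theorem integral_swap_of_continuous {G : ℝ → ℝ → ℝ} (hG : Continuous fun z : ℝ × ℝ => G z.1 z.2)
    (x y s t : ℝ) :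
    ∫ z in x..y, ∫ r in s..t, G z r = ∫ r in s..t, ∫ z in x..y, G z r := by
  simpa using isCoeff_one.integral_swap hG x y s t

theorem continuous_integral_right {G : ℝ → ℝ → ℝ} (hG : Continuous fun z : ℝ × ℝ => G z.1 z.2)
    (x y : ℝ) : Continuous fun t => ∫ z in x..y, G z t :=
  continuous_integral_left (G := fun t x => G x t) (hG.comp continuous_swap) x y

/-! ### Total energy and hidden regularity of the trace -/

namespace IsWave

variable {ρ b : ℝ → ℝ} {L : ℝ} {P Q Pt Qt : ℝ → ℝ → ℝ} {m M v β : ℝ}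

theorem continuous_sq (h : IsWave ρ b L P Q Pt Qt) :
    Continuous fun z : ℝ × ℝ => P z.1 z.2 ^ 2 + Q z.1 z.2 ^ 2 :=
  (h.continuous_P.pow 2).add (h.continuous_Q.pow 2)

theorem energy_intervalIntegrable (hρ : IsCoeff m M ρ) (hb : IsCoeff m M b)
    (h : IsWave ρ b L P Q Pt Qt) (t : ℝ) :
    IntervalIntegrable (fun x => ρ x * P x t ^ 2 + b x * Q x t ^ 2) volume 0 L :=
  (hρ.intervalIntegrable_mul ((continuous_of_uncurry_left h.continuous_P t).pow 2) _ _).add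
    (hb.intervalIntegrable_mul ((continuous_of_uncurry_left h.continuous_Q t).pow 2) _ _)

theorem le_energy (hρ : IsCoeff m M ρ) (hb : IsCoeff m M b) (hL : 0 ≤ L)
    (h : IsWave ρ b L P Q Pt Qt) (t : ℝ) :
    m * ∫ x in 0..L, (P x t ^ 2 + Q x t ^ 2) ≤ waveEnergy ρ b L P Q t := by
  rw [← intervalIntegral.integral_const_mul]
  refine intervalIntegral.integral_mono_on hL
    ((continuous_const.mul (continuous_of_uncurry_left
      (P := fun x t => P x t ^ 2 + Q x t ^ 2) h.continuous_sq t)).intervalIntegrable _ _)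
    (h.energy_intervalIntegrable hρ hb t) fun x _ => ?_
  have h1 := mul_le_mul_of_nonneg_right (hρ.lower x) (sq_nonneg (P x t))
  have h2 := mul_le_mul_of_nonneg_right (hb.lower x) (sq_nonneg (Q x t))
  linarith

theorem energy_le (hρ : IsCoeff m M ρ) (hb : IsCoeff m M b) (hL : 0 ≤ L)
    (h : IsWave ρ b L P Q Pt Qt) (t : ℝ) :
    waveEnergy ρ b L P Q t ≤ M * ∫ x in 0..L, (P x t ^ 2 + Q x t ^ 2) := by
  rw [← intervalIntegral.integral_const_mul]
  refine intervalIntegral.integral_mono_on hL (h.energy_intervalIntegrable hρ hb t)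
    ((continuous_const.mul (continuous_of_uncurry_left
      (P := fun x t => P x t ^ 2 + Q x t ^ 2) h.continuous_sq t)).intervalIntegrable _ _)
    fun x _ => ?_
  have h1 := mul_le_mul_of_nonneg_right (hρ.upper x) (sq_nonneg (P x t))
  have h2 := mul_le_mul_of_nonneg_right (hb.upper x) (sq_nonneg (Q x t))
  linarith

theorem norm_sq_le_energy (hρ : IsCoeff m M ρ) (hb : IsCoeff m M b) (hL : 0 ≤ L)
    (h : IsWave ρ b L P Q Pt Qt) (t : ℝ) :
    ‖toL2 0 L fun x => P x t‖ ^ 2 ≤ m⁻¹ * waveEnergy ρ b L P Q t ∧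
      ‖toL2 0 L fun x => b x * Q x t‖ ^ 2 ≤ M * waveEnergy ρ b L P Q t := by
  rw [toL2_norm_sq (h.memLp_P t), toL2_norm_sq (h.memLp_R hb t),
    setIntegral_Ioo_eq_intervalIntegral hL, setIntegral_Ioo_eq_intervalIntegral hL, waveEnergy,
    ← intervalIntegral.integral_const_mul, ← intervalIntegral.integral_const_mul]
  have hP2 := (continuous_of_uncurry_left h.continuous_P t).pow 2
  have hQ2 := (continuous_of_uncurry_left h.continuous_Q t).pow 2
  have hm := hρ.pos
  have hi := h.energy_intervalIntegrable hρ hb t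
  constructor
  · refine intervalIntegral.integral_mono_on hL (hP2.intervalIntegrable _ _) (hi.const_mul _)
      fun x _ => ?_
    have h1 := mul_le_mul_of_nonneg_right (hρ.lower x) (sq_nonneg (P x t))
    have h2 := mul_nonneg (hb.apply_pos x).le (sq_nonneg (Q x t))
    rw [← div_eq_inv_mul, le_div_iff₀ hm]
    linarith
  · have hi' := ((hb.intervalIntegrable_mul hQ2 0 L).const_mul M)
    have hi2 : IntervalIntegrable (fun x => (b x * Q x t) ^ 2) volume 0 L := by
      refine hi'.mono_fun ?_ (ae_of_all _ fun x => ?_)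
      · exact ((hb.measurable.mul (continuous_of_uncurry_left h.continuous_Q t).measurable).pow_const
          2).aestronglyMeasurable
      · have h2 := mul_nonneg (hb.apply_pos x).le (sq_nonneg (Q x t))
        simp only [Pi.pow_apply]
        rw [Real.norm_eq_abs, Real.norm_eq_abs, abs_of_nonneg (sq_nonneg _),
          abs_of_nonneg (mul_nonneg hb.upper_pos.le h2)]
        have h3 := mul_le_mul_of_nonneg_right (hb.upper x) h2
        linarith
    refine intervalIntegral.integral_mono_on hL hi2 (hi.const_mul _) fun x _ => ?_
    have h1 := mul_nonneg (hρ.apply_pos x).le (sq_nonneg (P x t))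
    have h2 := mul_nonneg (hb.apply_pos x).le (sq_nonneg (Q x t))
    have h3 := mul_le_mul_of_nonneg_right (hb.upper x) h2
    have h4 := mul_nonneg hb.upper_pos.le h1
    linarith

theorem energy_le_norm_sq (hρ : IsCoeff m M ρ) (hb : IsCoeff m M b) (hL : 0 ≤ L)
    (h : IsWave ρ b L P Q Pt Qt) (t : ℝ) :
    waveEnergy ρ b L P Q t ≤ M * ‖toL2 0 L fun x => P x t‖ ^ 2
      + m⁻¹ * ‖toL2 0 L fun x => b x * Q x t‖ ^ 2 := by
  have hP := continuous_of_uncurry_left h.continuous_P t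
  have hQ := continuous_of_uncurry_left h.continuous_Q t
  have hi := h.energy_intervalIntegrable hρ hb t
  have i1 : IntervalIntegrable (fun x => M * P x t ^ 2) volume 0 L :=
    (continuous_const.mul (hP.pow 2)).intervalIntegrable _ _
  have i2 : IntervalIntegrable (fun x => m⁻¹ * (b x * Q x t) ^ 2) volume 0 L := by
    have := (h.memLp_R hb t (p := 2)).integrable_sq
    have i3 : IntervalIntegrable (fun x => (b x * Q x t) ^ 2) volume 0 L := by
      rw [intervalIntegrable_iff_integrableOn_Ioo_of_le hL]; exact this
    exact i3.const_mul _
  rw [toL2_norm_sq (h.memLp_P t), toL2_norm_sq (h.memLp_R hb t),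
    setIntegral_Ioo_eq_intervalIntegral hL, setIntegral_Ioo_eq_intervalIntegral hL, waveEnergy,
    ← intervalIntegral.integral_const_mul, ← intervalIntegral.integral_const_mul,
    ← intervalIntegral.integral_add i1 i2]
  refine intervalIntegral.integral_mono_on hL hi (i1.add i2) fun x _ => ?_
  have h1 := mul_le_mul_of_nonneg_right (hρ.upper x) (sq_nonneg (P x t))
  have h2 := mul_nonneg (hb.apply_pos x).le (sq_nonneg (Q x t))
  have h3 := mul_le_mul_of_nonneg_right (hb.lower x) h2
  have h4 : b x * Q x t ^ 2 ≤ m⁻¹ * (b x * Q x t) ^ 2 := by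
    rw [← div_eq_inv_mul, le_div_iff₀ hρ.pos]
    linarith
  linarith

theorem continuous_waveEnergy (hρ : IsCoeff m M ρ) (hb : IsCoeff m M b) (hL : 0 ≤ L)
    (h : IsWave ρ b L P Q Pt Qt) : Continuous (waveEnergy ρ b L P Q) := by
  have c0 : Continuous fun r => 2 * (P 0 r * Q 0 r) :=
    continuous_const.mul ((continuous_of_uncurry_right h.continuous_P 0).mul
      (continuous_of_uncurry_right h.continuous_Q 0))
  have : waveEnergy ρ b L P Q = fun t =>
      waveEnergy ρ b L P Q 0 - ∫ r in (0 : ℝ)..t, 2 * (P 0 r * Q 0 r) := by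
    ext t
    have := h.energy_sub_eq hρ hb hL 0 t
    simp only [waveEnergy]
    linarith
  rw [this]
  exact continuous_const.sub (intervalIntegral.continuous_primitive
    (fun a b => c0.intervalIntegrable _ _) _)

theorem energy_eq_of_left_eq_zero (hρ : IsCoeff m M ρ) (hb : IsCoeff m M b) (hL : 0 ≤ L)
    (h : IsWave ρ b L P Q Pt Qt) (hQ : ∀ t, Q 0 t = 0) (t : ℝ) :
    waveEnergy ρ b L P Q t = waveEnergy ρ b L P Q 0 := by
  have := h.energy_sub_eq hρ hb hL 0 t
  simp only [hQ, mul_zero, intervalIntegral.integral_zero, neg_zero] at this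
  exact sub_eq_zero.1 this

theorem abs_mul_le_half (x y : ℝ) : 2 * |x * y| ≤ x ^ 2 + y ^ 2 := by
  rw [abs_mul]
  nlinarith [sq_nonneg (|x| - |y|), sq_abs x, sq_abs y]

/-- Hidden regularity of the trace at `x = L` of waves with homogeneous Neumann conditions. -/
theorem exists_integral_trace_le (hc : WaveCoeffs m M v β L ρ b) {T : ℝ} (hT : 0 ≤ T) :
    ∃ C, 0 ≤ C ∧ ∀ P Q Pt Qt : ℝ → ℝ → ℝ, IsWave ρ b L P Q Pt Qt → (∀ t, Q 0 t = 0) →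
      ∫ t in 0..T, P L t ^ 2 ≤ C * waveEnergy ρ b L P Q 0 := by
  have hρ := hc.isCoeff_fst
  have hb := hc.isCoeff_snd
  have hL := hc.length_pos
  have hm := hρ.pos
  have hM := hρ.upper_pos
  set K := M / m * Real.exp (v / m + 0 * L)
  have hK : 0 < K := by positivity
  refine ⟨K * ((T + 2) ^ 2 + L * M * (T + 2)) * ((T + 2) * m⁻¹) / L, by positivity, ?_⟩
  intro P Q Pt Qt h hQ
  -- The weight vanishes at -1 and T + 1, which removes the boundary terms without any condition on
  -- the wave, and it is at least 1 on [0, T]. Waves exist for all times, so the larger window is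
  -- harmless.
  set χ : ℝ → ℝ := fun t => (t + 1) * (T + 1 - t)
  set E := waveEnergy ρ b L P Q 0
  have cχ : Continuous χ := by fun_prop
  have hT1 : (-1 : ℝ) ≤ T + 1 := by linarith
  have hχ : ∀ t, HasDerivAt χ (T - 2 * t) t := fun t => by
    refine (((hasDerivAt_id t).add_const 1).mul ((hasDerivAt_id t).const_sub (T + 1))).congr_deriv ?_
    simp only [id]; ring
  have hχ0 : ∀ t ∈ Icc (-1) (T + 1), 0 ≤ χ t := fun t ht =>
    mul_nonneg (by linarith [ht.1]) (by linarith [ht.2])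
  have hχ1 : ∀ t ∈ Icc (-1) (T + 1), χ t ≤ (T + 2) ^ 2 := fun t ht => by
    rw [sq]
    exact mul_le_mul (by linarith [ht.2]) (by linarith [ht.1]) (by linarith [ht.2]) (by linarith)
  set n : ℝ → ℝ := fun x => ∫ t in (-1)..(T + 1), (P x t ^ 2 + Q x t ^ 2)
  have cn : Continuous n :=
    continuous_integral_left (G := fun x t => P x t ^ 2 + Q x t ^ 2) h.continuous_sq _ _
  have hn0 : ∀ x, 0 ≤ n x := fun x => intervalIntegral.integral_nonneg hT1 fun t _ => by positivity
  have isq : ∀ x, IntervalIntegrable (fun t => P x t ^ 2 + Q x t ^ 2) volume (-1) (T + 1) := fun x =>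
    (continuous_of_uncurry_right (P := fun x t => P x t ^ 2 + Q x t ^ 2) h.continuous_sq x
      ).intervalIntegrable _ _
  have iχsq : ∀ x, IntervalIntegrable (fun t => χ t * (P x t ^ 2 + Q x t ^ 2)) volume (-1) (T + 1) :=
    fun x => (cχ.mul (continuous_of_uncurry_right (P := fun x t => P x t ^ 2 + Q x t ^ 2)
      h.continuous_sq x)).intervalIntegrable _ _
  have hD : ∫ x in 0..L, n x ≤ (T + 2) * m⁻¹ * E := by
    rw [integral_swap_of_continuous (G := fun x t => P x t ^ 2 + Q x t ^ 2) h.continuous_sq]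
    calc ∫ t in (-1)..(T + 1), ∫ x in 0..L, (P x t ^ 2 + Q x t ^ 2)
        ≤ ∫ _t in (-1)..(T + 1), m⁻¹ * E := by
          refine intervalIntegral.integral_mono_on hT1
            ((continuous_integral_right (G := fun x t => P x t ^ 2 + Q x t ^ 2) h.continuous_sq 0 L
              ).intervalIntegrable _ _) intervalIntegrable_const fun t _ => ?_
          have := h.le_energy hρ hb hL.le t
          rw [h.energy_eq_of_left_eq_zero hρ hb hL.le hQ] at this
          rw [← div_eq_inv_mul, le_div_iff₀ hm]
          linarith
      _ = _ := by rw [intervalIntegral.integral_const, smul_eq_mul]; ring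
  have hside : ∀ x ∈ Icc 0 L, (∫ t in (-1)..(T + 1), χ t * (P L t ^ 2 + Q L t ^ 2)) ≤
      K * ((T + 2) ^ 2 * n x + 1 / M * ∫ s in 0..L, M ^ 2 * (T + 2) * n s) := by
    intro x hx
    -- Near its zeros χ does not dominate |χ'|, so the whole contribution of χ' is put into the
    -- source, with |χ'| ≤ T + 2, ρ b ≤ M² and 2 |P Q| ≤ P² + Q².
    have := (h.sidewise_energy_le hc hT1 hχ (by fun_prop) hχ0 (κ := 0)
      (S := fun s => M ^ 2 * (T + 2) * n s) (by
        intro x _; simp [χ]) le_rfl (continuous_const.mul cn)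
      (fun x => mul_nonneg (by positivity) (hn0 x)) (by
        refine ae_of_all _ fun s => ?_
        rw [zero_mul, zero_add]
        have cPs := continuous_of_uncurry_right h.continuous_P s
        have cQs := continuous_of_uncurry_right h.continuous_Q s
        have k1 : ∫ t in (-1)..(T + 1), |(T - 2 * t) * (P s t * Q s t)| ≤ (T + 2) / 2 * n s := by
          rw [← intervalIntegral.integral_const_mul]
          refine intervalIntegral.integral_mono_on hT1 ?_ ((isq s).const_mul _) fun t ht => ?_
          · exact Continuous.intervalIntegrable (by fun_prop) _ _
          · rw [abs_mul]
            have j1 : |T - 2 * t| ≤ T + 2 := abs_le.2 ⟨by linarith [ht.2], by linarith [ht.1]⟩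
            have j2 := abs_mul_le_half (P s t) (Q s t)
            have j3 := mul_le_mul j1 j2 (by positivity) (by linarith)
            linarith
        have k2 : ρ s * b s ≤ M * M :=
          mul_le_mul (hρ.upper s) (hb.upper s) (hb.apply_pos s).le hM.le
        have k3 : 0 ≤ ∫ t in (-1)..(T + 1), |(T - 2 * t) * (P s t * Q s t)| :=
          intervalIntegral.integral_nonneg hT1 fun t _ => abs_nonneg _
        calc 2 * (ρ s * b s) * ∫ t in (-1)..(T + 1), |(T - 2 * t) * (P s t * Q s t)|
            ≤ 2 * (M * M) * ((T + 2) / 2 * n s) := by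
              apply mul_le_mul (by linarith) k1 k3 (by positivity)
          _ = _ := by ring) hx).2
    refine this.trans (mul_le_mul_of_nonneg_left (add_le_add_left ?_ _) hK.le)
    rw [← intervalIntegral.integral_const_mul]
    exact intervalIntegral.integral_mono_on hT1 (iχsq x) ((isq x).const_mul _) fun t ht =>
      mul_le_mul_of_nonneg_right (hχ1 t ht) (by positivity)
  have hlow : ∫ t in 0..T, P L t ^ 2 ≤ ∫ t in (-1)..(T + 1), χ t * (P L t ^ 2 + Q L t ^ 2) := by
    have cPL := continuous_of_uncurry_right h.continuous_P L
    calc ∫ t in 0..T, P L t ^ 2 ≤ ∫ t in 0..T, χ t * (P L t ^ 2 + Q L t ^ 2) := by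
          refine intervalIntegral.integral_mono_on hT ((cPL.pow 2).intervalIntegrable _ _)
            ((cχ.mul (continuous_of_uncurry_right (P := fun x t => P x t ^ 2 + Q x t ^ 2)
              h.continuous_sq L)).intervalIntegrable _ _) fun t ht => ?_
          have j1 : 1 ≤ χ t := by
            have := mul_nonneg ht.1 (sub_nonneg.2 ht.2)
            simp only [χ]
            linarith [ht.1, ht.2]
          rw [h.right_Q]
          have := mul_le_mul_of_nonneg_right j1 (sq_nonneg (P L t))
          linarith
      _ ≤ _ := by
          refine intervalIntegral.integral_mono_interval (by norm_num) hT (by linarith) ?_ (iχsq L)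
          filter_upwards [ae_restrict_mem measurableSet_Ioc] with t ht
          exact mul_nonneg (hχ0 t (Ioc_subset_Icc_self ht)) (by positivity)
  have cSide : Continuous fun x =>
      K * ((T + 2) ^ 2 * n x + 1 / M * ∫ s in 0..L, M ^ 2 * (T + 2) * n s) := by fun_prop
  -- Averaging over x replaces the sidewise energies by a space-time integral, which conservation of
  -- energy bounds in `hD`.
  have hfin := intervalIntegral.integral_mono_on (μ := volume) hL.le
    (f := fun _ => ∫ t in (-1)..(T + 1), χ t * (P L t ^ 2 + Q L t ^ 2))
    intervalIntegrable_const (cSide.intervalIntegrable _ _) hside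
  rw [intervalIntegral.integral_const, intervalIntegral.integral_const_mul,
    intervalIntegral.integral_add (Continuous.intervalIntegrable (by fun_prop) _ _)
    intervalIntegrable_const, intervalIntegral.integral_const,
    intervalIntegral.integral_const_mul, intervalIntegral.integral_const_mul, sub_zero,
    smul_eq_mul, smul_eq_mul] at hfin
  rw [div_mul_eq_mul_div, le_div_iff₀ hL]
  have e : K * ((T + 2) ^ 2 * (∫ x in 0..L, n x)
      + L * (1 / M * (M ^ 2 * (T + 2) * ∫ x in 0..L, n x)))
      = K * ((T + 2) ^ 2 + L * M * (T + 2)) * ∫ x in 0..L, n x := by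
    field_simp
  rw [e] at hfin
  have k5 : K * ((T + 2) ^ 2 + L * M * (T + 2)) * (∫ x in 0..L, n x)
      ≤ K * ((T + 2) ^ 2 + L * M * (T + 2)) * ((T + 2) * m⁻¹ * E) :=
    mul_le_mul_of_nonneg_left hD (by positivity)
  have k6 := mul_le_mul_of_nonneg_left hlow hL.le
  linarith

end IsWave

/-! ### Exponential weights in time and finite speed of propagation -/

theorem two_mul_abs_mul_le {ρ b β p q : ℝ} (hρ : 0 < ρ) (hb : 0 < b) (hβ : 0 ≤ β)
    (h : ρ * b ≤ β ^ 2) : 2 * (ρ * b) * |p * q| ≤ β * (ρ * p ^ 2 + b * q ^ 2) := by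
  have h1 : √(ρ * b) ≤ β := Real.sqrt_le_iff.2 ⟨hβ, h⟩
  have h2 := IsWave.abs_mul_le_half (√ρ * p) (√b * q)
  rw [mul_pow, mul_pow, Real.sq_sqrt hρ.le, Real.sq_sqrt hb.le] at h2
  have h3 : |√ρ * p * (√b * q)| = √(ρ * b) * |p * q| := by
    rw [Real.sqrt_mul hρ.le, show √ρ * p * (√b * q) = √ρ * √b * (p * q) by ring, abs_mul,
      abs_of_nonneg (by positivity)]
  rw [h3] at h2
  have h4 : 2 * (ρ * b) * |p * q| = √(ρ * b) * (2 * (√(ρ * b) * |p * q|)) := by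
    have := Real.mul_self_sqrt (mul_pos hρ hb).le
    linear_combination (-2 * |p * q|) * this
  rw [h4]
  exact mul_le_mul h1 h2 (by positivity) hβ

namespace IsWave

variable {ρ b : ℝ → ℝ} {L : ℝ} {P Q Pt Qt : ℝ → ℝ → ℝ} {m M v β T : ℝ}

/-- Sidewise energy estimate with an exponential weight in time. -/
theorem integral_exp_mul_le (hc : WaveCoeffs m M v β L ρ b) (hT : 0 ≤ T)
    (h : IsWave ρ b L P Q Pt Qt) (hQ : ∀ x, Q x T = 0 ∧ Q x (-T) = 0)
    {l : ℝ} (hl : 0 ≤ l) {x : ℝ} (hx : x ∈ Icc 0 L) :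
    ∫ t in (-T)..T, Real.exp (-(2 * l * t)) * (P x t ^ 2 + Q x t ^ 2) ≤
      M / m * Real.exp (v / m + 2 * l * β * L) *
        ∫ t in (-T)..T, Real.exp (-(2 * l * t)) * P L t ^ 2 := by
  have hρ := hc.isCoeff_fst
  have hb := hc.isCoeff_snd
  have hχ : ∀ t, HasDerivAt (fun t => Real.exp (-(2 * l * t)))
      (-(2 * l) * Real.exp (-(2 * l * t))) t := fun t => by
    refine ((hasDerivAt_id t).const_mul (2 * l)).neg.exp.congr_deriv ?_
    simp only [Pi.neg_apply, id]; ring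
  have := (h.sidewise_energy_le hc (t₁ := -T) (t₂ := T) (by linarith) hχ (by fun_prop)
    (fun t _ => (Real.exp_pos _).le) (κ := 2 * l * β)
    (by intro x _; rw [(hQ x).1, (hQ x).2]; simp)
    (mul_nonneg (by positivity) hc.beta_nonneg)
    (S := fun _ => 0) continuous_const (fun _ => le_rfl) (by
      filter_upwards [hc.slowness] with s hs
      have cPs := continuous_of_uncurry_right h.continuous_P s
      have cQs := continuous_of_uncurry_right h.continuous_Q s
      rw [add_zero, ← intervalIntegral.integral_const_mul, ← intervalIntegral.integral_const_mul]
      refine intervalIntegral.integral_mono_on (by linarith)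
        (Continuous.intervalIntegrable (by fun_prop) _ _)
        (Continuous.intervalIntegrable (by fun_prop) _ _) fun t _ => ?_
      -- The slowness bound enters here: it turns the contribution of χ' = -2 l χ into κ = 2 l β,
      -- and so fixes the threshold time L β.
      have k1 := two_mul_abs_mul_le (p := P s t) (q := Q s t) (hρ.apply_pos s) (hb.apply_pos s)
        hc.beta_nonneg hs
      have k2 : 0 ≤ 2 * l * Real.exp (-(2 * l * t)) := by positivity
      have k3 := mul_le_mul_of_nonneg_left k1 k2
      rw [abs_mul (-(2 * l) * Real.exp (-(2 * l * t))), neg_mul, abs_neg, abs_of_nonneg k2]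
      linarith) hx).1
  simpa only [h.right_Q, zero_pow two_ne_zero, add_zero, intervalIntegral.integral_zero,
    mul_zero] using this

theorem integral_integral_exp_mul_le (hc : WaveCoeffs m M v β L ρ b) (hT : 0 ≤ T)
    (h : IsWave ρ b L P Q Pt Qt) (hQ : ∀ x, Q x T = 0 ∧ Q x (-T) = 0) {l : ℝ} (hl : 0 ≤ l) :
    ∫ t in (-T)..T, Real.exp (-(2 * l * t)) * ∫ x in 0..L, (P x t ^ 2 + Q x t ^ 2) ≤
      L * (M / m * Real.exp (v / m + 2 * l * β * L) *
        ∫ t in (-T)..T, Real.exp (-(2 * l * t)) * P L t ^ 2) := by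
  have hL := hc.length_pos
  have cG : Continuous fun z : ℝ × ℝ =>
      Real.exp (-(2 * l * z.2)) * (P z.1 z.2 ^ 2 + Q z.1 z.2 ^ 2) := by
    have := h.continuous_sq
    fun_prop
  simp only [← intervalIntegral.integral_const_mul (Real.exp _)]
  rw [← integral_swap_of_continuous
    (G := fun x t => Real.exp (-(2 * l * t)) * (P x t ^ 2 + Q x t ^ 2)) cG]
  refine (intervalIntegral.integral_mono_on hL.le
    ((continuous_integral_left (G := fun x t => Real.exp (-(2 * l * t)) * (P x t ^ 2 + Q x t ^ 2))
      cG (-T) T).intervalIntegrable _ _) intervalIntegrable_const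
    fun x hx => h.integral_exp_mul_le hc hT hQ hl hx).trans (le_of_eq ?_)
  rw [intervalIntegral.integral_const, smul_eq_mul, sub_zero]

/-- Bounds for waves that are determined by their trace at `x = L`. -/
theorem exists_energy_le_trace (hc : WaveCoeffs m M v β L ρ b) (hT : 0 < T) :
    ∃ C, 0 ≤ C ∧ ∀ P Q Pt Qt : ℝ → ℝ → ℝ, IsWave ρ b L P Q Pt Qt →
      (∀ x, Q x T = 0 ∧ Q x (-T) = 0) →
      (∀ t ∈ Icc (-T) T, waveEnergy ρ b L P Q t ≤ C * ∫ t in (-T)..T, P L t ^ 2) ∧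
      (∫ t in (-T)..T, Q 0 t ^ 2 ≤ C * ∫ t in (-T)..T, P L t ^ 2) ∧
      ∀ l : ℝ, 0 ≤ l → waveEnergy ρ b L P Q 0 ≤
        C * Real.exp (2 * l * β * L) * ∫ t in (-T)..T, Real.exp (-(2 * l * t)) * P L t ^ 2 := by
  have hρ := hc.isCoeff_fst
  have hb := hc.isCoeff_snd
  have hL := hc.length_pos
  have hm := hρ.pos
  have hM := hρ.upper_pos
  set K := M / m * Real.exp (v / m)
  have hK : 0 < K := by positivity
  have hKe : ∀ l : ℝ, M / m * Real.exp (v / m + 2 * l * β * L) = K * Real.exp (2 * l * β * L) := by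
    intro l; rw [Real.exp_add]; ring
  refine ⟨(M * L / T + 1) * K, by positivity, ?_⟩
  intro P Q Pt Qt h hQ
  set n : ℝ → ℝ := fun t => ∫ x in 0..L, (P x t ^ 2 + Q x t ^ 2)
  have cn : Continuous n :=
    continuous_integral_right (G := fun x t => P x t ^ 2 + Q x t ^ 2) h.continuous_sq _ _
  have hn0 : ∀ t, 0 ≤ n t := fun t => intervalIntegral.integral_nonneg hL.le fun x _ => by positivity
  have ce := h.continuous_waveEnergy hρ hb hL.le
  set e := waveEnergy ρ b L P Q
  have hen : ∀ t, e t ≤ M * n t := h.energy_le hρ hb hL.le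
  have hTT : -T ≤ T := by linarith
  have h0 : (0 : ℝ) ∈ Icc 0 L := left_mem_Icc.2 hL.le
  have cP0 := continuous_of_uncurry_right h.continuous_P 0
  have cQ0 := continuous_of_uncurry_right h.continuous_Q 0
  have cPL := continuous_of_uncurry_right h.continuous_P L
  -- The energy changes only through the flux at x = 0, which the sidewise estimate at x = 0
  -- controls.
  have hdiff : ∀ s ∈ Icc (-T) T, ∀ t ∈ Icc (-T) T, s ≤ t →
      |e t - e s| ≤ ∫ r in s..t, (P 0 r ^ 2 + Q 0 r ^ 2) := by
    intro s hs t ht hst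
    have := h.energy_sub_eq hρ hb hL.le s t
    change e t - e s = _ at this
    rw [this, abs_neg, ← Real.norm_eq_abs]
    refine intervalIntegral.norm_integral_le_of_norm_le (μ := volume) hst (ae_of_all _ fun r _ => ?_)
      (Continuous.intervalIntegrable (by fun_prop) _ _)
    rw [Real.norm_eq_abs, abs_mul, abs_two]
    exact abs_mul_le_half _ _
  have hmono : ∀ s t, -T ≤ s → s ≤ t → t ≤ T → (∫ r in s..t, (P 0 r ^ 2 + Q 0 r ^ 2)) ≤
      ∫ r in (-T)..T, (P 0 r ^ 2 + Q 0 r ^ 2) := by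
    intro s t h1 h2 h3
    exact intervalIntegral.integral_mono_interval h1 h2 h3 (ae_of_all _ fun r => by positivity)
      (Continuous.intervalIntegrable (by fun_prop) _ _)
  have hE0 := h.integral_exp_mul_le hc hT.le hQ le_rfl h0
  have hEn0 := h.integral_integral_exp_mul_le hc hT.le hQ le_rfl
  simp only [mul_zero, zero_mul, neg_zero, Real.exp_zero, one_mul, add_zero] at hE0 hEn0
  set q := ∫ t in (-T)..T, P L t ^ 2
  have hq0 : 0 ≤ q := intervalIntegral.integral_nonneg hTT fun t _ => sq_nonneg _
  refine ⟨?_, ?_, ?_⟩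
  · intro t ht
    -- Averaging over `s` trades the energy at one time for a space-time integral, to which the
    -- sidewise estimate integrated over x applies.
    have k1 : ∀ s ∈ Icc (-T) T, e t ≤ M * n s + K * q := by
      intro s hs
      have k2 : |e t - e s| ≤ K * q := by
        rcases le_total s t with hst | hst
        · exact (hdiff s hs t ht hst).trans ((hmono s t hs.1 hst ht.2).trans hE0)
        · rw [abs_sub_comm]
          exact (hdiff t ht s hs hst).trans ((hmono t s ht.1 hst hs.2).trans hE0)
      have k3 := (abs_le.1 k2).2
      have k4 := hen s
      linarith
    have k5 := intervalIntegral.integral_mono_on (μ := volume) hTT (f := fun _ => e t)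
      intervalIntegrable_const (Continuous.intervalIntegrable (by fun_prop) _ _) k1
    rw [intervalIntegral.integral_const, intervalIntegral.integral_add
      (Continuous.intervalIntegrable (by fun_prop) _ _) intervalIntegrable_const,
      intervalIntegral.integral_const, intervalIntegral.integral_const_mul, smul_eq_mul,
      smul_eq_mul, sub_neg_eq_add] at k5
    have k6 := mul_le_mul_of_nonneg_left hEn0 hM.le
    have k7 : 0 ≤ M * (L * (K * q)) := by positivity
    have k8 : (M * L / T + 1) * K * q = (M * (L * (K * q)) + T * (K * q)) / T := by
      field_simp
    rw [k8, le_div_iff₀ hT]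
    have k9 : M * (∫ t in (-T)..T, n t) ≤ M * (L * (K * q)) := k6
    linarith
  · have k1 : ∫ t in (-T)..T, Q 0 t ^ 2 ≤ ∫ t in (-T)..T, (P 0 t ^ 2 + Q 0 t ^ 2) :=
      intervalIntegral.integral_mono_on hTT (Continuous.intervalIntegrable (by fun_prop) _ _)
        (Continuous.intervalIntegrable (by fun_prop) _ _) fun t _ => by
          linarith [sq_nonneg (P 0 t)]
    have k2 : 0 ≤ M * L / T * (K * q) := by positivity
    have k3 : ∫ t in (-T)..T, Q 0 t ^ 2 ≤ K * q := k1.trans hE0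
    linarith
  · intro l hl
    have hE := h.integral_exp_mul_le hc hT.le hQ hl h0
    have hEn := h.integral_integral_exp_mul_le hc hT.le hQ hl
    rw [hKe] at hE hEn
    set χ : ℝ → ℝ := fun t => Real.exp (-(2 * l * t)) with hχdef
    have cχ : Continuous χ := by fun_prop
    set w := K * Real.exp (2 * l * β * L) * ∫ t in (-T)..T, χ t * P L t ^ 2
    -- The averaging now runs over [-T, 0], where inserting the weight costs nothing. This uses that
    -- the window reaches back before time 0.
    have hχ1 : ∀ t ≤ 0, 1 ≤ χ t := fun t ht => by
      rw [hχdef]; apply Real.one_le_exp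
      have := mul_nonneg (mul_nonneg zero_le_two hl) (neg_nonneg.2 ht)
      linarith
    have hT0 : -T ≤ 0 := by linarith
    have weight : ∀ f : ℝ → ℝ, Continuous f → (∀ t, 0 ≤ f t) → ∀ s ∈ Icc (-T) 0,
        ∫ t in s..0, f t ≤ ∫ t in (-T)..T, χ t * f t := by
      intro f hf hf0 s hs
      calc ∫ t in s..0, f t ≤ ∫ t in s..0, χ t * f t := by
            refine intervalIntegral.integral_mono_on hs.2 (hf.intervalIntegrable _ _)
              ((cχ.mul hf).intervalIntegrable _ _) fun t ht => ?_
            have := mul_le_mul_of_nonneg_right (hχ1 t ht.2) (hf0 t)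
            linarith
        _ ≤ _ := intervalIntegral.integral_mono_interval hs.1 hs.2 hT.le
            (ae_of_all _ fun t => mul_nonneg (Real.exp_pos _).le (hf0 t))
            ((cχ.mul hf).intervalIntegrable _ _)
    have k1 : ∀ s ∈ Icc (-T) 0, e 0 ≤ M * n s + w := by
      intro s hs
      have k2 := hdiff s ⟨hs.1, hs.2.trans hT.le⟩ 0 ⟨hT0, hT.le⟩ hs.2
      have k3 := weight (fun r => P 0 r ^ 2 + Q 0 r ^ 2) (by fun_prop) (fun r => by positivity) s hs
      have k4 := (abs_le.1 (k2.trans (k3.trans hE))).2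
      have k5 := hen s
      linarith
    have k5 := intervalIntegral.integral_mono_on (μ := volume) hT0 (f := fun _ => e 0)
      intervalIntegrable_const (Continuous.intervalIntegrable (by fun_prop) _ _) k1
    rw [intervalIntegral.integral_const, intervalIntegral.integral_add
      (Continuous.intervalIntegrable (by fun_prop) _ _) intervalIntegrable_const,
      intervalIntegral.integral_const, intervalIntegral.integral_const_mul, smul_eq_mul,
      smul_eq_mul, zero_sub, neg_neg] at k5
    have k6 := (weight n cn hn0 (-T) ⟨le_rfl, hT0⟩).trans hEn
    have k7 := mul_le_mul_of_nonneg_left k6 hM.le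
    have k8 : (M * L / T + 1) * K * Real.exp (2 * l * β * L) * (∫ t in (-T)..T, χ t * P L t ^ 2)
        = (M * (L * w) + T * w) / T := by
      simp only [w]; field_simp
    rw [k8, le_div_iff₀ hT]
    linarith

end IsWave

/-! ### Density of separated waves -/

theorem Submodule.exists_norm_sub_lt {H : Type*} [NormedAddCommGroup H] [InnerProductSpace ℝ H]
    [CompleteSpace H] (S : Submodule ℝ H) (h : ∀ f, (∀ g ∈ S, inner ℝ f g = 0) → f = 0) (f : H)
    {ε : ℝ} (hε : 0 < ε) : ∃ g ∈ S, ‖g - f‖ < ε := by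
  have h1 : S.topologicalClosure = ⊤ := by
    rw [Submodule.topologicalClosure_eq_top_iff, Submodule.eq_bot_iff]
    intro f hf
    exact h f fun g hg => by
      rw [real_inner_comm]; exact (Submodule.mem_orthogonal _ _).1 hf g hg
  have h2 : f ∈ closure (S : Set H) := by
    rw [← Submodule.topologicalClosure_coe, h1]; trivial
  obtain ⟨g, hg, hd⟩ := Metric.mem_closure_iff.1 h2 ε hε
  exact ⟨g, hg, by rwa [← dist_eq_norm, dist_comm]⟩

/-- The difference from the explicit solution is a mode with zero data at `T`. Hence the
completeness of Neumann modes, applied to the time interval with unit coefficients, is a statement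
about cosines. -/
theorem IsMode.eqOn_cos_sin {T ν : ℝ} {ψ η : ℝ → ℝ}
    (h : IsMode (fun _ => 1) (fun _ => 1) (-T) T ν ψ η) (hη : η T = 0) :
    ∀ t ∈ Icc (-T) T, ψ t = ψ T * Real.cos (ν * (t - T)) ∧
      η t = -(ψ T * Real.sin (ν * (t - T))) := by
  set C : ℝ → ℝ := fun t => ψ T * Real.cos (ν * (t - T)) with hC
  set S : ℝ → ℝ := fun t => ψ T * Real.sin (ν * (t - T)) with hS
  have hlin : ∀ t, HasDerivAt (fun t => ν * (t - T)) ν t := fun t => by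
    simpa using ((hasDerivAt_id t).sub_const T).const_mul ν
  have hC' : ∀ t, HasDerivAt C (-(ν * S t)) t := fun t =>
    ((hlin t).cos.const_mul (ψ T)).congr_deriv (by simp only [hS]; ring)
  have hS' : ∀ t, HasDerivAt S (ν * C t) t := fun t =>
    ((hlin t).sin.const_mul (ψ T)).congr_deriv (by simp only [hC]; ring)
  have cC : Continuous C := by fun_prop
  have cS : Continuous S := by fun_prop
  have cψ := h.continuous_fst
  have cη := h.continuous_snd
  have iC : ∀ t, ∫ s in t..T, -(ν * S s) = C T - C t := fun t =>
    intervalIntegral.integral_eq_sub_of_hasDerivAt (fun s _ => hC' s)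
      (Continuous.intervalIntegrable (by fun_prop) _ _)
  have iS : ∀ t, ∫ s in t..T, ν * C s = S T - S t := fun t =>
    intervalIntegral.integral_eq_sub_of_hasDerivAt (fun s _ => hS' s)
      (Continuous.intervalIntegrable (by fun_prop) _ _)
  have CT : C T = ψ T := by simp [hC]
  have ST : S T = 0 := by simp [hS]
  have key : IsMode (fun _ => 1) (fun _ => 1) (-T) T ν (fun t => ψ t - C t)
      (fun t => η t + S t) := by
    refine ⟨by fun_prop, by fun_prop, ?_, ?_⟩
    · intro t ht
      have e : ∀ s, ν * 1 * (η s + S s) = ν * 1 * η s - -(ν * S s) := fun s => by ring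
      simp only [e]
      rw [intervalIntegral.integral_sub (Continuous.intervalIntegrable (by fun_prop) _ _)
        (Continuous.intervalIntegrable (by fun_prop) _ _), iC, h.eq_fst t ht]
      ring
    · intro t ht
      have e : ∀ s, -(ν * 1 * (ψ s - C s)) = -(ν * 1 * ψ s) + ν * C s := fun s => by ring
      simp only [e]
      rw [intervalIntegral.integral_add (Continuous.intervalIntegrable (by fun_prop) _ _)
        (Continuous.intervalIntegrable (by fun_prop) _ _), iS, h.eq_snd t ht]
      ring
  have hz := key.eq_zero isCoeff_one isCoeff_one (by simp [CT]) (by simp [ST, hη])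
  have hψ : ∀ t ∈ Icc (-T) T, ψ t = C t := fun t ht => sub_eq_zero.1 (hz t ht)
  intro t ht
  refine ⟨hψ t ht, ?_⟩
  have k := key.eq_snd t ht
  have k0 : ∫ s in t..T, -(ν * 1 * (ψ s - C s)) = 0 := by
    rw [intervalIntegral.integral_congr (g := fun _ => 0)]
    · simp
    · intro s hs
      rw [uIcc_of_le ht.2] at hs
      simp only
      rw [hz s ⟨ht.1.trans hs.1, hs.2⟩]; simp
  rw [k0, hη, ST] at k
  linarith

namespace IsWave

variable {ρ b : ℝ → ℝ} {L : ℝ} {P Q Pt Qt : ℝ → ℝ → ℝ} {m M v β : ℝ}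

theorem zero (hb : IsCoeff m M b) : IsWave ρ b L (fun _ _ => 0) (fun _ _ => 0)
    (fun _ _ => 0) (fun _ _ => 0) := by
  have h : IsMode ρ b 0 L 0 (fun _ => 0) (fun _ => 0) :=
    ⟨continuous_const, continuous_const, by simp, by simp⟩
  simpa using of_isMode hb h rfl (f := fun _ => 0) (g := fun _ => 0)
    (fun t => by simpa using hasDerivAt_const t (0 : ℝ))
    (fun t => by simpa using hasDerivAt_const t (0 : ℝ))

theorem toL2_zero {c d : ℝ} : (toL2 c d fun _ => 0) = 0 := by
  simpa using toL2_const_mul (c := c) (d := d) (f := fun _ => 0) MemLp.zero' 0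

/-- Waves with homogeneous Neumann conditions have dense initial data. -/
theorem exists_initial_norm_sub_lt (hL : 0 < L) (hρ : IsCoeff m M ρ) (hb : IsCoeff m M b)
    (X Y : Lp ℝ 2 (volOn 0 L)) {ε : ℝ} (hε : 0 < ε) :
    ∃ P Q Pt Qt, IsWave ρ b L P Q Pt Qt ∧ (∀ t, Q 0 t = 0) ∧
      ‖(toL2 0 L fun x => P x 0) - X‖ < ε ∧ ‖(toL2 0 L fun x => b x * Q x 0) - Y‖ < ε := by
  -- Velocity and strain are approximated separately: `V₁` has zero strain and `V₂` zero velocity at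
  -- time 0. The phases (cos, sin) and (-sin, cos) of a Neumann mode supply elements of the two
  -- spaces.
  let V : (Lp ℝ 2 (volOn 0 L) → Lp ℝ 2 (volOn 0 L) → Lp ℝ 2 (volOn 0 L) → Prop) →
      Lp ℝ 2 (volOn 0 L) → Prop := fun p Z =>
    ∃ P Q Pt Qt, IsWave ρ b L P Q Pt Qt ∧ (∀ t, Q 0 t = 0) ∧
      p (toL2 0 L fun x => P x 0) (toL2 0 L fun x => b x * Q x 0) Z
  let V₁ : Submodule ℝ (Lp ℝ 2 (volOn 0 L)) :=
    { carrier := {Z | V (fun A B Z => A = Z ∧ B = 0) Z}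
      zero_mem' := ⟨_, _, _, _, zero hb, fun _ => rfl, toL2_zero, by simpa using toL2_zero⟩
      add_mem' := by
        rintro _ _ ⟨P, Q, Pt, Qt, h, h0, rfl, h2⟩ ⟨P', Q', Pt', Qt', h', h0', rfl, h2'⟩
        refine ⟨_, _, _, _, h.add hρ hb h', fun t => by rw [h0, h0', add_zero],
          h.toL2_P_add h' 0, ?_⟩
        rw [h.toL2_R_add hb h' 0, h2, h2', add_zero]
      smul_mem' := by
        rintro r _ ⟨P, Q, Pt, Qt, h, h0, rfl, h2⟩
        refine ⟨_, _, _, _, h.const_mul hb r, fun t => by rw [h0, mul_zero],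
          h.toL2_P_const_mul r 0, ?_⟩
        rw [h.toL2_R_const_mul hb r 0, h2, smul_zero] }
  let V₂ : Submodule ℝ (Lp ℝ 2 (volOn 0 L)) :=
    { carrier := {Z | V (fun A B Z => A = 0 ∧ B = Z) Z}
      zero_mem' := ⟨_, _, _, _, zero hb, fun _ => rfl, toL2_zero, by simpa using toL2_zero⟩
      add_mem' := by
        rintro _ _ ⟨P, Q, Pt, Qt, h, h0, h2, rfl⟩ ⟨P', Q', Pt', Qt', h', h0', h2', rfl⟩
        refine ⟨_, _, _, _, h.add hρ hb h', fun t => by rw [h0, h0', add_zero],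
          ?_, h.toL2_R_add hb h' 0⟩
        rw [h.toL2_P_add h' 0, h2, h2', add_zero]
      smul_mem' := by
        rintro r _ ⟨P, Q, Pt, Qt, h, h0, h2, rfl⟩
        refine ⟨_, _, _, _, h.const_mul hb r, fun t => by rw [h0, mul_zero],
          ?_, h.toL2_R_const_mul hb r 0⟩
        rw [h.toL2_P_const_mul r 0, h2, smul_zero] }
  have hcos : ∀ ν t : ℝ, HasDerivAt (fun t => Real.cos (ν * t)) (-(ν * Real.sin (ν * t))) t :=
    fun ν t => by
      have := ((hasDerivAt_id t).const_mul ν).cos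
      refine this.congr_deriv ?_
      simp only [id]; ring
  have hsin : ∀ ν t : ℝ, HasDerivAt (fun t => Real.sin (ν * t)) (ν * Real.cos (ν * t)) t :=
    fun ν t => by
      have := ((hasDerivAt_id t).const_mul ν).sin
      refine this.congr_deriv ?_
      simp only [id]; ring
  have hV₁ : ∀ f, (∀ g ∈ V₁, inner ℝ f g = 0) → f = 0 := by
    intro f hf
    refine eq_zero_of_inner_isMode_fst hL hρ hb fun ν ψ η h h0 hd => ?_
    have mψ : MemLp ψ 2 (volOn 0 L) := memLp_of_continuousOn h.continuous_fst.continuousOn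
    have := hf (toL2 0 L ψ) ⟨_, _, _, _, of_isMode hb h hd (hcos ν) (hsin ν),
      fun t => by rw [h0, mul_zero], by simp, by simpa using toL2_zero⟩
    rwa [← toL2_coe f, toL2_inner (Lp.memLp f) mψ] at this
  have hV₂ : ∀ f, (∀ g ∈ V₂, inner ℝ f g = 0) → f = 0 := by
    intro f hf
    refine eq_zero_of_inner_isMode_snd hL hρ hb fun ν ψ η h h0 hd => ?_
    have mη : MemLp (fun x => b x * η x) 2 (volOn 0 L) :=
      hb.memLp_mul h.continuous_snd.continuousOn
    have := hf (toL2 0 L fun x => b x * η x) ⟨_, _, _, _, of_isMode hb h hd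
      (f := fun t => -Real.sin (ν * t)) (g := fun t => Real.cos (ν * t))
      (fun t => (hsin ν t).neg) (fun t => (hcos ν t).congr_deriv (by ring)),
      fun t => by rw [h0, mul_zero], by simpa using toL2_zero, by simp⟩
    rwa [← toL2_coe f, toL2_inner (Lp.memLp f) mη] at this
  obtain ⟨_, ⟨P, Q, Pt, Qt, h, h0, rfl, h2⟩, hX⟩ := V₁.exists_norm_sub_lt hV₁ X hε
  obtain ⟨_, ⟨P', Q', Pt', Qt', h', h0', h2', rfl⟩, hY⟩ := V₂.exists_norm_sub_lt hV₂ Y hε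
  refine ⟨_, _, _, _, h.add hρ hb h', fun t => by rw [h0, h0', add_zero], ?_, ?_⟩
  · rwa [h.toL2_P_add h' 0, h2', add_zero]
  · rwa [h.toL2_R_add hb h' 0, h2, zero_add]

/-- The traces at `x = L` of waves that satisfy `Q = 0` at the times `T` and `-T` are dense. -/
theorem exists_trace_norm_sub_lt (hL : 0 < L) (hρ : IsCoeff m M ρ) (hb : IsCoeff m M b) {T : ℝ}
    (hT : 0 < T) (f : Lp ℝ 2 (volOn (-T) T)) {ε : ℝ} (hε : 0 < ε) :
    ∃ P Q Pt Qt, IsWave ρ b L P Q Pt Qt ∧ (∀ x, Q x T = 0 ∧ Q x (-T) = 0) ∧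
      ‖toL2 (-T) T (P L) - f‖ < ε := by
  have mP : ∀ {P Q Pt Qt : ℝ → ℝ → ℝ}, IsWave ρ b L P Q Pt Qt →
      MemLp (P L) 2 (volOn (-T) T) := fun h =>
    memLp_of_continuousOn (continuous_of_uncurry_right h.continuous_P L).continuousOn
  let V : Submodule ℝ (Lp ℝ 2 (volOn (-T) T)) :=
    { carrier := {Z | ∃ P Q Pt Qt, IsWave ρ b L P Q Pt Qt ∧ (∀ x, Q x T = 0 ∧ Q x (-T) = 0) ∧
        toL2 (-T) T (P L) = Z}
      zero_mem' := ⟨_, _, _, _, zero hb, fun _ => ⟨rfl, rfl⟩, toL2_zero⟩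
      add_mem' := by
        rintro _ _ ⟨P, Q, Pt, Qt, h, h0, rfl⟩ ⟨P', Q', Pt', Qt', h', h0', rfl⟩
        exact ⟨_, _, _, _, h.add hρ hb h', fun x => by simp [h0 x, h0' x],
          toL2_add (mP h) (mP h')⟩
      smul_mem' := by
        rintro r _ ⟨P, Q, Pt, Qt, h, h0, rfl⟩
        exact ⟨_, _, _, _, h.const_mul hb r, fun x => by simp [h0 x],
          toL2_const_mul (mP h) r⟩ }
  have hV : ∀ f, (∀ g ∈ V, inner ℝ f g = 0) → f = 0 := by
    intro f hf
    refine eq_zero_of_inner_isMode_fst (by linarith) isCoeff_one isCoeff_one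
      fun ν ψ η h h0 hd => ?_
    have hcs := h.eqOn_cos_sin hd
    -- Space and time exchange roles. Every frequency of the time problem is admissible, because in
    -- space only an initial value problem from x = L is solved and nothing is imposed at x = 0.
    obtain ⟨ψ', η', h', hψ', hη'⟩ := exists_isMode hL.le hρ hb ν
    have hlin : ∀ t, HasDerivAt (fun t => ν * (t - T)) ν t := fun t => by
      simpa using ((hasDerivAt_id t).sub_const T).const_mul ν
    have mψ : MemLp ψ 2 (volOn (-T) T) := memLp_of_continuousOn h.continuous_fst.continuousOn
    have := hf (toL2 (-T) T ψ) ⟨_, _, _, _, of_isMode hb h' hη'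
      (f := fun t => ψ T * Real.cos (ν * (t - T))) (g := fun t => ψ T * Real.sin (ν * (t - T)))
      (fun t => ((hlin t).cos.const_mul (ψ T)).congr_deriv (by ring))
      (fun t => ((hlin t).sin.const_mul (ψ T)).congr_deriv (by ring)), fun x => ⟨by simp, ?_⟩, ?_⟩
    · rwa [← toL2_coe f, toL2_inner (Lp.memLp f) mψ] at this
    · have := (hcs (-T) ⟨le_rfl, by linarith⟩).2
      rw [h0] at this
      rw [neg_eq_zero.1 this.symm, zero_mul]
    · apply toL2_congr
      filter_upwards [ae_restrict_mem measurableSet_Ioo] with t ht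
      rw [hψ', mul_one, ← (hcs t (Ioo_subset_Icc_self ht)).1]
  obtain ⟨_, ⟨P, Q, Pt, Qt, h, h0, rfl⟩, hX⟩ := V.exists_norm_sub_lt hV f hε
  exact ⟨P, Q, Pt, Qt, h, h0, hX⟩

end IsWave

/-! ### Traces that vanish up to the time `L β` -/

theorem tendsto_integral_exp_mul_sq {c d τ : ℝ} (f : Lp ℝ 2 (volOn c d))
    (hf : ∀ᵐ t ∂(volOn c d), t ≤ τ → f t = 0) :
    Tendsto (fun n : ℕ => ∫ t in Ioo c d, Real.exp (-(2 * n * (t - τ))) * f t ^ 2) atTop (𝓝 0) := by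
  have key := tendsto_integral_of_dominated_convergence (μ := volOn c d)
    (F := fun (n : ℕ) t => Real.exp (-(2 * n * (t - τ))) * f t ^ 2) (f := fun _ => 0)
    (fun t => f t ^ 2) (fun n => ?_) (Lp.memLp f).integrable_sq (fun n => ?_) ?_
  · simpa using key
  · exact (Continuous.aestronglyMeasurable (by fun_prop)).mul
      ((Lp.aestronglyMeasurable f).pow 2)
  · filter_upwards [hf] with t ht
    rw [Real.norm_eq_abs, abs_of_nonneg (by positivity)]
    rcases le_or_gt t τ with h | h
    · rw [ht h]; simp
    · have : Real.exp (-(2 * n * (t - τ))) ≤ 1 := by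
        rw [Real.exp_le_one_iff, neg_nonpos]
        have := sub_pos.2 h
        positivity
      exact mul_le_of_le_one_left (sq_nonneg _) this
  · filter_upwards [hf] with t ht
    rcases le_or_gt t τ with h | h
    · rw [ht h]; simp
    · have h1 : Tendsto (fun n : ℕ => (n : ℝ) * (2 * (t - τ))) atTop atTop :=
        tendsto_natCast_atTop_atTop.atTop_mul_const (by linarith)
      have h2 := (Real.tendsto_exp_neg_atTop_nhds_zero.comp h1).mul_const (f t ^ 2)
      rw [zero_mul] at h2
      refine h2.congr fun n => ?_
      simp only [Function.comp]
      congr 3; ring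

namespace IsWave

variable {ρ b : ℝ → ℝ} {L : ℝ} {P Q Pt Qt : ℝ → ℝ → ℝ} {m M v β : ℝ}

/-- A trace at `x = L` that vanishes before the time `L β` comes, up to a small error, from a wave
with small energy at time `0`. -/
theorem exists_trace_norm_sub_lt_energy_lt (hc : WaveCoeffs m M v β L ρ b) {T : ℝ} (hT : 0 < T)
    (f : Lp ℝ 2 (volOn (-T) T)) (hf : ∀ᵐ t ∂(volOn (-T) T), t ≤ L * β → f t = 0)
    {ε : ℝ} (hε : 0 < ε) :
    ∃ P Q Pt Qt, IsWave ρ b L P Q Pt Qt ∧ (∀ x, Q x T = 0 ∧ Q x (-T) = 0) ∧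
      ‖toL2 (-T) T (P L) - f‖ < ε ∧ waveEnergy ρ b L P Q 0 < ε := by
  obtain ⟨C, hC0, hC⟩ := exists_energy_le_trace hc hT
  have hTT : -T ≤ T := by linarith
  have hφ := (tendsto_integral_exp_mul_sq f hf).const_mul (2 * C)
  rw [mul_zero] at hφ
  -- The exponent is chosen first, from `f` alone, and the accuracy of the trace afterwards. The
  -- approximating trace need not vanish before L β, so its squared error is amplified by up to `D`,
  -- a factor that depends on `n`.
  obtain ⟨n, hn⟩ := (hφ.eventually (gt_mem_nhds (half_pos hε))).exists
  set D := 2 * C * (Real.exp (2 * n * β * L) * Real.exp (2 * n * T)) with hD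
  have hD0 : 0 ≤ D := by positivity
  have hδ : 0 < min ε (min 1 (ε / (2 * (D + 1)))) := by positivity
  obtain ⟨P, Q, Pt, Qt, h, h0, hP⟩ :=
    exists_trace_norm_sub_lt hc.length_pos hc.isCoeff_fst hc.isCoeff_snd hT f hδ
  refine ⟨P, Q, Pt, Qt, h, h0, hP.trans_le (min_le_left _ _), ?_⟩
  have cP := continuous_of_uncurry_right h.continuous_P L
  have mP : MemLp (P L) 2 (volOn (-T) T) := memLp_of_continuousOn cP.continuousOn
  set δ := ‖toL2 (-T) T (P L) - f‖ with hδdef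
  have hδ1 : δ < 1 := hP.trans_le ((min_le_right _ _).trans (min_le_left _ _))
  have hδ2 : δ < ε / (2 * (D + 1)) := hP.trans_le ((min_le_right _ _).trans (min_le_right _ _))
  have hδ0 : 0 ≤ δ := norm_nonneg _
  have e1 : δ ^ 2 = ∫ t in Ioo (-T) T, (P L t - f t) ^ 2 := by
    rw [hδdef]
    nth_rewrite 1 [← toL2_coe f]
    rw [← toL2_sub mP (Lp.memLp f)]
    exact toL2_norm_sq (mP.sub (Lp.memLp f))
  have i1 : Integrable (fun t => (P L t - f t) ^ 2) (volOn (-T) T) :=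
    (mP.sub (Lp.memLp f)).integrable_sq
  have i2 : Integrable (fun t => Real.exp (-(2 * n * t)) * f t ^ 2) (volOn (-T) T) := by
    refine (Lp.memLp f).integrable_sq.bdd_mul (c := Real.exp (2 * n * T))
      (Continuous.aestronglyMeasurable (by fun_prop)) ?_
    filter_upwards [ae_restrict_mem measurableSet_Ioo] with t ht
    rw [Real.norm_eq_abs, abs_of_nonneg (Real.exp_pos _).le, Real.exp_le_exp]
    have := mul_le_mul_of_nonneg_left ht.1.le (by positivity : (0 : ℝ) ≤ 2 * n)
    linarith
  have e2 : ∫ t in (-T)..T, Real.exp (-(2 * n * t)) * P L t ^ 2 ≤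
      2 * (∫ t in Ioo (-T) T, Real.exp (-(2 * n * t)) * f t ^ 2)
        + 2 * Real.exp (2 * n * T) * δ ^ 2 := by
    rw [e1, ← setIntegral_Ioo_eq_intervalIntegral hTT, ← integral_const_mul, ← integral_const_mul,
      ← integral_add (i2.const_mul 2) (i1.const_mul _)]
    have i0 : IntervalIntegrable (fun t => Real.exp (-(2 * n * t)) * P L t ^ 2) volume (-T) T :=
      Continuous.intervalIntegrable (by fun_prop) _ _
    have i0' : Integrable (fun t => Real.exp (-(2 * n * t)) * P L t ^ 2) (volOn (-T) T) :=
      ((intervalIntegrable_iff_integrableOn_Ioc_of_le hTT).1 i0).mono_set Ioo_subset_Ioc_self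
    refine integral_mono_ae i0' ((i2.const_mul 2).add (i1.const_mul _)) ?_
    filter_upwards [ae_restrict_mem measurableSet_Ioo] with t ht
    have k1 : Real.exp (-(2 * n * t)) ≤ Real.exp (2 * n * T) := by
      rw [Real.exp_le_exp]
      have := mul_le_mul_of_nonneg_left ht.1.le (by positivity : (0 : ℝ) ≤ 2 * n)
      linarith
    have k2 : P L t ^ 2 ≤ 2 * f t ^ 2 + 2 * (P L t - f t) ^ 2 := by
      nlinarith [sq_nonneg (P L t - 2 * f t)]
    have k3 := mul_le_mul_of_nonneg_left k2 (Real.exp_pos (-(2 * n * t))).le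
    have k4 := mul_le_mul_of_nonneg_right k1 (sq_nonneg (P L t - f t))
    linarith
  have e3 : Real.exp (2 * n * β * L) * (∫ t in Ioo (-T) T, Real.exp (-(2 * n * t)) * f t ^ 2)
      = ∫ t in Ioo (-T) T, Real.exp (-(2 * n * (t - L * β))) * f t ^ 2 := by
    rw [← integral_const_mul]
    congr 1; ext t
    rw [← mul_assoc, ← Real.exp_add]
    congr 2; ring
  have e4 := (hC P Q Pt Qt h h0).2.2 n (Nat.cast_nonneg n)
  have e5 := mul_le_mul_of_nonneg_left e2
    (mul_nonneg hC0 (Real.exp_pos (2 * n * β * L)).le)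
  have e6 : D * δ ^ 2 ≤ ε / 2 := by
    rw [lt_div_iff₀ (by positivity)] at hδ2
    nlinarith [mul_nonneg hD0 hδ0]
  have e7 : C * Real.exp (2 * n * β * L) *
      (2 * (∫ t in Ioo (-T) T, Real.exp (-(2 * n * t)) * f t ^ 2)
        + 2 * Real.exp (2 * n * T) * δ ^ 2) =
      2 * C * (∫ t in Ioo (-T) T, Real.exp (-(2 * n * (t - L * β))) * f t ^ 2) + D * δ ^ 2 := by
    rw [← e3, hD]; ring
  linarith

end IsWave

/-! ### Limits of regular waves are finite energy solutions -/

/-- Extending the integrand by constants gives a continuous function on the line, so the two-sided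
fundamental theorem covers the end points as well. -/
theorem hasDerivWithinAt_of_eq_add_integral {E : Type*} [NormedAddCommGroup E] [NormedSpace ℝ E]
    [CompleteSpace E] {T : ℝ} (hT : 0 ≤ T) {F f : ℝ → E} (hf : ContinuousOn f (Icc 0 T))
    (hF : ∀ t ∈ Icc 0 T, F t = F 0 + ∫ s in (0 : ℝ)..t, f s) {t : ℝ} (ht : t ∈ Icc 0 T) :
    HasDerivWithinAt F (f t) (Icc 0 T) t := by
  set g : ℝ → E := IccExtend hT ((Icc 0 T).domRestrict f)
  have hg : Continuous g := (continuousOn_iff_continuous_domRestrict.1 hf).Icc_extend'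
  have e : ∀ s ∈ Icc 0 T, g s = f s := fun s hs => IccExtend_of_mem hT _ hs
  have h1 : HasDerivAt (fun t => F 0 + ∫ s in (0 : ℝ)..t, g s) (g t) t :=
    (hg.integral_hasStrictDerivAt 0 t).hasDerivAt.const_add _
  rw [e t ht] at h1
  have k : ∀ r ∈ Icc 0 T, F r = F 0 + ∫ s in (0 : ℝ)..r, g s := fun r hr => by
    rw [hF r hr, intervalIntegral.integral_congr]
    intro s hs
    rw [uIcc_of_le hr.1] at hs
    exact (e s ⟨hs.1, hs.2.trans hr.2⟩).symm
  exact h1.hasDerivWithinAt.congr k (k t ht)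

namespace IsWave

variable {ρ b : ℝ → ℝ} {L : ℝ} {P Q Pt Qt : ℝ → ℝ → ℝ} {m M v β : ℝ}

/-- The displacement is recovered, up to a constant, from the trace velocity at x = L and the strain
b Q. Its time derivative is P because P_x = b Q_t. -/
theorem hasDerivAt_displacement (hL : 0 ≤ L) (hb : IsCoeff m M b) (h : IsWave ρ b L P Q Pt Qt)
    (t : ℝ) :
    HasDerivAt (fun t => (∫ s in (0 : ℝ)..t, P L s) • (toL2 0 L fun _ => 1)
      - tailOp 0 L hL (toL2 0 L fun x => b x * Q x t)) (toL2 0 L fun x => P x t) t := by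
  have cP := continuous_of_uncurry_right h.continuous_P L
  have h1 : HasDerivAt (fun t => ∫ s in (0 : ℝ)..t, P L s) (P L t) t :=
    (cP.integral_hasStrictDerivAt 0 t).hasDerivAt
  have h2 := (h1.smul_const (toL2 0 L fun _ => 1)).sub
    ((tailOp 0 L hL).hasFDerivAt.comp_hasDerivAt t (h.hasDerivAt_toL2_R t))
  refine h2.congr_deriv ?_
  have m1 : MemLp (fun _ => (1 : ℝ)) 2 (volOn 0 L) := memLp_of_continuousOn continuousOn_const
  have mQ : MemLp (fun x => b x * Qt x t) 2 (volOn 0 L) :=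
    hb.memLp_mul (continuous_of_uncurry_left h.continuous_Qt t).continuousOn
  rw [← toL2_const_mul m1]
  symm
  apply toL2_eq_of_ae
  filter_upwards [Lp.coeFn_sub (toL2 0 L fun _ => P L t * 1)
    (tailOp 0 L hL (toL2 0 L fun x => b x * Qt x t)),
    toL2_ae (m1.const_mul (P L t)), tailOp_ae hL (toL2 0 L fun x => b x * Qt x t),
    ae_restrict_mem measurableSet_Ioo] with x h1 h2 h3 hx
  have hx' := Ioo_subset_Icc_self hx
  rw [h1, Pi.sub_apply, h2, h3, h.eq_P t x hx', mul_one,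
    intervalIntegral_congr_volOn (toL2_ae mQ) hx' (right_mem_Icc.2 hL)]

/-- The weak form of the wave equation, tested with an element of `H¹` and integrated in time. -/
theorem weak_form (hL : 0 < L) (hρ : IsCoeff m M ρ) (hb : IsCoeff m M b)
    (h : IsWave ρ b L P Q Pt Qt) {f g : ℝ → ℝ} (hf : IsH1With 0 L f g) (t : ℝ) :
    inner ℝ (mulOp 0 L ρ ((toL2 0 L fun x => P x t) - toL2 0 L fun x => P x 0)) (toL2 0 L f)
      + (∫ s in (0 : ℝ)..t, inner ℝ (mulOp 0 L (fun x => (b x)⁻¹)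
          (toL2 0 L fun x => b x * Q x s)) (toL2 0 L g))
      + f 0 * ∫ s in (0 : ℝ)..t, Q 0 s = 0 := by
  have mf : MemLp f 2 (volOn 0 L) := memLp_of_continuousOn hf.continuousOn
  have hLL := right_mem_Icc.2 hL.le
  have h0L := left_mem_Icc.2 hL.le
  set Φ : Lp ℝ 2 (volOn 0 L) →L[ℝ] ℝ :=
    (innerSL ℝ (toL2 0 L f)) ∘L mulOp 0 L ρ
  set Ψ : Lp ℝ 2 (volOn 0 L) →L[ℝ] ℝ :=
    (innerSL ℝ (toL2 0 L g)) ∘L mulOp 0 L (fun x => (b x)⁻¹)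
  have hΦ : ∀ X, Φ X = inner ℝ (mulOp 0 L ρ X) (toL2 0 L f) := fun X => by rw [real_inner_comm]; rfl
  have hΨ : ∀ X, Ψ X = inner ℝ (mulOp 0 L (fun x => (b x)⁻¹) X) (toL2 0 L g) :=
    fun X => by rw [real_inner_comm]; rfl
  simp only [← hΦ, ← hΨ]
  have hd : ∀ s, Φ (toL2 0 L fun x => Pt x s)
      = -(Ψ (toL2 0 L fun x => b x * Q x s) + f 0 * Q 0 s) := by
    intro s
    have cPt := continuous_of_uncurry_left h.continuous_Pt s
    have mPt : MemLp (fun x => Pt x s) 2 (volOn 0 L) := memLp_of_continuousOn cPt.continuousOn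
    have cQ := continuous_of_uncurry_left h.continuous_Q s
    have hgi := hf.memLp.intervalIntegrable_volOn h0L hLL
    have key := integral_primitive_mul hL.le (hρ.intervalIntegrable_mul cPt 0 L) hgi
      (U := fun x => Q x s) (h.eq_Q s) (hf.eq_primitive hL)
    have i1 : IntervalIntegrable (fun x => ρ x * Pt x s * f x) volume 0 L := by
      refine (hρ.intervalIntegrable_mul cPt 0 L).mul_continuousOn ?_
      rw [uIcc_of_le hL.le]; exact hf.continuousOn
    have i2 : IntervalIntegrable (fun x => Q x s * g x) volume 0 L :=
      hgi.continuousOn_mul cQ.continuousOn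
    rw [intervalIntegral.integral_add i1 i2] at key
    have e1 : Φ (toL2 0 L fun x => Pt x s) = ∫ x in 0..L, ρ x * Pt x s * f x := by
      rw [hΦ, mulOp_inner hρ.memLp, ← setIntegral_Ioo_eq_intervalIntegral hL.le]
      apply integral_congr_ae
      filter_upwards [toL2_ae mPt, toL2_ae mf] with x k1 k2
      rw [k1, k2]
    have e2 : Ψ (toL2 0 L fun x => b x * Q x s) = ∫ x in 0..L, Q x s * g x := by
      rw [hΨ, mulOp_inner hb.inv.memLp, ← setIntegral_Ioo_eq_intervalIntegral hL.le]
      apply integral_congr_ae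
      filter_upwards [toL2_ae (h.memLp_R hb s), toL2_ae hf.memLp] with x k1 k2
      rw [k1, k2, inv_mul_cancel_left₀ (hb.apply_pos x).ne']
    rw [h.right_Q] at key
    rw [e1, e2]
    linarith
  have cQ0 := continuous_of_uncurry_right h.continuous_Q 0
  have cR : Continuous fun s => toL2 0 L fun x => b x * Q x s :=
    continuous_iff_continuousAt.2 fun s => (h.hasDerivAt_toL2_R s).continuousAt
  have c1 : Continuous fun s => Ψ (toL2 0 L fun x => b x * Q x s) := Ψ.continuous.comp cR
  have c2 : Continuous fun s => f 0 * Q 0 s := continuous_const.mul cQ0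
  have hFTC := intervalIntegral.integral_eq_sub_of_hasDerivAt (a := 0) (b := t)
    (f := fun s => Φ (toL2 0 L fun x => P x s))
    (fun s _ => (Φ.hasFDerivAt.comp_hasDerivAt s (h.hasDerivAt_toL2_P s)).congr_deriv (hd s))
    ((c1.add c2).neg.intervalIntegrable _ _)
  rw [intervalIntegral.integral_neg, intervalIntegral.integral_add (c1.intervalIntegrable _ _)
    (c2.intervalIntegrable _ _), intervalIntegral.integral_const_mul] at hFTC
  rw [map_sub]
  linarith

end IsWave

theorem tendsto_integral_of_tendsto_toL2 {T : ℝ} {f : ℕ → ℝ → ℝ} {g : Lp ℝ 2 (volOn 0 T)}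
    (hf : ∀ n, Continuous (f n)) (h : Tendsto (fun n => toL2 0 T (f n)) atTop (𝓝 g)) {t : ℝ}
    (ht : t ∈ Icc 0 T) :
    Tendsto (fun n => ∫ s in (0 : ℝ)..t, f n s) atTop (𝓝 (∫ s in (0 : ℝ)..t, g s)) := by
  have h0 : (0 : ℝ) ∈ Icc 0 T := ⟨le_rfl, ht.1.trans ht.2⟩
  rw [tendsto_iff_norm_sub_tendsto_zero]
  refine squeeze_zero (g := fun n => √|t - 0| * ‖toL2 0 T (f n) - g‖) (fun _ => norm_nonneg _)
    (fun n => ?_) ?_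
  · refine le_trans (le_of_eq ?_) (L2_abs_integral_le (toL2 0 T (f n) - g) h0 ht)
    have mf : MemLp (f n) 2 (volOn 0 T) := memLp_of_continuousOn (hf n).continuousOn
    rw [Real.norm_eq_abs, ← intervalIntegral_congr_volOn (toL2_ae mf) h0 ht,
      ← intervalIntegral.integral_sub (L2_intervalIntegrable _ h0 ht)
        (L2_intervalIntegrable _ h0 ht),
      intervalIntegral_congr_volOn (Lp.coeFn_sub (toL2 0 T (f n)) g) h0 ht]
    rfl
  · simpa using (tendsto_iff_norm_sub_tendsto_zero.1 h).const_mul (√|t - 0|)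

/-- Uniform convergence in time of velocity and strain, together with L² convergence of the traces
P(L,·) and Q(0,·), suffices to pass to the limit in the weak form. The displacement is anchored at x
= L, so its trace there is y₀(L) plus the primitive of `pL`. Dividing by a(0⁺) converts the limit
flux `q` into the control. -/
theorem isFiniteEnergySolution_of_tendsto {ρ b ρ' a' : ℝ → ℝ} {L T m M : ℝ} (hL : 0 < L)
    (hT : 0 ≤ T) (hρ : IsCoeff m M ρ) (hb : IsCoeff m M b) (hρ' : ρ' =ᵐ[volOn 0 L] ρ)
    (ha' : a' =ᵐ[volOn 0 L] fun x => (b x)⁻¹) (ha0 : Function.rightLim a' 0 ≠ 0)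
    {P Q Pt Qt : ℕ → ℝ → ℝ → ℝ} (h : ∀ n, IsWave ρ b L (P n) (Q n) (Pt n) (Qt n))
    {p r : ℝ → Lp ℝ 2 (volOn 0 L)}
    (hp : TendstoUniformlyOn (fun n t => toL2 0 L fun x => P n x t) p atTop (Icc 0 T))
    (hr : TendstoUniformlyOn (fun n t => toL2 0 L fun x => b x * Q n x t) r atTop (Icc 0 T))
    {pL q : Lp ℝ 2 (volOn 0 T)} (hpL : Tendsto (fun n => toL2 0 T (P n L)) atTop (𝓝 pL))
    (hq : Tendsto (fun n => toL2 0 T (Q n 0)) atTop (𝓝 q))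
    {y₀ y₀' y₁ : ℝ → ℝ} (hy₀ : IsH1With 0 L y₀ y₀') (hp0 : p 0 =ᵐ[volOn 0 L] y₁)
    (hr0 : r 0 =ᵐ[volOn 0 L] y₀') :
    IsFiniteEnergySolution ρ' a' L T y₀ y₁ (fun t => (Function.rightLim a' 0)⁻¹ * q t)
      fun x t => y₀ L + (∫ s in (0 : ℝ)..t, pL s) - ∫ s in x..L, r t s := by
  have h0 : (0 : ℝ) ∈ Icc 0 T := ⟨le_rfl, hT⟩
  have hLL := right_mem_Icc.2 hL.le
  have cpn : ∀ n, Continuous fun t => toL2 0 L fun x => P n x t := fun n =>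
    continuous_iff_continuousAt.2 fun t => ((h n).hasDerivAt_toL2_P t).continuousAt
  have crn : ∀ n, Continuous fun t => toL2 0 L fun x => b x * Q n x t := fun n =>
    continuous_iff_continuousAt.2 fun t => ((h n).hasDerivAt_toL2_R t).continuousAt
  have cp : ContinuousOn p (Icc 0 T) :=
    hp.continuousOn (.of_forall fun n => (cpn n).continuousOn)
  have cr : ContinuousOn r (Icc 0 T) :=
    hr.continuousOn (.of_forall fun n => (crn n).continuousOn)
  have sub : ∀ t ∈ Icc 0 T, uIcc 0 t ⊆ Icc 0 T := fun t ht => uIcc_subset_Icc h0 ht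
  have hprim : ∀ t, ∀ x ∈ Icc 0 L, (y₀ L + (∫ s in (0 : ℝ)..t, pL s) - ∫ s in x..L, r t s)
      = (y₀ L + (∫ s in (0 : ℝ)..t, pL s) - ∫ s in L..L, r t s) - ∫ s in x..L, r t s := by
    intro t x _; simp
  have hH1 : ∀ t, IsH1With 0 L
      (fun x => y₀ L + (∫ s in (0 : ℝ)..t, pL s) - ∫ s in x..L, r t s) (r t) := fun t =>
    isH1With_of_eq_primitive hL.le (Lp.memLp _) (hprim t)
  have mY : ∀ t, MemLp (fun x => y₀ L + (∫ s in (0 : ℝ)..t, pL s) - ∫ s in x..L, r t s) 2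
      (volOn 0 L) := fun t => memLp_of_continuousOn (hH1 t).continuousOn
  set Y : ℝ → Lp ℝ 2 (volOn 0 L) := fun t =>
    toL2 0 L fun x => y₀ L + (∫ s in (0 : ℝ)..t, pL s) - ∫ s in x..L, r t s with hY
  have m1 : MemLp (fun _ => (1 : ℝ)) 2 (volOn 0 L) := memLp_of_continuousOn continuousOn_const
  have hYt : ∀ t, Y t = y₀ L • (toL2 0 L fun _ => 1) + ((∫ s in (0 : ℝ)..t, pL s) •
      (toL2 0 L fun _ => 1) - tailOp 0 L hL.le (r t)) := by
    intro t
    rw [← add_sub_assoc, ← add_smul, ← toL2_const_mul m1]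
    apply toL2_eq_of_ae
    filter_upwards [Lp.coeFn_sub (toL2 0 L fun _ => (y₀ L + ∫ s in (0 : ℝ)..t, pL s) * 1)
      (tailOp 0 L hL.le (r t)), toL2_ae (m1.const_mul (y₀ L + ∫ s in (0 : ℝ)..t, pL s)),
      tailOp_ae hL.le (r t)] with x k1 k2 k3
    rw [k1, Pi.sub_apply, k2, k3, mul_one]
  have hint : ∀ t ∈ Icc 0 T, Y t = Y 0 + ∫ s in (0 : ℝ)..t, p s := by
    intro t ht
    have l1 := TendstoUniformlyOn.tendsto_intervalIntegral_of_continuousOn (μ := volume)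
      (.of_forall fun n => (cpn n).continuousOn) (hp.mono (sub t ht))
    have l2 : Tendsto (fun n => ((∫ s in (0 : ℝ)..t, P n L s) • (toL2 0 L fun _ => (1 : ℝ))
        - tailOp 0 L hL.le (toL2 0 L fun x => b x * Q n x t)) -
        ((∫ s in (0 : ℝ)..0, P n L s) • (toL2 0 L fun _ => (1 : ℝ))
        - tailOp 0 L hL.le (toL2 0 L fun x => b x * Q n x 0))) atTop (𝓝 (Y t - Y 0)) := by
      have : ∀ t ∈ Icc 0 T, Tendsto (fun n => (∫ s in (0 : ℝ)..t, P n L s) •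
          (toL2 0 L fun _ => (1 : ℝ)) - tailOp 0 L hL.le (toL2 0 L fun x => b x * Q n x t)) atTop
          (𝓝 ((∫ s in (0 : ℝ)..t, pL s) • (toL2 0 L fun _ => 1) - tailOp 0 L hL.le (r t))) :=
        fun t ht => ((tendsto_integral_of_tendsto_toL2
          (fun n => continuous_of_uncurry_right (h n).continuous_P L) hpL ht).smul_const _).sub
          (((tailOp 0 L hL.le).continuous.tendsto _).comp (hr.tendsto_at ht))
      rw [hYt, hYt, add_sub_add_left_eq_sub]
      exact (this t ht).sub (this 0 h0)
    have l3 := fun n => intervalIntegral.integral_eq_sub_of_hasDerivAt (a := 0) (b := t)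
      (fun s _ => (h n).hasDerivAt_displacement hL.le hb s)
      (Continuous.intervalIntegrable (μ := volume) (cpn n) 0 t)
    simp only [l3] at l1
    rw [tendsto_nhds_unique l1 l2]
    abel
  have hder : ∀ t ∈ Icc 0 T, HasDerivWithinAt Y (p t) (Icc 0 T) t := fun t ht =>
    hasDerivWithinAt_of_eq_add_integral hT cp hint ht
  refine ⟨Y, r, p, ⟨fun t _ => toL2_ae (mY t), fun t _ => hH1 t,
    fun t ht => (hder t ht).continuousWithinAt, cr, hder, cp, ?_, hp0, ?_⟩⟩
  · intro x hx
    rw [intervalIntegral_congr_volOn hr0 hx hLL, intervalIntegral.integral_same, add_zero,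
      hy₀.eq_primitive hL x hx]
  · intro f g hf t ht
    have mf : MemLp f 2 (volOn 0 L) := memLp_of_continuousOn hf.continuousOn
    have l1 : Tendsto (fun n => inner ℝ (mulOp 0 L ρ ((toL2 0 L fun x => P n x t)
        - toL2 0 L fun x => P n x 0)) (toL2 0 L f)) atTop
        (𝓝 (inner ℝ (mulOp 0 L ρ (p t - p 0)) (toL2 0 L f))) :=
      (((mulOp 0 L ρ).continuous.tendsto _).comp
        ((hp.tendsto_at ht).sub (hp.tendsto_at h0))).inner tendsto_const_nhds
    set Ψ : Lp ℝ 2 (volOn 0 L) →L[ℝ] ℝ :=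
      (innerSL ℝ (toL2 0 L g)) ∘L mulOp 0 L (fun x => (b x)⁻¹)
    have hΨ : ∀ X, Ψ X = inner ℝ (mulOp 0 L (fun x => (b x)⁻¹) X) (toL2 0 L g) :=
      fun X => by rw [real_inner_comm]; rfl
    have l2 : Tendsto (fun n => ∫ s in (0 : ℝ)..t, Ψ (toL2 0 L fun x => b x * Q n x s)) atTop
        (𝓝 (∫ s in (0 : ℝ)..t, Ψ (r s))) :=
      TendstoUniformlyOn.tendsto_intervalIntegral_of_continuousOn
        (.of_forall fun n => (Ψ.continuous.comp (crn n)).continuousOn)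
        (Ψ.uniformContinuous.comp_tendstoUniformlyOn (hr.mono (sub t ht)))
    have l3 := (tendsto_integral_of_tendsto_toL2
          (fun n => continuous_of_uncurry_right (h n).continuous_Q 0) hq ht).const_mul (f 0)
    have l4 := (l1.add l2).add l3
    simp only [hΨ, fun n => (h n).weak_form hL hρ hb hf t] at l4
    have key := tendsto_nhds_unique l4 tendsto_const_nhds
    rw [intervalIntegral.integral_const_mul, show ∀ A B C : ℝ, A * B * (A⁻¹ * C) = A * A⁻¹ * (B * C)
      from fun A B C => by ring, mul_inv_cancel₀ ha0, one_mul]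
    refine Eq.trans ?_ key
    congr 2
    · rw [mulOp_inner hρ.memLp]
      apply integral_congr_ae
      filter_upwards [hρ', Lp.coeFn_sub (p t) (p 0), toL2_ae mf] with x k1 k2 k3
      rw [k1, k2, k3, Pi.sub_apply]
    · congr 1; ext s
      rw [mulOp_inner hb.inv.memLp]
      apply integral_congr_ae
      filter_upwards [ha', toL2_ae hf.memLp] with x k1 k2
      rw [k1, k2]

/-! ### Uniqueness of finite energy solutions -/

theorem IsCoeff.mul_norm_sq_le_inner {m M c d : ℝ} {w : ℝ → ℝ} (hw : IsCoeff m M w)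
    (f : Lp ℝ 2 (volOn c d)) : m * ‖f‖ ^ 2 ≤ inner ℝ (mulOp c d w f) f := by
  rw [mulOp_inner hw.memLp, L2_norm_sq, ← integral_const_mul]
  have hi : Integrable (fun x => f x ^ 2) (volOn c d) := (Lp.memLp f).integrable_sq
  simp only [mul_assoc, ← sq]
  exact integral_mono (hi.const_mul m) (hi.bdd_mul hw.measurable.aestronglyMeasurable
    (ae_of_all _ hw.abs_le)) fun x => mul_le_mul_of_nonneg_right (hw.lower x) (sq_nonneg _)

theorem IsH1With.sub {c d : ℝ} (hcd : c < d) {f g f' g' : ℝ → ℝ} (h : IsH1With c d f g)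
    (h' : IsH1With c d f' g') : IsH1With c d (fun x => f x - f' x) (fun x => g x - g' x) := by
  refine isH1With_of_eq_primitive hcd.le (h.memLp.sub h'.memLp) fun x hx => ?_
  have hd := right_mem_Icc.2 hcd.le
  rw [intervalIntegral.integral_sub (h.memLp.intervalIntegrable_volOn hx hd)
    (h'.memLp.intervalIntegrable_volOn hx hd), h.eq_primitive hcd x hx, h'.eq_primitive hcd x hx]
  ring

theorem eq_zero_of_ae_eq_zero {c d : ℝ} (hcd : c < d) {f : ℝ → ℝ} (hf : ContinuousOn f (Icc c d))
    (h : f =ᵐ[volOn c d] 0) : ∀ x ∈ Icc c d, f x = 0 := by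
  have h1 : f =ᵐ[volume.restrict (Icc c d)] fun _ => 0 := by
    rw [← restrict_Ioo_eq_restrict_Icc]; exact h
  exact fun x hx => Measure.eqOn_Icc_of_ae_eq volume hcd.ne h1 hf continuousOn_const hx

section Uniqueness

variable {ρ α ρ' a' : ℝ → ℝ} {L T m M : ℝ} {y₀ y₁ u : ℝ → ℝ} {y z : ℝ → ℝ → ℝ}
  {Y Yx Yt Z Zx Zt : ℝ → Lp ℝ 2 (volOn 0 L)}

theorem IsFiniteEnergySolutionWith.weak_inner (hρ : IsCoeff m M ρ) (hα : IsCoeff m M α)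
    (hρ' : ρ' =ᵐ[volOn 0 L] ρ) (ha' : a' =ᵐ[volOn 0 L] α)
    (h : IsFiniteEnergySolutionWith ρ' a' L T y₀ y₁ u y Y Yx Yt) {f g : ℝ → ℝ}
    (hf : IsH1With 0 L f g) {t : ℝ} (ht : t ∈ Icc 0 T) :
    inner ℝ (mulOp 0 L ρ (Yt t - Yt 0)) (toL2 0 L f)
      + (∫ s in (0 : ℝ)..t, inner ℝ (mulOp 0 L α (Yx s)) (toL2 0 L g))
      + Function.rightLim a' 0 * f 0 * (∫ s in (0 : ℝ)..t, u s) = 0 := by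
  have mf : MemLp f 2 (volOn 0 L) := memLp_of_continuousOn hf.continuousOn
  refine Eq.trans ?_ (h.weak f g hf t ht)
  congr 2
  · rw [mulOp_inner hρ.memLp]
    apply integral_congr_ae
    filter_upwards [hρ', Lp.coeFn_sub (Yt t) (Yt 0), toL2_ae mf] with x k1 k2 k3
    rw [k1, k2, k3, Pi.sub_apply]
  · congr 1; ext s
    rw [mulOp_inner hα.memLp]
    apply integral_congr_ae
    filter_upwards [ha', toL2_ae hf.memLp] with x k1 k2
    rw [k1, k2]

/-- The time derivative of the difference D is only in L² and cannot be a test function, so the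
equation integrated in time is tested with D(t) itself. With V = ∫₀ᵗ D_x this says (ρ D_t, D) + (α
V, V_t) = 0, so (ρ D, D) + (α V, V) is conserved; it vanishes at time 0. -/
theorem IsFiniteEnergySolutionWith.eqOn (hL : 0 < L) (hT : 0 < T)
    (hρ : IsCoeff m M ρ) (hα : IsCoeff m M α)
    (hρ' : ρ' =ᵐ[volOn 0 L] ρ) (ha' : a' =ᵐ[volOn 0 L] α)
    (h : IsFiniteEnergySolutionWith ρ' a' L T y₀ y₁ u y Y Yx Yt)
    (h' : IsFiniteEnergySolutionWith ρ' a' L T y₀ y₁ u z Z Zx Zt) :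
    ∀ x ∈ Icc 0 L, ∀ t ∈ Icc 0 T, z x t = y x t := by
  have h0 : (0 : ℝ) ∈ Icc 0 T := ⟨le_rfl, hT.le⟩
  set D : ℝ → Lp ℝ 2 (volOn 0 L) := fun t => Y t - Z t
  set G : ℝ → Lp ℝ 2 (volOn 0 L) := fun t => Yx t - Zx t
  set Dt : ℝ → Lp ℝ 2 (volOn 0 L) := fun t => Yt t - Zt t
  set V : ℝ → Lp ℝ 2 (volOn 0 L) := fun t => ∫ s in (0 : ℝ)..t, G s
  have cG : ContinuousOn G (Icc 0 T) := h.continuousOn_x.sub h'.continuousOn_x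
  have hD : ∀ t ∈ Icc 0 T, HasDerivWithinAt D (Dt t) (Icc 0 T) t := fun t ht =>
    (h.hasDeriv_t t ht).sub (h'.hasDeriv_t t ht)
  have hV0 : V 0 = 0 := intervalIntegral.integral_same
  have hV : ∀ t ∈ Icc 0 T, HasDerivWithinAt V (G t) (Icc 0 T) t := fun t ht =>
    hasDerivWithinAt_of_eq_add_integral hT.le cG (fun t _ => by rw [hV0, zero_add]) ht
  have hD0 : D 0 = 0 := by
    refine sub_eq_zero.2 (Lp.ext ?_)
    filter_upwards [h.ae_eq 0 h0, h'.ae_eq 0 h0, ae_restrict_mem measurableSet_Ioo] with x k1 k2 hx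
    have hx' := Ioo_subset_Icc_self hx
    rw [k1, k2, h.initial x hx', h'.initial x hx']
  have hDt0 : Yt 0 = Zt 0 := Lp.ext (h.initial_t.trans h'.initial_t.symm)
  have hH : ∀ t ∈ Icc 0 T, IsH1With 0 L (fun x => y x t - z x t) (fun x => Yx t x - Zx t x) :=
    fun t ht => (h.isH1 t ht).sub hL (h'.isH1 t ht)
  have hDv : ∀ t ∈ Icc 0 T, (toL2 0 L fun x => y x t - z x t) = D t := by
    intro t ht
    apply toL2_eq_of_ae
    filter_upwards [h.ae_eq t ht, h'.ae_eq t ht, Lp.coeFn_sub (Y t) (Z t)] with x k1 k2 k3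
    rw [k3, Pi.sub_apply, k1, k2]
  have hGv : ∀ t, (toL2 0 L fun x => Yx t x - Zx t x) = G t := fun t =>
    toL2_eq_of_ae (Lp.coeFn_sub (Yx t) (Zx t)).symm
  have hweak : ∀ t ∈ Icc 0 T,
      inner ℝ (mulOp 0 L ρ (Dt t)) (D t) + inner ℝ (mulOp 0 L α (V t)) (G t) = 0 := by
    intro t ht
    have k1 := h.weak_inner hρ hα hρ' ha' (hH t ht) ht
    have k2 := h'.weak_inner hρ hα hρ' ha' (hH t ht) ht
    rw [hDv t ht, hGv t] at k1 k2
    set Ψ : Lp ℝ 2 (volOn 0 L) →L[ℝ] ℝ := (innerSL ℝ (G t)) ∘L mulOp 0 L α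
    have hΨ : ∀ X, inner ℝ (mulOp 0 L α X) (G t) = Ψ X := fun X => by rw [real_inner_comm]; rfl
    have hsub : uIcc 0 t ⊆ Icc 0 T := uIcc_subset_Icc h0 ht
    have i1 : IntervalIntegrable (fun s => Ψ (Yx s)) volume 0 t :=
      (Ψ.continuous.comp_continuousOn (h.continuousOn_x.mono hsub)).intervalIntegrable
    have i2 : IntervalIntegrable (fun s => Ψ (Zx s)) volume 0 t :=
      (Ψ.continuous.comp_continuousOn (h'.continuousOn_x.mono hsub)).intervalIntegrable
    have e : Ψ (V t) = (∫ s in (0 : ℝ)..t, Ψ (Yx s)) - ∫ s in (0 : ℝ)..t, Ψ (Zx s) := by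
      rw [← intervalIntegral.integral_sub i1 i2,
        ← Ψ.intervalIntegral_comp_comm (cG.mono hsub).intervalIntegrable]
      simp only [G, map_sub]
    have e' : inner ℝ (mulOp 0 L ρ (Dt t)) (D t) = inner ℝ (mulOp 0 L ρ (Yt t - Yt 0)) (D t)
        - inner ℝ (mulOp 0 L ρ (Zt t - Zt 0)) (D t) := by
      rw [← inner_sub_left, ← map_sub, hDt0, sub_sub_sub_cancel_right]
    simp only [hΨ] at k1 k2 ⊢
    rw [e, e']
    linarith
  set E : ℝ → ℝ := fun t => inner ℝ (mulOp 0 L ρ (D t)) (D t) + inner ℝ (mulOp 0 L α (V t)) (V t)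
  have hE : ∀ t ∈ Icc 0 T, HasDerivWithinAt E 0 (Icc 0 T) t := by
    intro t ht
    have k1 := ((mulOp 0 L ρ).hasFDerivAt.comp_hasDerivWithinAt t (hD t ht)).inner ℝ (hD t ht)
    have k2 := ((mulOp 0 L α).hasFDerivAt.comp_hasDerivWithinAt t (hV t ht)).inner ℝ (hV t ht)
    refine (k1.add k2).congr_deriv ?_
    have k3 := hweak t ht
    have k4 : inner ℝ (mulOp 0 L ρ (D t)) (Dt t) = inner ℝ (mulOp 0 L ρ (Dt t)) (D t) := by
      rw [mulOp_symm, real_inner_comm]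
    have k5 : inner ℝ (mulOp 0 L α (G t)) (V t) = inner ℝ (mulOp 0 L α (V t)) (G t) := by
      rw [mulOp_symm, real_inner_comm]
    simp only [Function.comp]
    rw [k4, k5]
    linarith
  intro x hx t ht
  have hEt : E t = 0 := by
    have := constant_of_derivWithin_zero (fun s hs => (hE s hs).differentiableWithinAt)
      (fun s hs => (hE s (Ico_subset_Icc_self hs)).derivWithin
        (uniqueDiffOn_Icc hT s (Ico_subset_Icc_self hs))) t ht
    rw [this]
    simp only [E, hD0, hV0, map_zero, inner_zero_left, add_zero]
  have k1 := hρ.mul_norm_sq_le_inner (D t)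
  have k2 := hα.mul_norm_sq_le_inner (V t)
  have k3 : ‖D t‖ ^ 2 = 0 := by
    have : 0 ≤ m * ‖V t‖ ^ 2 := mul_nonneg hρ.pos.le (sq_nonneg _)
    have k4 : m * ‖D t‖ ^ 2 ≤ 0 := by
      have : inner ℝ (mulOp 0 L ρ (D t)) (D t) + inner ℝ (mulOp 0 L α (V t)) (V t) = 0 := hEt
      linarith
    exact le_antisymm (nonpos_of_mul_nonpos_right k4 hρ.pos) (sq_nonneg _)
  have k5 : D t = 0 := norm_eq_zero.1 (pow_eq_zero_iff two_ne_zero |>.1 k3)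
  have k6 := eq_zero_of_ae_eq_zero hL (hH t ht).continuousOn (by
    filter_upwards [toL2_ae (memLp_of_continuousOn (p := 2) (hH t ht).continuousOn),
      Lp.coeFn_zero ℝ 2 (volOn 0 L)] with x k1 k2
    rw [← k1, hDv t ht, k5, k2]) x hx
  linarith

end Uniqueness

/-! ### Sidewise controllability for coefficients in `WaveCoeffs` -/

theorem exists_tendstoUniformlyOn {E : Type*} [NormedAddCommGroup E] [CompleteSpace E]
    {f : ℕ → ℝ → E} {s : Set ℝ} {K : ℝ}
    (h : ∀ n k : ℕ, ∀ t ∈ s, ‖f n t - f k t‖ ^ 2 ≤ K * (1 / ((n : ℝ) + 1) + 1 / ((k : ℝ) + 1)) ^ 2) :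
    ∃ g, TendstoUniformlyOn f g atTop s := by
  have hc : UniformCauchySeqOn f atTop s := by
    rw [Metric.uniformCauchySeqOn_iff]
    intro ε hε
    have h1 := (tendsto_one_div_add_atTop_nhds_zero_nat (𝕜 := ℝ)).const_mul (2 * √K)
    rw [mul_zero] at h1
    obtain ⟨N, hN⟩ := (h1.eventually (gt_mem_nhds hε)).exists
    refine ⟨N, fun n hn k hk t ht => ?_⟩
    rw [dist_eq_norm]
    have h2 := Real.le_sqrt_of_sq_le (h n k t ht)
    rw [Real.sqrt_mul' _ (sq_nonneg _), Real.sqrt_sq (by positivity)] at h2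
    refine (h2.trans ?_).trans_lt hN
    have h3 := Nat.one_div_le_one_div (α := ℝ) hn
    have h4 := Nat.one_div_le_one_div (α := ℝ) hk
    have := mul_le_mul_of_nonneg_left (add_le_add h3 h4) (Real.sqrt_nonneg K)
    linarith
  have hex : ∀ t, ∃ a, t ∈ s → Tendsto (fun n => f n t) atTop (𝓝 a) := by
    intro t
    by_cases ht : t ∈ s
    · obtain ⟨a, ha⟩ := cauchySeq_tendsto_of_complete (hc.cauchySeq ht)
      exact ⟨a, fun _ => ha⟩
    · exact ⟨0, fun h => absurd h ht⟩
  choose g hg using hex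
  exact ⟨g, hc.tendstoUniformlyOn_of_tendsto fun t ht => hg t ht⟩

theorem exists_tendsto_of_norm_sub_sq_le {E : Type*} [NormedAddCommGroup E] [CompleteSpace E]
    {f : ℕ → E} {K : ℝ}
    (h : ∀ n k : ℕ, ‖f n - f k‖ ^ 2 ≤ K * (1 / ((n : ℝ) + 1) + 1 / ((k : ℝ) + 1)) ^ 2) :
    ∃ g, Tendsto f atTop (𝓝 g) := by
  obtain ⟨g, hg⟩ := exists_tendstoUniformlyOn (f := fun n _ => f n) (s := {0})
    fun n k t _ => h n k
  exact ⟨g 0, hg.tendsto_at rfl⟩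

theorem tendsto_of_norm_sub_lt_one_div {E : Type*} [NormedAddCommGroup E] {f : ℕ → E} {g : E}
    (h : ∀ n : ℕ, ‖f n - g‖ < 1 / ((n : ℝ) + 1)) : Tendsto f atTop (𝓝 g) :=
  tendsto_iff_norm_sub_tendsto_zero.2 (squeeze_zero (fun _ => norm_nonneg _) (fun n => (h n).le)
    tendsto_one_div_add_atTop_nhds_zero_nat)

theorem norm_sub_le_of_norm_sub_lt {E : Type*} [NormedAddCommGroup E] {f : ℕ → E} {g : E}
    (h : ∀ n : ℕ, ‖f n - g‖ < 1 / ((n : ℝ) + 1)) (n k : ℕ) :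
    ‖f n - f k‖ ^ 2 ≤ (1 / ((n : ℝ) + 1) + 1 / ((k : ℝ) + 1)) ^ 2 := by
  refine pow_le_pow_left₀ (norm_nonneg _) ?_ 2
  have h1 := norm_sub_le_norm_sub_add_norm_sub (f n) g (f k)
  have h2 := h k
  rw [norm_sub_rev] at h2
  linarith [h n]

theorem norm_toL2_sub_sq {c d : ℝ} (hcd : c ≤ d) {f g : ℝ → ℝ} (hf : Continuous f)
    (hg : Continuous g) : ‖toL2 c d f - toL2 c d g‖ ^ 2 = ∫ t in c..d, (f t - g t) ^ 2 := by
  rw [← toL2_sub (memLp_of_continuousOn hf.continuousOn) (memLp_of_continuousOn hg.continuousOn),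
    toL2_norm_sq (f := fun t => f t - g t) (memLp_of_continuousOn (hf.sub hg).continuousOn),
    setIntegral_Ioo_eq_intervalIntegral hcd]

namespace IsWave

variable {ρ b : ℝ → ℝ} {L : ℝ} {P Q Pt Qt P' Q' Pt' Qt' : ℝ → ℝ → ℝ} {m M v β T : ℝ}

theorem toL2_P_sub (h : IsWave ρ b L P Q Pt Qt) (h' : IsWave ρ b L P' Q' Pt' Qt') (t : ℝ) :
    (toL2 0 L fun x => P x t - P' x t) = (toL2 0 L fun x => P x t) - toL2 0 L fun x => P' x t :=
  toL2_sub (h.memLp_P t) (h'.memLp_P t)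

theorem toL2_R_sub (hb : IsCoeff m M b) (h : IsWave ρ b L P Q Pt Qt)
    (h' : IsWave ρ b L P' Q' Pt' Qt') (t : ℝ) :
    (toL2 0 L fun x => b x * (Q x t - Q' x t))
      = (toL2 0 L fun x => b x * Q x t) - toL2 0 L fun x => b x * Q' x t := by
  rw [← toL2_sub (h.memLp_R hb t) (h'.memLp_R hb t)]
  simp only [mul_sub]

/-- A sequence of waves with `Q(0, t) = 0` that converges to the uncontrolled solution. -/
theorem exists_tendsto_initial (hc : WaveCoeffs m M v β L ρ b) (hT : 0 ≤ T)
    (X Y : Lp ℝ 2 (volOn 0 L)) :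
    ∃ P Q Pt Qt : ℕ → ℝ → ℝ → ℝ, (∀ n, IsWave ρ b L (P n) (Q n) (Pt n) (Qt n)) ∧
      (∀ n t, Q n 0 t = 0) ∧ ∃ p r : ℝ → Lp ℝ 2 (volOn 0 L),
      TendstoUniformlyOn (fun n t => toL2 0 L fun x => P n x t) p atTop (Icc 0 T) ∧
      TendstoUniformlyOn (fun n t => toL2 0 L fun x => b x * Q n x t) r atTop (Icc 0 T) ∧
      p 0 = X ∧ r 0 = Y ∧ ∃ pL, Tendsto (fun n => toL2 0 T (P n L)) atTop (𝓝 pL) := by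
  have hρ := hc.isCoeff_fst
  have hb := hc.isCoeff_snd
  have hL := hc.length_pos
  have hm := hρ.pos
  have hM := hρ.upper_pos
  obtain ⟨C, hC0, hC⟩ := exists_integral_trace_le hc hT
  have hex := fun n : ℕ => exists_initial_norm_sub_lt hL hρ hb X Y
    (Nat.one_div_pos_of_nat (α := ℝ) (n := n))
  choose P Q Pt Qt h hQ hX hY using hex
  -- The initial energy of a difference controls everything: it is conserved, because Q(0,·) = 0,
  -- and it bounds the trace at x = L by hidden regularity.
  have hE : ∀ n k, waveEnergy ρ b L (fun x t => P n x t - P k x t) (fun x t => Q n x t - Q k x t) 0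
      ≤ (M + m⁻¹) * (1 / ((n : ℝ) + 1) + 1 / ((k : ℝ) + 1)) ^ 2 := by
    intro n k
    have k1 := ((h n).sub hρ hb (h k)).energy_le_norm_sq hρ hb hL.le 0
    rw [(h n).toL2_P_sub (h k), (h n).toL2_R_sub hb (h k)] at k1
    have k2 := mul_le_mul_of_nonneg_left (norm_sub_le_of_norm_sub_lt hX n k) hM.le
    have k3 := mul_le_mul_of_nonneg_left (norm_sub_le_of_norm_sub_lt hY n k) (inv_pos.2 hm).le
    linarith
  have hE' : ∀ n k t, waveEnergy ρ b L (fun x t => P n x t - P k x t)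
      (fun x t => Q n x t - Q k x t) t
      ≤ (M + m⁻¹) * (1 / ((n : ℝ) + 1) + 1 / ((k : ℝ) + 1)) ^ 2 := fun n k t => by
    rw [((h n).sub hρ hb (h k)).energy_eq_of_left_eq_zero hρ hb hL.le
      (fun t => by rw [hQ, hQ, sub_zero])]
    exact hE n k
  have h0 : (0 : ℝ) ∈ Icc 0 T := ⟨le_rfl, hT⟩
  obtain ⟨p, hp⟩ := exists_tendstoUniformlyOn (f := fun n t => toL2 0 L fun x => P n x t)
    (s := Icc 0 T) (K := m⁻¹ * (M + m⁻¹)) fun n k t _ => by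
      rw [← (h n).toL2_P_sub (h k), mul_assoc]
      exact (((h n).sub hρ hb (h k)).norm_sq_le_energy hρ hb hL.le t).1.trans
        (mul_le_mul_of_nonneg_left (hE' n k t) (inv_pos.2 hm).le)
  obtain ⟨r, hr⟩ := exists_tendstoUniformlyOn (f := fun n t => toL2 0 L fun x => b x * Q n x t)
    (s := Icc 0 T) (K := M * (M + m⁻¹)) fun n k t _ => by
      rw [← (h n).toL2_R_sub hb (h k), mul_assoc]
      exact (((h n).sub hρ hb (h k)).norm_sq_le_energy hρ hb hL.le t).2.trans
        (mul_le_mul_of_nonneg_left (hE' n k t) hM.le)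
  obtain ⟨pL, hpL⟩ := exists_tendsto_of_norm_sub_sq_le (f := fun n => toL2 0 T (P n L))
    (K := C * (M + m⁻¹)) fun n k => by
      rw [norm_toL2_sub_sq hT (continuous_of_uncurry_right (h n).continuous_P L)
        (continuous_of_uncurry_right (h k).continuous_P L), mul_assoc]
      exact (hC _ _ _ _ ((h n).sub hρ hb (h k)) (fun t => by rw [hQ, hQ, sub_zero])).trans
        (mul_le_mul_of_nonneg_left (hE n k) hC0)
  exact ⟨P, Q, Pt, Qt, h, hQ, p, r, hp, hr,
    tendsto_nhds_unique (hp.tendsto_at h0) (tendsto_of_norm_sub_lt_one_div hX),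
    tendsto_nhds_unique (hr.tendsto_at h0) (tendsto_of_norm_sub_lt_one_div hY), pL, hpL⟩

/-- A sequence of waves that converges to a solution with vanishing initial data and with a
prescribed trace at `x = L`, which has to vanish until the time `L β`. -/
theorem exists_tendsto_trace (hc : WaveCoeffs m M v β L ρ b) (hT : 0 < T) {f : ℝ → ℝ}
    (hf : MemLp f 2 (volOn (-T) T)) (hf0 : ∀ t ≤ L * β, f t = 0) :
    ∃ P Q Pt Qt : ℕ → ℝ → ℝ → ℝ, (∀ n, IsWave ρ b L (P n) (Q n) (Pt n) (Qt n)) ∧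
      ∃ p r : ℝ → Lp ℝ 2 (volOn 0 L),
      TendstoUniformlyOn (fun n t => toL2 0 L fun x => P n x t) p atTop (Icc 0 T) ∧
      TendstoUniformlyOn (fun n t => toL2 0 L fun x => b x * Q n x t) r atTop (Icc 0 T) ∧
      p 0 = 0 ∧ r 0 = 0 ∧ Tendsto (fun n => toL2 0 T (P n L)) atTop (𝓝 (toL2 0 T f)) ∧
      ∃ q, Tendsto (fun n => toL2 0 T (Q n 0)) atTop (𝓝 q) := by
  have hρ := hc.isCoeff_fst
  have hb := hc.isCoeff_snd
  have hL := hc.length_pos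
  have hm := hρ.pos
  have hM := hρ.upper_pos
  have hTT : -T ≤ T := by linarith
  have hT0 : -T ≤ 0 := by linarith
  obtain ⟨C, hC0, hC⟩ := exists_energy_le_trace hc hT
  have hex := fun n : ℕ => exists_trace_norm_sub_lt_energy_lt hc hT (toL2 (-T) T f)
    ((toL2_ae hf).mono fun t ht h => ht.trans (hf0 t h))
    (Nat.one_div_pos_of_nat (α := ℝ) (n := n))
  choose P Q Pt Qt h hQ hP hE0 using hex
  have hPc : ∀ n, Continuous (P n L) := fun n => continuous_of_uncurry_right (h n).continuous_P L
  have hq : ∀ n k, ∫ t in (-T)..T, (P n L t - P k L t) ^ 2 ≤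
      (1 / ((n : ℝ) + 1) + 1 / ((k : ℝ) + 1)) ^ 2 := fun n k => by
    rw [← norm_toL2_sub_sq hTT (hPc n) (hPc k)]
    exact norm_sub_le_of_norm_sub_lt hP n k
  -- Differences keep the condition Q = 0 at the times T and -T, so the unweighted bounds make all
  -- sequences Cauchy. The weighted bound has already been spent on making the initial energies in
  -- `hE0` tend to zero.
  have hd := fun n k => hC _ _ _ _ ((h n).sub hρ hb (h k))
    (fun x => by simp [hQ n x, hQ k x])
  have hE : ∀ n k, ∀ t ∈ Icc 0 T, waveEnergy ρ b L (fun x t => P n x t - P k x t)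
      (fun x t => Q n x t - Q k x t) t ≤ C * (1 / ((n : ℝ) + 1) + 1 / ((k : ℝ) + 1)) ^ 2 :=
    fun n k t ht => ((hd n k).1 t ⟨hT0.trans ht.1, ht.2⟩).trans
      (mul_le_mul_of_nonneg_left (hq n k) hC0)
  have h0 : (0 : ℝ) ∈ Icc 0 T := ⟨le_rfl, hT.le⟩
  obtain ⟨p, hp⟩ := exists_tendstoUniformlyOn (f := fun n t => toL2 0 L fun x => P n x t)
    (s := Icc 0 T) (K := m⁻¹ * C) fun n k t ht => by
      rw [← (h n).toL2_P_sub (h k), mul_assoc]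
      exact (((h n).sub hρ hb (h k)).norm_sq_le_energy hρ hb hL.le t).1.trans
        (mul_le_mul_of_nonneg_left (hE n k t ht) (inv_pos.2 hm).le)
  obtain ⟨r, hr⟩ := exists_tendstoUniformlyOn (f := fun n t => toL2 0 L fun x => b x * Q n x t)
    (s := Icc 0 T) (K := M * C) fun n k t ht => by
      rw [← (h n).toL2_R_sub hb (h k), mul_assoc]
      exact (((h n).sub hρ hb (h k)).norm_sq_le_energy hρ hb hL.le t).2.trans
        (mul_le_mul_of_nonneg_left (hE n k t ht) hM.le)
  have hQc : ∀ n, Continuous (Q n 0) := fun n => continuous_of_uncurry_right (h n).continuous_Q 0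
  obtain ⟨q, hq⟩ := exists_tendsto_of_norm_sub_sq_le (f := fun n => toL2 0 T (Q n 0))
    (K := C) fun n k => by
      rw [norm_toL2_sub_sq hT.le (hQc n) (hQc k)]
      refine le_trans ?_ ((hd n k).2.1.trans (mul_le_mul_of_nonneg_left (hq n k) hC0))
      exact intervalIntegral.integral_mono_interval hT0 hT.le le_rfl
        (ae_of_all _ fun t => sq_nonneg _)
        ((((hQc n).sub (hQc k)).pow 2).intervalIntegrable _ _)
  have hinit : ∀ {F : ℕ → Lp ℝ 2 (volOn 0 L)} {K : ℝ}, 0 ≤ K →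
      (∀ n, ‖F n‖ ^ 2 ≤ K * waveEnergy ρ b L (P n) (Q n) 0) → Tendsto F atTop (𝓝 0) := by
    intro F K hK hF
    have k1 : Tendsto (fun n => ‖F n‖ ^ 2) atTop (𝓝 0) := by
      refine squeeze_zero (fun n => sq_nonneg _) (fun n => (hF n).trans
        (mul_le_mul_of_nonneg_left (hE0 n).le hK)) ?_
      simpa using (tendsto_one_div_add_atTop_nhds_zero_nat (𝕜 := ℝ)).const_mul K
    have k2 := k1.sqrt
    simp only [Real.sqrt_sq (norm_nonneg _), Real.sqrt_zero] at k2
    exact tendsto_zero_iff_norm_tendsto_zero.2 k2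
  refine ⟨P, Q, Pt, Qt, h, p, r, hp, hr, ?_, ?_, ?_, q, hq⟩
  · exact tendsto_nhds_unique (hp.tendsto_at h0) (hinit (inv_pos.2 hm).le fun n =>
      ((h n).norm_sq_le_energy hρ hb hL.le 0).1)
  · exact tendsto_nhds_unique (hr.tendsto_at h0) (hinit hM.le fun n =>
      ((h n).norm_sq_le_energy hρ hb hL.le 0).2)
  · refine tendsto_of_norm_sub_lt_one_div fun n => lt_of_le_of_lt ?_ (hP n)
    have hle : volOn 0 T ≤ volOn (-T) T := Measure.restrict_mono (Ioo_subset_Ioo_left hT0) le_rfl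
    have mP : MemLp (P n L) 2 (volOn (-T) T) := memLp_of_continuousOn (hPc n).continuousOn
    have md : MemLp (fun t => P n L t - f t) 2 (volOn (-T) T) := mP.sub hf
    rw [← toL2_sub mP hf, ← toL2_sub (mP.mono_measure hle) (hf.mono_measure hle),
      ← pow_le_pow_iff_left₀ (norm_nonneg _) (norm_nonneg _) two_ne_zero, toL2_norm_sq md,
      toL2_norm_sq (md.mono_measure hle)]
    exact integral_mono_measure hle (ae_of_all _ fun t => sq_nonneg _) md.integrable_sq

end IsWave

theorem IsFiniteEnergySolution.isThe {ρ α ρ' a' : ℝ → ℝ} {L T m M : ℝ} {y₀ y₁ u : ℝ → ℝ}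
    {y : ℝ → ℝ → ℝ} (hL : 0 < L) (hT : 0 < T) (hρ : IsCoeff m M ρ) (hα : IsCoeff m M α)
    (hρ' : ρ' =ᵐ[volOn 0 L] ρ) (ha' : a' =ᵐ[volOn 0 L] α)
    (h : IsFiniteEnergySolution ρ' a' L T y₀ y₁ u y) :
    IsTheFiniteEnergySolution ρ' a' L T y₀ y₁ u y := by
  obtain ⟨Y, Yx, Yt, hY⟩ := h
  exact ⟨⟨Y, Yx, Yt, hY⟩, fun z ⟨Z, Zx, Zt, hZ⟩ => hY.eqOn hL hT hρ hα hρ' ha' hZ⟩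

theorem IsCoeff.mono {m M m' M' : ℝ} {w : ℝ → ℝ} (h : IsCoeff m M w) (hm' : 0 < m') (hm : m' ≤ m)
    (hM : M ≤ M') : IsCoeff m' M' w :=
  ⟨h.measurable, hm', fun x => hm.trans (h.lower x), fun x => (h.upper x).trans hM⟩

theorem sidewise_controllability {ρ b ρ' a' : ℝ → ℝ} {L T m M v β : ℝ}
    (hc : WaveCoeffs m M v β L ρ b) (hρ' : ρ' =ᵐ[volOn 0 L] ρ)
    (ha' : a' =ᵐ[volOn 0 L] fun x => (b x)⁻¹) (ha0 : Function.rightLim a' 0 ≠ 0)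
    (hT : L * β < T) {y₀ y₁ : ℝ → ℝ} (hy₀ : MemH1 0 L y₀) (hy₁ : MemLp y₁ 2 (volOn 0 L)) :
    ∃ w : ℝ → ℝ → ℝ, IsTheFiniteEnergySolution ρ' a' L T y₀ y₁ (fun _ => 0) w ∧
      ∀ p : ℝ → ℝ, MemH1 (L * β) T p → p (L * β) = w L (L * β) →
        ∃ u : ℝ → ℝ, MemLp u 2 (volOn 0 T) ∧
          ∃ y : ℝ → ℝ → ℝ, IsTheFiniteEnergySolution ρ' a' L T y₀ y₁ u y ∧
            ∀ t ∈ Ioo (L * β) T, y L t = p t := by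
  have hρ := hc.isCoeff_fst
  have hb := hc.isCoeff_snd
  have hL := hc.length_pos
  have hβ : 0 ≤ L * β := mul_nonneg hL.le hc.beta_nonneg
  have hT0 : 0 < T := hβ.trans_lt hT
  -- Uniqueness is stated for ρ and α = 1/b with common bounds, and inversion changes those of `b`.
  have hρm := hρ.mono (lt_min hρ.pos hb.inv.pos) (min_le_left m M⁻¹) (le_max_left M m⁻¹)
  have hbm := hb.inv.mono (lt_min hρ.pos hb.inv.pos) (min_le_right m M⁻¹) (le_max_right M m⁻¹)
  obtain ⟨y₀', hy₀'⟩ := hy₀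
  obtain ⟨P, Q, Pt, Qt, h, hQ, p, r, hp, hr, hp0, hr0, pL, hpL⟩ :=
    IsWave.exists_tendsto_initial hc hT0.le (toL2 0 L y₁) (toL2 0 L y₀')
  have hp0' : p 0 =ᵐ[volOn 0 L] y₁ := by rw [hp0]; exact toL2_ae hy₁
  have hr0' : r 0 =ᵐ[volOn 0 L] y₀' := by rw [hr0]; exact toL2_ae hy₀'.memLp
  have hq : Tendsto (fun n => toL2 0 T (Q n 0)) atTop (𝓝 0) := by
    simp only [show ∀ n, Q n 0 = fun _ => 0 from fun n => funext (hQ n), IsWave.toL2_zero]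
    exact tendsto_const_nhds
  have hw := isFiniteEnergySolution_of_tendsto hL hT0.le hρ hb hρ' ha' ha0 h hp hr hpL hq hy₀'
    hp0' hr0'
  refine ⟨fun x t => y₀ L + (∫ s in (0 : ℝ)..t, pL s) - ∫ s in x..L, r t s, ?_, ?_⟩
  · refine IsFiniteEnergySolution.isThe hL hT0 hρm hbm hρ' ha' ?_
    obtain ⟨Y, Yx, Yt, k⟩ := hw
    -- The limit construction returns a multiple of the zero class as control, which is the function
    -- 0 only almost everywhere. The weak form alone involves the control, through its integral.
    refine ⟨Y, Yx, Yt, { k with weak := fun f g hf t ht => ?_ }⟩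
    have k1 : ∫ s in (0 : ℝ)..t, (Function.rightLim a' 0)⁻¹ *
        (0 : Lp ℝ 2 (volOn 0 T)) s = ∫ s in (0 : ℝ)..t, (0 : ℝ) := by
      refine intervalIntegral_congr_volOn ?_ ⟨le_rfl, hT0.le⟩ ht
      filter_upwards [Lp.coeFn_zero ℝ 2 (volOn 0 T)] with s hs
      rw [hs, Pi.zero_apply, mul_zero]
    have := k.weak f g hf t ht
    rwa [k1] at this
  · intro z hz hzw
    obtain ⟨z', hz'⟩ := hz
    have hTm : L * β ∈ Icc 0 T := ⟨hβ, hT.le⟩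
    have h0 : (0 : ℝ) ∈ Icc 0 T := ⟨le_rfl, hT0.le⟩
    -- The correction that the trace velocity of the uncontrolled solution needs in order to follow
    -- the target. It vanishes up to L β, so the added solution has zero initial data; agreement of
    -- the values at L β fixes the constant of integration.
    set f : ℝ → ℝ := (Ioo (L * β) T).indicator fun t => z' t - pL t with hf
    have mpL : MemLp pL 2 (volOn (L * β) T) :=
      (Lp.memLp pL).mono_measure (Measure.restrict_mono (Ioo_subset_Ioo_left hβ) le_rfl)
    have mf : ∀ c ≤ L * β, MemLp f 2 (volOn c T) := fun c hcl => by
      rw [hf, memLp_indicator_iff_restrict measurableSet_Ioo, Measure.restrict_restrict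
        measurableSet_Ioo, inter_eq_left.2 (Ioo_subset_Ioo_left hcl)]
      exact hz'.memLp.sub mpL
    obtain ⟨P', Q', Pt', Qt', h', p', r', hp', hr', hpz, hrz, hpL', q, hq'⟩ :=
      IsWave.exists_tendsto_trace hc hT0 (mf (-T) (by linarith))
        (fun t ht => indicator_of_notMem (fun hm => ht.not_gt hm.1) _)
    have hs := isFiniteEnergySolution_of_tendsto hL hT0.le hρ hb hρ' ha' ha0
      (P := fun n x t => P n x t + P' n x t) (Q := fun n x t => Q n x t + Q' n x t)
      (fun n => (h n).add hρ hb (h' n)) (p := p + p') (r := r + r')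
      (by simp only [(h _).toL2_P_add (h' _)]; exact hp.add hp')
      (by simp only [(h _).toL2_R_add hb (h' _)]; exact hr.add hr')
      (pL := pL + toL2 0 T f) (q := q) ?_ ?_ hy₀' (y₁ := y₁) ?_ ?_
    · refine ⟨_, (Lp.memLp q).const_mul _, _,
        IsFiniteEnergySolution.isThe hL hT0 hρm hbm hρ' ha' hs, ?_⟩
      intro t ht
      have htm : t ∈ Icc 0 T := ⟨hβ.trans ht.1.le, ht.2.le⟩
      have e1 : ∫ s in (0 : ℝ)..t, (pL + toL2 0 T f : Lp ℝ 2 (volOn 0 T)) s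
          = ∫ s in (0 : ℝ)..t, (pL s + f s) := by
        refine intervalIntegral_congr_volOn ?_ h0 htm
        filter_upwards [Lp.coeFn_add pL (toL2 0 T f), toL2_ae (mf 0 hβ)] with s k1 k2
        rw [k1, Pi.add_apply, k2]
      have ipL := fun {x y : ℝ} (hx : x ∈ Icc 0 T) (hy : y ∈ Icc 0 T) =>
        L2_intervalIntegrable pL hx hy
      have if0 := fun {x y : ℝ} (hx : x ∈ Icc 0 T) (hy : y ∈ Icc 0 T) =>
        (mf 0 hβ).intervalIntegrable_volOn hx hy
      have e2 : ∫ s in (0 : ℝ)..(L * β), (pL s + f s) = ∫ s in (0 : ℝ)..(L * β), pL s := by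
        apply intervalIntegral.integral_congr
        intro s hs
        rw [uIcc_of_le hβ] at hs
        simp only [f, indicator_of_notMem (fun hm : s ∈ Ioo (L * β) T => hs.2.not_gt hm.1),
          add_zero]
      have hTl : T ∈ Icc (L * β) T := ⟨hT.le, le_rfl⟩
      have htl : t ∈ Icc (L * β) T := ⟨ht.1.le, ht.2.le⟩
      have hll : L * β ∈ Icc (L * β) T := ⟨le_rfl, hT.le⟩
      have e3 : ∫ s in (L * β)..t, (pL s + f s) = ∫ s in (L * β)..t, z' s := by
        refine intervalIntegral_congr_volOn (c := L * β) (d := T) ?_ hll htl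
        filter_upwards [ae_restrict_mem measurableSet_Ioo] with s hs
        simp only [f, indicator_of_mem hs]
        ring
      have e4 : ∫ s in (L * β)..t, z' s = z t - z (L * β) := by
        have k1 := hz'.eq_primitive hT _ hll
        have k2 := hz'.eq_primitive hT _ htl
        have k3 := intervalIntegral.integral_add_adjacent_intervals
          (hz'.memLp.intervalIntegrable_volOn hll htl) (hz'.memLp.intervalIntegrable_volOn htl hTl)
        linarith
      have e5 := intervalIntegral.integral_add_adjacent_intervals
        ((ipL h0 hTm).add (if0 h0 hTm)) ((ipL hTm htm).add (if0 hTm htm))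
      simp only [intervalIntegral.integral_same, sub_zero] at hzw ⊢
      rw [e1, ← e5, e2, e3, e4, hzw]
      ring
    · have k := hpL.add hpL'
      refine k.congr fun n => ?_
      rw [← toL2_add (memLp_of_continuousOn
        (continuous_of_uncurry_right (h n).continuous_P L).continuousOn) (memLp_of_continuousOn
        (continuous_of_uncurry_right (h' n).continuous_P L).continuousOn)]
    · refine hq'.congr fun n => ?_
      simp only [hQ, zero_add]
    · rw [Pi.add_apply, hpz, add_zero]; exact hp0'
    · rw [Pi.add_apply, hrz, add_zero]; exact hr0'

/-! ### Coefficients of bounded variation -/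

theorem abs_clamp_sub_clamp_le (c d x y : ℝ) :
    |max c (min d y) - max c (min d x)| ≤ |y - x| :=
  (abs_max_sub_max_le_max c _ c _).trans (max_le (by simp)
    ((abs_min_sub_min_le_max d y d x).trans (max_le (by simp) le_rfl)))

/-- A function of bounded variation that takes values in `[c, d]` almost everywhere has a
representative of bounded variation in `IsCoeff`. -/
theorem BoundedVariationOn.exists_isCoeff {L c d : ℝ} (hL : 0 < L) {f : ℝ → ℝ}
    (hf : BoundedVariationOn f (Ioo 0 L)) (hc : 0 < c) (hcd : c ≤ d)
    (h : ∀ᵐ x ∂(volOn 0 L), c ≤ f x ∧ f x ≤ d) :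
    ∃ g, IsCoeff c d g ∧ f =ᵐ[volOn 0 L] g ∧ ∃ V v, MonotoneOn V (Ioo 0 L) ∧
      ∀ x ∈ Ioo 0 L, ∀ y ∈ Ioo 0 L, x ≤ y → V y - V x ≤ v ∧ |g y - g x| ≤ V y - V x := by
  have hx₀ : L / 2 ∈ Ioo 0 L := ⟨by linarith, by linarith⟩
  have hlf := hf.locallyBoundedVariationOn
  set V := variationOnFromTo f (Ioo 0 L) (L / 2)
  set w := (eVariationOn f (Ioo 0 L)).toReal
  have hV : MonotoneOn V (Ioo 0 L) := variationOnFromTo.monotoneOn hlf hx₀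
  have hVb : ∀ x, |V x| ≤ w := fun x => variationOnFromTo.abs_le_eVariationOn hf
  have hW : MonotoneOn (V - f) (Ioo 0 L) := variationOnFromTo.sub_self_monotoneOn hlf hx₀
  have hfb : ∀ x ∈ Ioo 0 L, |f x - f (L / 2)| ≤ w := fun x hx => hf.dist_le hx hx₀
  -- Jordan decomposition f = V - (V - f). Both monotone parts extend to monotone, hence measurable,
  -- functions on the line. Clamping to `[c, d]` then makes the bounds hold everywhere and does not
  -- increase the variation.
  obtain ⟨V', hV', eV⟩ := hV.exists_monotone_extension
    ⟨-w, by rintro _ ⟨x, _, rfl⟩; exact (abs_le.1 (hVb x)).1⟩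
    ⟨w, by rintro _ ⟨x, _, rfl⟩; exact (abs_le.1 (hVb x)).2⟩
  obtain ⟨W', hW', eW⟩ := hW.exists_monotone_extension
    ⟨-w - (f (L / 2) + w), by
      rintro _ ⟨x, hx, rfl⟩
      have h1 := (abs_le.1 (hVb x)).1
      have h2 := (abs_le.1 (hfb x hx)).2
      rw [Pi.sub_apply]; linarith⟩
    ⟨w - (f (L / 2) - w), by
      rintro _ ⟨x, hx, rfl⟩
      have h1 := (abs_le.1 (hVb x)).2
      have h2 := (abs_le.1 (hfb x hx)).1
      rw [Pi.sub_apply]; linarith⟩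
  have ef : ∀ x ∈ Ioo 0 L, V' x - W' x = f x := fun x hx => by
    rw [← eV hx, ← eW hx, Pi.sub_apply]; ring
  refine ⟨fun x => max c (min d (V' x - W' x)),
    ⟨measurable_const.max (measurable_const.min (hV'.measurable.sub hW'.measurable)), hc,
      fun x => le_max_left _ _, fun x => max_le hcd (min_le_left _ _)⟩, ?_, V, 2 * w, hV, ?_⟩
  · filter_upwards [h, ae_restrict_mem measurableSet_Ioo] with x hx hxm
    rw [ef x hxm, min_eq_right hx.2, max_eq_right hx.1]
  · intro x hx y hy hxy
    refine ⟨?_, ?_⟩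
    · have h1 := (abs_le.1 (hVb x)).1
      have h2 := (abs_le.1 (hVb y)).2
      linarith
    · refine (abs_clamp_sub_clamp_le _ _ _ _).trans ?_
      rw [ef x hx, ef y hy]
      exact variationOnFromTo.abs_sub_le_sub_of_le hlf hx₀ hx hy hxy

/-- The right limit exists by bounded variation. Were it below `c`, then f < c would hold on an
interval of positive measure. Applied to `a`, this gives a(0⁺) > 0, so that the flux at x = 0
determines a control. -/
theorem BoundedVariationOn.le_rightLim {L c : ℝ} (hL : 0 < L) {f : ℝ → ℝ}
    (hf : BoundedVariationOn f (Ioo 0 L)) (h : ∀ᵐ x ∂(volOn 0 L), c ≤ f x) :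
    c ≤ Function.rightLim f 0 := by
  obtain ⟨l, hl⟩ := hf.exists_tendsto_right 0
  have hnhds : 𝓝[Ioo 0 L ∩ Ioi 0] (0 : ℝ) = 𝓝[>] 0 := by
    rw [inter_eq_left.2 Ioo_subset_Ioi_self, nhdsWithin_Ioo_eq_nhdsGT hL]
  rw [hnhds] at hl
  rw [rightLim_eq_of_tendsto hl]
  by_contra! hlt
  obtain ⟨δ, hδ, hδs⟩ := mem_nhdsGT_iff_exists_Ioo_subset.1
    (inter_mem (hl.eventually (gt_mem_nhds hlt)) (Ioo_mem_nhdsGT hL))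
  have h1 : volume.restrict (Ioo 0 L) (Ioo 0 δ) = 0 := by
    refine measure_mono_null (fun x hx => ?_) (ae_iff.1 h)
    exact not_le.2 (hδs hx).1
  rw [Measure.restrict_apply measurableSet_Ioo, inter_eq_left.2 fun x hx => (hδs hx).2,
    Real.volume_Ioo, ENNReal.ofReal_eq_zero] at h1
  have : (0 : ℝ) < δ := hδ
  linarith

theorem IsCoeff.abs_inv_sub_inv_le {m M : ℝ} {w : ℝ → ℝ} (h : IsCoeff m M w) (x y : ℝ) :
    |(w y)⁻¹ - (w x)⁻¹| ≤ (m ^ 2)⁻¹ * |w y - w x| := by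
  have hx := h.apply_pos x
  have hy := h.apply_pos y
  have hm := h.pos
  rw [inv_sub_inv hy.ne' hx.ne', abs_div, abs_of_pos (mul_pos hy hx), abs_sub_comm, div_eq_inv_mul]
  refine mul_le_mul_of_nonneg_right (inv_anti₀ (by positivity) ?_) (abs_nonneg _)
  rw [sq]
  exact mul_le_mul (h.lower y) (h.lower x) hm.le hy.le

/-- Sidewise controllability of the 1-d wave equation with `BV` coefficients. Elements of
`BV(0, L)` are given by representatives of bounded variation on `(0, L)`. For initial data
`y₀ ∈ H¹(0, L)`, `y₁ ∈ L²(0, L)` let `w` be the uncontrolled solution (`u = 0`); the target `p` has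
to match it at time `L β`. For `y₀ = y₁ = 0` one has `w = 0` and the condition is `p (L β) = 0`. -/
theorem theorem2p1 (L T : ℝ) (hL : 0 < L) (ρ a : ℝ → ℝ)
    (hρBV : BoundedVariationOn ρ (Ioo 0 L)) (haBV : BoundedVariationOn a (Ioo 0 L))
    (ρ₀ ρ₁ a₀ a₁ : ℝ) (hρ₀ : 0 < ρ₀) (ha₀ : 0 < a₀)
    (hρ : ∀ᵐ x ∂(volOn 0 L), ρ₀ ≤ ρ x ∧ ρ x ≤ ρ₁)
    (ha : ∀ᵐ x ∂(volOn 0 L), a₀ ≤ a x ∧ a x ≤ a₁)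
    (β : ℝ) (hβ : β = essSup (fun x => Real.sqrt (ρ x / a x)) (volOn 0 L))
    (hT : L * β < T)
    (y₀ y₁ : ℝ → ℝ) (hy₀ : MemH1 0 L y₀) (hy₁ : MemLp y₁ 2 (volOn 0 L)) :
    ∃ w : ℝ → ℝ → ℝ, IsTheFiniteEnergySolution ρ a L T y₀ y₁ (fun _ => 0) w ∧
      ∀ p : ℝ → ℝ, MemH1 (L * β) T p → p (L * β) = w L (L * β) →
        ∃ u : ℝ → ℝ, MemLp u 2 (volOn 0 T) ∧
          ∃ y : ℝ → ℝ → ℝ, IsTheFiniteEnergySolution ρ a L T y₀ y₁ u y ∧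
            ∀ t ∈ Ioo (L * β) T, y L t = p t := by
  have : NeZero (volOn 0 L) := ⟨by
    rw [Ne, Measure.restrict_eq_zero, Real.volume_Ioo, ENNReal.ofReal_eq_zero]; linarith⟩
  have hρ01 : ρ₀ ≤ ρ₁ := let ⟨x, hx⟩ := hρ.exists; hx.1.trans hx.2
  have ha01 : a₀ ≤ a₁ := let ⟨x, hx⟩ := ha.exists; hx.1.trans hx.2
  have ha₁ : 0 < a₁ := ha₀.trans_le ha01
  have hsup : ∀ᵐ x ∂(volOn 0 L), √(ρ x / a x) ≤ β := by
    rw [hβ]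
    -- A real-valued essential supremum is an almost everywhere bound only if some such bound
    -- exists; the bounds on the coefficients provide one.
    refine ae_le_essSup ⟨√(ρ₁ / a₀), ?_⟩
    rw [eventually_map]
    filter_upwards [hρ, ha] with x h1 h2
    exact Real.sqrt_le_sqrt (div_le_div₀ (hρ₀.le.trans hρ01) h1.2 ha₀ h2.1)
  have hβ0 : 0 ≤ β := let ⟨x, hx⟩ := hsup.exists; (Real.sqrt_nonneg _).trans hx
  obtain ⟨r, hr, hρr, V, v, hV, hVr⟩ := hρBV.exists_isCoeff hL hρ₀ hρ01 hρ
  obtain ⟨α, hα, haα, W, w, hW, hWα⟩ := haBV.exists_isCoeff hL ha₀ ha01 ha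
  have hm : 0 < min ρ₀ a₁⁻¹ := lt_min hρ₀ (inv_pos.2 ha₁)
  have hk : 0 ≤ (a₀ ^ 2)⁻¹ := by positivity
  -- The factor a₀⁻² is the Lipschitz constant of inversion on [a₀, ∞). A single monotone function
  -- dominates the increments of both coefficients.
  have hc : WaveCoeffs (min ρ₀ a₁⁻¹) (max ρ₁ a₀⁻¹) (v + (a₀ ^ 2)⁻¹ * w) β L r
      (fun x => (α x)⁻¹) := by
    refine ⟨hr.mono hm (min_le_left _ _) (le_max_left _ _),
      hα.inv.mono hm (min_le_right _ _) (le_max_right _ _),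
      ⟨fun x => V x + (a₀ ^ 2)⁻¹ * W x, hV.add fun x hx y hy h =>
        mul_le_mul_of_nonneg_left (hW hx hy h) hk, ?_⟩, ?_, hβ0, hL⟩
    · intro x hx y hy hxy
      obtain ⟨h1, h2⟩ := hVr x hx y hy hxy
      obtain ⟨h3, h4⟩ := hWα x hx y hy hxy
      have h5 := hα.abs_inv_sub_inv_le x y
      have h6 := mul_le_mul_of_nonneg_left h3 hk
      have h7 := mul_le_mul_of_nonneg_left h4 hk
      have h8 : 0 ≤ V y - V x := sub_nonneg.2 (hV hx hy hxy)
      have h9 := (abs_nonneg _).trans h5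
      refine ⟨by linarith, by linarith, by linarith⟩
    · filter_upwards [hsup, hρr, haα] with x h1 h2 h3
      rw [← h2, ← h3, ← div_eq_mul_inv]
      exact (Real.sqrt_le_left hβ0).1 h1
  refine sidewise_controllability hc hρr (by simpa only [inv_inv] using haα) ?_ hT hy₀ hy₁
  exact (ha₀.trans_le (haBV.le_rightLim hL (ha.mono fun x h => h.1))).ne'
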